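/- Let $d,m\in\mathbb N$, $t_0\in\mathbb R$. Let $t\mapsto H_t$ (self-adjoint) and $t\mapsto L_{l;t}$ ($l=1,\dots,m$) be continuous functions on $[t_0,\infty)$ with values in the complex $d\times d$ matrices $\mathcal M_d$, and let $w_{l;\cdot}$ be continuous real functions on $[t_0,\infty)$, of any sign; neither the number $m$ nor the $L_l$ are otherwise restricted. The master equation is $$\dot\rho_t=\mathcal G_t(\rho_t):=-i[H_t,\rho_t]+\sum_{l=1}^m w_{l;t}\,\tfrac12\big([L_{l;t},\rho_tL_{l;t}^\dagger]+[L_{l;t}\rho_t,L_{l;t}^\dagger]\big).\qquad(\mathrm{ME})$$ For any continuous rates $r_{l;\cdot}>0$ on $[t_0,\infty)$, let $\varpi_1,\dots,\varpi_m$ be mutually independent Poisson processes on $[t_0,\infty)$ (starting from $0$) with rates $r_{l;t}$, on a filtered probability space, the filtration being such that the increments of $(\varpi_l)_l$ after any time are independent of the past. Let $(\phi,\lambda)$ be an adapted càdlàg solution, with values in $\mathbb C^d\times\mathbb R$, of the Itô equations $$d\phi_t=A_t\phi_t\,dt+\sum_l d\varpi_{l;t}(L_{l;t}\phi_t-\phi_t),\quad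 \phi_{t_0}=z,\qquad d\lambda_t=\lambda_t\sum_l d\varpi_{l;t}\Big(\frac{w_{l;t}}{r_{l;t}}-1\Big),\quad\lambda_{t_0}=1,$$ where $z\in\mathbb C^d$ and $A_t=-iH_t-\sum_l\tfrac12\big(w_{l;t}L_{l;t}^\dagger L_{l;t}-r_{l;t}1\big)$ (integrands of $d\varpi_l$ are taken just before the jump). Put $\sigma_t=\lambda_t\phi_t\phi_t^\dagger$. Then: 1. Almost surely, for all $t\ge t_0$, in integrated form, $$d\sigma_t=\mathcal G_t(\sigma_t)\,dt+\sum_l(d\varpi_{l;t}-r_{l;t}\,dt)\Big(\frac{w_{l;t}}{r_{l;t}}L_{l;t}\sigma_tL_{l;t}^\dagger-\sigma_t\Big),\qquad\sigma_{t_0}=zz^\dagger.$$ 2. For all $t\ge t_0$ the matrix $\sigma_t$ is integrable, and $\rho_t=E(\sigma_t)$ solves (ME) on $[t_0,\infty)$ with $\rho_{t_0}=zz^\dagger$; in particular $\operatorname{Tr}\rho_t=\|z\|^2$. 3. Let $G_{t,s}=\mathcal T\exp\big(-\int_s^t(iH_u+\tfrac12\sum_lw_{l;u}L_{l;u}^\dagger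 L_{l;u})\,du\big)$ be the time-ordered exponential and, for real weights $v_l$, let $$J^{v}_t(\rho)=\sum_l\int_{t_0}^t v_{l;u}\,G_{t,u}L_{l;u}G_{u,t_0}\,\rho\,G_{u,t_0}^\dagger L_{l;u}^\dagger G_{t,u}^\dagger\,du .$$ The contribution to $E(\sigma_t)$ of the trajectories with exactly one jump in $[t_0,t]$ is $$E\big(\sigma_t\mathbf 1_{\{\sum_l\varpi_{l;t}=1\}}\big)=J^{w}_t(zz^\dagger).$$ It is independent of the rates, and $J^w_t=J^{w^+}_t-J^{w^-}_t$ with $w_l^\pm=\max(0,\pm w_l)$ and both $J^{w^\pm}_t$ completely positive. 4. For every $t\ge t_0$ there are completely positive linear maps $\Phi^+_t,\Phi^-_t$ on $\mathcal M_d$, which do not depend on the rates $r_l$, on $z$, or on the realization of the process, such that for every such process $$E(\sigma_t)=\Phi^+_t(zz^\dagger)-\Phi^-_t(zz^\dagger).$$ Their difference has the canonical form $\Phi^+_t(\rho)-\Phi^-_t(\rho)=\sum_{n=1}^{d^2}\operatorname{sign}(f_n)V_n\rho V_n^\dagger$ for all $\rho\in\mathcal M_d$, with some $f_n\in\mathbb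 R$, $V_n\in\mathcal M_d$ depending on $t$. -/

import Mathlib

open MeasureTheory ProbabilityTheory Set
open scoped Matrix Topology ComplexOrder

noncomputable section

namespace Ostensible

/-- Operators on the `d`-dimensional Hilbert space `ℂ^d`. -/
abbrev Op (d : ℕ) := Matrix (Fin d) (Fin d) ℂ

/-- The entrywise integral `∫_a^b F_s ds` of an operator-valued function of time. -/
def timeIntegral {d : ℕ} (F : ℝ → Op d) (a b : ℝ) : Op d :=
  Matrix.of fun i j => ∫ s in a..b, F s i j

/-- The entrywise expectation `E(X)` of a random operator. -/
def expect {Ω : Type*} [MeasurableSpace Ω] {d : ℕ} (P : Measure Ω) (X : Ω → Op d) : Op d :=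
  Matrix.of fun i j => ∫ ω, X ω i j ∂P

/-- The dissipator `D_L(ρ) = ([L, ρ L†] + [L ρ, L†]) / 2`. -/
def dissipator {d : ℕ} (L ρ : Op d) : Op d :=
  (1 / 2 : ℂ) • (⁅L, ρ * Lᴴ⁆ + ⁅L * ρ, Lᴴ⁆)

/-- The right-hand side of the master equation:
`-i [H_t, ρ] + ∑_l w_{l;t} D_{L_{l;t}}(ρ)`. -/
def masterGenerator {d m : ℕ} (H : ℝ → Op d) (L : Fin m → ℝ → Op d) (w : Fin m → ℝ → ℝ)
    (t : ℝ) (ρ : Op d) : Op d :=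
  (-Complex.I) • ⁅H t, ρ⁆ + ∑ l, (w l t : ℂ) • dissipator (L l t) ρ

/-- The drift `A_t = -i H_t - ∑_l (w_{l;t} L_{l;t}† L_{l;t} - r_{l;t} 1) / 2`. -/
def drift {d m : ℕ} (H : ℝ → Op d) (L : Fin m → ℝ → Op d) (w r : Fin m → ℝ → ℝ)
    (t : ℝ) : Op d :=
  (-Complex.I) • H t -
    ∑ l, (1 / 2 : ℂ) • ((w l t : ℂ) • ((L l t)ᴴ * L l t) - (r l t : ℂ) • (1 : Op d))

/-! ### Driving processes and stochastic integrals -/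

/-- `ϖ 0, …, ϖ (m-1)` are mutually independent (inhomogeneous) Poisson processes on `[t₀, ∞)`
with rates `r l`, relative to the filtration `ℱ`: each is adapted, starts from `0`, has
nondecreasing right-continuous paths, has Poisson distributed increments of mean `∫_s^t r l`,
and the increments of the family after time `s` are independent of `ℱ s`. -/
structure IsPoissonSystem {Ω : Type*} [mΩ : MeasurableSpace Ω] (P : Measure Ω)
    (ℱ : Filtration ℝ mΩ) (t₀ : ℝ) {m : ℕ} (r : Fin m → ℝ → ℝ)
    (ϖ : Fin m → ℝ → Ω → ℕ) : Prop where
  adapted : ∀ l t, t₀ ≤ t → Measurable[ℱ t] (ϖ l t)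
  zero : ∀ᵐ ω ∂P, ∀ l, ϖ l t₀ ω = 0
  mono : ∀ᵐ ω ∂P, ∀ l, MonotoneOn (fun t => ϖ l t ω) (Ici t₀)
  right_cont : ∀ᵐ ω ∂P, ∀ l t, t₀ ≤ t → ContinuousWithinAt (fun s => ϖ l s ω) (Ici t) t
  law : ∀ l s t, t₀ ≤ s → s ≤ t →
    P.map (fun ω => ϖ l t ω - ϖ l s ω) = poissonMeasure (∫ u in s..t, r l u).toNNReal
  indep : iIndepFun (fun l ω (t : Ici t₀) => ϖ l t ω) P
  indep_past : ∀ s, t₀ ≤ s →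
    Indep (⨆ l, ⨆ u : Ici s, MeasurableSpace.comap (fun ω => ϖ l u ω - ϖ l s ω) ⊤) (ℱ s) P

/-- The pathwise integral `∫_{(a, b]} f dN` against a nondecreasing right-continuous
`ℕ`-valued path `N`: the sum of `f` over the jump times of `N`, weighted by the jump sizes. -/
def jumpIntegral {E : Type*} [AddCommMonoid E] (N : ℝ → ℕ) (f : ℝ → E) (a b : ℝ) : E :=
  ∑ᶠ s ∈ Ioc a b, (N s - Function.leftLim N s) • f s

/-- The path `x` is right-continuous with left limits on `[t₀, ∞)`. -/
def IsCadlagFrom {E : Type*} [TopologicalSpace E] (t₀ : ℝ) (x : ℝ → E) : Prop :=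
  (∀ t, t₀ ≤ t → ContinuousWithinAt x (Ici t) t) ∧
    ∀ t, t₀ < t → ∃ y, Filter.Tendsto x (𝓝[<] t) (𝓝 y)

/-- `(φ, lam)` is a solution on `[t₀, ∞)` of the linear system
`dφ_t = A_t φ_t dt + ∑_l dϖ_{l;t} (L_{l;t} φ_t - φ_t)`, `φ_{t₀} = z`,
`dλ_t = λ_t ∑_l dϖ_{l;t} (w_{l;t} / r_{l;t} - 1)`, `λ_{t₀} = 1`,
in the Itô sense (integrands of `dϖ` are evaluated immediately before the jump). -/
structure IsOstensibleSolution {Ω : Type*} [mΩ : MeasurableSpace Ω] (P : Measure Ω)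
    (ℱ : Filtration ℝ mΩ) (t₀ : ℝ) {d m : ℕ} (A : ℝ → Op d) (L : Fin m → ℝ → Op d)
    (w r : Fin m → ℝ → ℝ) (ϖ : Fin m → ℝ → Ω → ℕ) (z : Fin d → ℂ)
    (φ : ℝ → Ω → Fin d → ℂ) (lam : ℝ → Ω → ℝ) : Prop where
  adapted_φ : ∀ t, t₀ ≤ t → Measurable[ℱ t] (φ t)
  adapted_lam : ∀ t, t₀ ≤ t → Measurable[ℱ t] (lam t)
  cadlag_φ : ∀ᵐ ω ∂P, IsCadlagFrom t₀ (fun t => φ t ω)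
  cadlag_lam : ∀ᵐ ω ∂P, IsCadlagFrom t₀ (fun t => lam t ω)
  eq_φ : ∀ᵐ ω ∂P, ∀ t, t₀ ≤ t →
    φ t ω = z + (∫ s in t₀..t, A s *ᵥ φ s ω) +
      ∑ l, jumpIntegral (fun s => ϖ l s ω)
        (fun s => L l s *ᵥ Function.leftLim (fun u => φ u ω) s
          - Function.leftLim (fun u => φ u ω) s) t₀ t
  eq_lam : ∀ᵐ ω ∂P, ∀ t, t₀ ≤ t →
    lam t ω = 1 + ∑ l, jumpIntegral (fun s => ϖ l s ω)
        (fun s => Function.leftLim (fun u => lam u ω) s * (w l s / r l s - 1)) t₀ t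

/-- The weighted random operator `σ_t = λ_t φ_t φ_t†`. -/
def sigma {Ω : Type*} {d : ℕ} (φ : ℝ → Ω → Fin d → ℂ) (lam : ℝ → Ω → ℝ) (t : ℝ) (ω : Ω) :
    Op d :=
  (lam t ω : ℂ) • Matrix.vecMulVec (φ t ω) (star (φ t ω))

/-- The coefficient `(w / r) L σ L† - σ` of an innovation process. -/
def jumpCoeff {d : ℕ} (L : Op d) (w r : ℝ) (σ : Op d) : Op d :=
  ((w / r : ℝ) : ℂ) • (L * σ * Lᴴ) - σ

/-! ### Time-ordered exponentials and completely positive maps -/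

/-- The `n`-th term of the time-ordered exponential series, the iterated integral
`∫_{s ≤ u₁ ≤ … ≤ uₙ ≤ t} B_{uₙ} ⋯ B_{u₁}`. -/
def dysonTerm {d : ℕ} (B : ℝ → Op d) (s : ℝ) : ℕ → ℝ → Op d
  | 0, _ => 1
  | n + 1, t => timeIntegral (fun u => B u * dysonTerm B s n u) s t

/-- The time-ordered exponential `T exp (∫_s^t B_u du)`. -/
def timeOrderedExp {d : ℕ} (B : ℝ → Op d) (t s : ℝ) : Op d :=
  ∑' n, dysonTerm B s n t

/-- The propagator `G_{t,s} = T exp (-∫_s^t (i H_u + ∑_l w_{l;u} L_{l;u}† L_{l;u} / 2) du)`. -/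
def propagator {d m : ℕ} (H : ℝ → Op d) (L : Fin m → ℝ → Op d) (w : Fin m → ℝ → ℝ)
    (t s : ℝ) : Op d :=
  timeOrderedExp
    (fun u => -(Complex.I • H u + ∑ l, (w l u / 2 : ℂ) • ((L l u)ᴴ * L l u))) t s

/-- The one-jump operator sum with weights `v`:
`∑_l ∫_{t₀}^t v_{l;u} G_{t,u} L_{l;u} G_{u,t₀} ρ G_{u,t₀}† L_{l;u}† G_{t,u}† du`,
where `G` is the propagator of `(H, L, w)`. -/
def oneJumpMap {d m : ℕ} (H : ℝ → Op d) (L : Fin m → ℝ → Op d) (w v : Fin m → ℝ → ℝ)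
    (t₀ t : ℝ) (ρ : Op d) : Op d :=
  ∑ l, timeIntegral (fun u => (v l u : ℂ) •
    (propagator H L w t u * L l u * propagator H L w u t₀ * ρ *
      (propagator H L w u t₀)ᴴ * (L l u)ᴴ * (propagator H L w t u)ᴴ)) t₀ t

/-- `Φ` is a completely positive linear map: for every `k` the blockwise map `id_k ⊗ Φ`
sends positive semidefinite matrices to positive semidefinite matrices. -/
def IsCompletelyPositive {d : ℕ} (Φ : Op d → Op d) : Prop :=
  IsLinearMap ℂ Φ ∧
    ∀ (k : ℕ) (X : Matrix (Fin k × Fin d) (Fin k × Fin d) ℂ), X.PosSemidef →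
      (Matrix.of fun p q : Fin k × Fin d =>
        Φ (Matrix.of fun i j => X (p.1, i) (q.1, j)) p.2 q.2).PosSemidef

end Ostensible

end

namespace Ostensible

/-! ### Linear evolution equations with continuous coefficients -/

section LinearFlow

/-! Almost surely no two channels jump at the same time. Between jumps λ is constant and φ' = Aφ, so
σ = λφφ† has drift Aσ + σA†, while a jump in channel l replaces σ by (w_l/r_l) L_l σ L_l†. The terms
r_l/2 in A contribute ∑ r_l σ, which is exactly what makes Aσ + σA† equal to the master generator
minus the compensators of the jumps; this is the stochastic equation
(`IsSolutionPath.sigma_equation`). The argument is pathwise: since jumps are finite in number on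
bounded intervals, an integral equation is equivalent to a right derivative together with prescribed
left limits (`isJumpDiff_of_integral_eq`, `IsJumpDiff.eq_integral_add`), and these local data are
easy to compute for a product.

Expectations are treated at once for σ_t g(M_t), where M is the total number of jumps and g is
bounded. With K = -(iH + ∑ w_l L_l†L_l / 2) and E_g = E(σ g(M)) one obtains E_g' = K E_g + E_g K† +
∑ w_l L_l E_{g(·+1)} L_l† (`hasOpDeriv_expect_counted`), from which the rates have cancelled. The
choice g = 1 gives the master equation. The indicators of {0} and {1} give a triangular system,
solved by variation of constants, and its second component is the one-jump operator sum
(`eq_oneJumpMap`). Complete positivity for nonnegative weights holds because conjugations are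
completely positive and sums and time integrals preserve this.

The probabilistic core is the formula E ∫ c₋ dϖ_l = ∫ r_l E(c) ds
(`IsTameProcess.integral_jumpIntegral`): Riemann sums on equidistant grids, independence of each
increment from the past, and dominated convergence. The dominating variable C κ^{M_T} comes from a
Gronwall estimate with jumps (`exists_solutionPath_bound`) and is integrable because Poisson
variables have all exponential moments.

For the last claim, the master equation involves only H, L and w. By uniqueness its flow is linear
and commutes with the adjoint, so its Choi matrix is Hermitian; eigenvectors reshaped into operators
give the canonical form, and the signs of the eigenvalues separate the two completely positive parts
(`exists_completelyPositive_decomposition`). Every E(σ_t) is this flow applied to zz†. -/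

theorem continuousOn_Ici_intervalIntegrable {E : Type*} [NormedAddCommGroup E] {f : ℝ → E} {s a b : ℝ}
    (hf : ContinuousOn f (Ici s)) (ha : s ≤ a) (hb : s ≤ b) :
    IntervalIntegrable f volume a b :=
  (hf.mono fun _ hx => (le_inf ha hb).trans hx.1).intervalIntegrable

variable {E : Type*} [NormedAddCommGroup E] [NormedSpace ℝ E]

theorem hasDerivWithinAt_Ici_integral [CompleteSpace E] {f : ℝ → E} {s t : ℝ}
    (hf : ContinuousOn f (Ici s)) (ht : s ≤ t) :
    HasDerivWithinAt (fun u => ∫ v in s..u, f v) (f t) (Ici s) t := by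
  -- Freezing `f` at `f s` to the left of `s` gives a function that is continuous on the whole line
  -- and agrees with `f` on `[s, ∞)`.
  have hc : Continuous fun u => f (max s u) :=
    hf.comp_continuous (by fun_prop) fun u => mem_Ici.2 (le_max_left _ _)
  have h := (intervalIntegral.integral_hasDerivAt_right (hc.intervalIntegrable s t)
    (hc.stronglyMeasurableAtFilter _ _) hc.continuousAt).hasDerivWithinAt (s := Ici s)
  simp only [max_eq_right ht] at h
  have key : ∀ u ∈ Ici s, ∫ v in s..u, f v = ∫ v in s..u, f (max s v) := fun u hu =>
    intervalIntegral.integral_congr fun v hv => by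
      rw [uIcc_of_le hu] at hv
      simp only [max_eq_right hv.1]
  exact h.congr key (key t ht)

theorem continuousOn_Ici_integral [CompleteSpace E] {f : ℝ → E} {s : ℝ}
    (hf : ContinuousOn f (Ici s)) : ContinuousOn (fun u => ∫ v in s..u, f v) (Ici s) :=
  fun _ ht => (hasDerivWithinAt_Ici_integral hf ht).continuousWithinAt

/-- The common source `g` cancels in the difference, which then satisfies a homogeneous linear
equation with zero initial value; Gronwall's inequality finishes. All later identifications of two
evolutions rest on this uniqueness. -/
theorem eq_of_hasDerivWithinAt_linear {B : ℝ → E →L[ℝ] E} {s : ℝ}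
    (hB : ContinuousOn B (Ici s)) {x y g : ℝ → E}
    (hx : ∀ t, s ≤ t → HasDerivWithinAt x (B t (x t) + g t) (Ici s) t)
    (hy : ∀ t, s ≤ t → HasDerivWithinAt y (B t (y t) + g t) (Ici s) t) (h0 : x s = y s)
    {t : ℝ} (ht : s ≤ t) : x t = y t := by
  obtain ⟨M, hM⟩ := isCompact_Icc.exists_bound_of_continuousOn
    (hB.mono (Icc_subset_Ici_self : Icc s t ⊆ Ici s))
  have h := norm_le_gronwallBound_of_norm_deriv_right_le (f := fun u => x u - y u)
    (f' := fun u => B u (x u - y u)) (δ := 0) (K := M) (ε := 0) (a := s) (b := t)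
    (fun u hu => ((hx u hu.1).continuousWithinAt.sub (hy u hu.1).continuousWithinAt).mono
      Icc_subset_Ici_self)
    (fun u hu => by
      have := ((hx u hu.1).sub (hy u hu.1)).mono (Ici_subset_Ici.2 hu.1)
      rw [add_sub_add_right_eq_sub, ← map_sub] at this
      exact this)
    (by simp [h0])
    (fun u hu => by
      rw [add_zero]
      exact (B u).le_of_opNorm_le (hM u ⟨hu.1, hu.2.le⟩) _) t ⟨ht, le_rfl⟩
  simp only [gronwallBound_ε0, zero_mul] at h
  exact sub_eq_zero.1 (norm_le_zero_iff.1 h)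

/-- The terms of the Volterra series of `x' = B x`, `x(s) = x₀`. -/
noncomputable def volterraTerm (B : ℝ → E →L[ℝ] E) (s : ℝ) (x : E) : ℕ → ℝ → E
  | 0, _ => x
  | n + 1, t => ∫ u in s..t, B u (volterraTerm B s x n u)

/-- The solution of `x' = B x`, `x(s) = x₀` as a Volterra series. -/
noncomputable def linearFlow (B : ℝ → E →L[ℝ] E) (s : ℝ) (x : E) (t : ℝ) : E :=
  ∑' n, volterraTerm B s x n t

theorem linearFlow_self (B : ℝ → E →L[ℝ] E) (s : ℝ) (x : E) : linearFlow B s x s = x := by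
  rw [linearFlow, tsum_eq_single 0 fun n hn => ?_]
  · rfl
  · obtain ⟨k, rfl⟩ := Nat.exists_eq_succ_of_ne_zero hn
    simp [volterraTerm]

/-- Each further integration raises the power of `t - s` by one and supplies the next factor of the
factorial, as in the exponential series. -/
theorem norm_volterraTerm_le {B : ℝ → E →L[ℝ] E} {s : ℝ} (x : E) {M T : ℝ} (hM0 : 0 ≤ M)
    (hM : ∀ u ∈ Icc s T, ‖B u‖ ≤ M) (n : ℕ) :
    ∀ t ∈ Icc s T, ‖volterraTerm B s x n t‖ ≤ ‖x‖ * ((M * (t - s)) ^ n / n.factorial) := by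
  induction n with
  | zero => intro t _; simp [volterraTerm]
  | succ n ih =>
    intro t ht
    have hle : ∀ u ∈ Ioc s t, ‖B u (volterraTerm B s x n u)‖ ≤
        M * (‖x‖ * ((M * (u - s)) ^ n / n.factorial)) := fun u hu =>
      have hu' : u ∈ Icc s T := ⟨hu.1.le, hu.2.trans ht.2⟩
      ((B u).le_of_opNorm_le (hM u hu') _).trans
        (mul_le_mul_of_nonneg_left (ih u hu') hM0)
    refine (intervalIntegral.norm_integral_le_of_norm_le ht.1
      (Filter.Eventually.of_forall hle)
      (Continuous.intervalIntegrable (by fun_prop) _ _)).trans (le_of_eq ?_)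
    have hd : ∀ u ∈ uIcc s t, HasDerivAt
        (fun u => ‖x‖ * ((M * (u - s)) ^ (n + 1) / (n + 1).factorial))
        (M * (‖x‖ * ((M * (u - s)) ^ n / n.factorial))) u := fun u _ => by
      have h := (((((hasDerivAt_id u).sub_const s).const_mul M).pow (n + 1)).div_const
        ((n + 1).factorial : ℝ)).const_mul ‖x‖
      refine HasDerivAt.congr_deriv h ?_
      have : (n.factorial : ℝ) ≠ 0 := by positivity
      have h2 : ((n : ℝ) + 1) ≠ 0 := by positivity
      simp only [Nat.factorial_succ, id, Nat.add_sub_cancel]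
      push_cast
      field_simp
    rw [intervalIntegral.integral_eq_sub_of_hasDerivAt hd
      (Continuous.intervalIntegrable (by fun_prop) _ _)]
    simp

variable [CompleteSpace E] {B : ℝ → E →L[ℝ] E} {s : ℝ}

theorem continuousOn_volterraTerm (hB : ContinuousOn B (Ici s)) (x : E) (n : ℕ) :
    ContinuousOn (volterraTerm B s x n) (Ici s) := by
  induction n with
  | zero => exact continuousOn_const
  | succ n ih => exact continuousOn_Ici_integral (hB.clm_apply ih)

omit [CompleteSpace E] in
-- The majorant is uniform in `t ≤ T`, which is what both the uniform convergence of the series and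
-- its termwise integration require.
theorem exists_volterraTerm_bound (hB : ContinuousOn B (Ici s)) (x : E) (T : ℝ) :
    ∃ M : ℝ, 0 ≤ M ∧ (∀ u ∈ Icc s T, ‖B u‖ ≤ M) ∧
      (Summable fun n : ℕ => ‖x‖ * ((M * (T - s)) ^ n / n.factorial)) ∧
      ∀ n, ∀ t ∈ Icc s T, ‖volterraTerm B s x n t‖ ≤
        ‖x‖ * ((M * (T - s)) ^ n / n.factorial) := by
  obtain ⟨M, hM⟩ := isCompact_Icc.exists_bound_of_continuousOn
    (hB.mono (Icc_subset_Ici_self : Icc s T ⊆ Ici s))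
  refine ⟨max M 0, le_max_right _ _, fun u hu => (hM u hu).trans (le_max_left _ _),
    (Real.summable_pow_div_factorial _).mul_left _, fun n t ht =>
    (norm_volterraTerm_le x (le_max_right M 0)
      (fun u hu => (hM u hu).trans (le_max_left _ _)) n t ht).trans ?_⟩
  have : 0 ≤ t - s := sub_nonneg.2 ht.1
  have h0 : 0 ≤ max M 0 := le_max_right _ _
  gcongr
  exact ht.2

theorem summable_volterraTerm (hB : ContinuousOn B (Ici s)) (x : E) {t : ℝ} (ht : s ≤ t) :
    Summable fun n => volterraTerm B s x n t := by
  obtain ⟨M, -, -, hs, h⟩ := exists_volterraTerm_bound hB x t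
  exact Summable.of_norm_bounded hs fun n => h n t ⟨ht, le_rfl⟩

theorem continuousOn_linearFlow (hB : ContinuousOn B (Ici s)) (x : E) :
    ContinuousOn (linearFlow B s x) (Ici s) := by
  intro t ht
  -- The horizon is `t + 1` because `[s, t + 1]` is a neighbourhood of `t` within `[s, ∞)`, whereas
  -- `[s, t]` need not be one.
  obtain ⟨M, -, -, hs, h⟩ := exists_volterraTerm_bound hB x (t + 1)
  have hc : ContinuousOn (linearFlow B s x) (Icc s (t + 1)) :=
    continuousOn_tsum (fun n => (continuousOn_volterraTerm hB x n).mono Icc_subset_Ici_self) hs h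
  refine (hc t ⟨ht, by linarith⟩).mono_of_mem_nhdsWithin ?_
  filter_upwards [self_mem_nhdsWithin, mem_nhdsWithin_of_mem_nhds (Iio_mem_nhds (lt_add_one t))]
    with u hu hu' using ⟨hu, hu'.le⟩

/-- Applying `B` and integrating term by term shifts the Volterra series by one index; only the
constant term is left over. -/
theorem linearFlow_eq_integral (hB : ContinuousOn B (Ici s)) (x : E) {t : ℝ} (ht : s ≤ t) :
    linearFlow B s x t = x + ∫ u in s..t, B u (linearFlow B s x u) := by
  obtain ⟨M, hM0, hM, hs, h⟩ := exists_volterraTerm_bound hB x t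
  have hI : HasSum (fun n => ∫ u in s..t, B u (volterraTerm B s x n u))
      (∫ u in s..t, B u (linearFlow B s x u)) := by
    refine intervalIntegral.hasSum_integral_of_dominated_convergence
      (fun n _ => M * (‖x‖ * ((M * (t - s)) ^ n / n.factorial))) (fun n => ?_) (fun n => ?_)
      ?_ ?_ ?_
    · exact (continuousOn_Ici_intervalIntegrable
        (hB.clm_apply (continuousOn_volterraTerm hB x n)) le_rfl ht).def'.aestronglyMeasurable
    · refine Filter.Eventually.of_forall fun u hu => ?_
      rw [uIoc_of_le ht] at hu
      have hu' : u ∈ Icc s t := ⟨hu.1.le, hu.2⟩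
      exact ((B u).le_of_opNorm_le (hM u hu') _).trans
        (mul_le_mul_of_nonneg_left (h n u hu') hM0)
    · exact Filter.Eventually.of_forall fun _ _ => hs.mul_left M
    · exact intervalIntegrable_const
    · refine Filter.Eventually.of_forall fun u hu => ?_
      rw [uIoc_of_le ht] at hu
      exact (B u).hasSum (summable_volterraTerm hB x hu.1.le).hasSum
  rw [linearFlow, (summable_volterraTerm hB x ht).tsum_eq_zero_add]
  exact congrArg (x + ·) hI.tsum_eq

theorem hasDerivWithinAt_linearFlow (hB : ContinuousOn B (Ici s)) (x : E) {t : ℝ} (ht : s ≤ t) :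
    HasDerivWithinAt (linearFlow B s x) (B t (linearFlow B s x t)) (Ici s) t :=
  ((hasDerivWithinAt_Ici_integral (hB.clm_apply (continuousOn_linearFlow hB x)) ht).const_add
    x).congr (fun _ hu => linearFlow_eq_integral hB x hu) (linearFlow_eq_integral hB x ht)

end LinearFlow

/-! ### Operator-valued differential equations -/

section OperatorODE

variable {d : ℕ}

/-- Entrywise derivative on `[s, ∞)` of an operator-valued function. -/
def HasOpDeriv (X : ℝ → Op d) (X' : Op d) (s t : ℝ) : Prop :=
  ∀ i j, HasDerivWithinAt (fun u => X u i j) (X' i j) (Ici s) t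

/-- Arrays of entries carry the sup norm, so this is the bridge from operators to the linear theory
in normed spaces. -/
theorem HasOpDeriv.pi {X : ℝ → Op d} {X' : Op d} {s t : ℝ} (h : HasOpDeriv X X' s t) :
    HasDerivWithinAt (fun u => (fun i j => X u i j : Fin d → Fin d → ℂ)) (fun i j => X' i j)
      (Ici s) t :=
  hasDerivWithinAt_pi.2 fun i => hasDerivWithinAt_pi.2 fun j => h i j

theorem hasOpDeriv_of_pi {X : ℝ → Op d} {X' : Op d} {s t : ℝ}
    (h : HasDerivWithinAt (fun u => (fun i j => X u i j : Fin d → Fin d → ℂ))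
      (fun i j => X' i j) (Ici s) t) : HasOpDeriv X X' s t :=
  fun i j => hasDerivWithinAt_pi.1 (hasDerivWithinAt_pi.1 h i) j

theorem HasOpDeriv.mul {X Y : ℝ → Op d} {X' Y' : Op d} {s t : ℝ} (hX : HasOpDeriv X X' s t)
    (hY : HasOpDeriv Y Y' s t) : HasOpDeriv (fun u => X u * Y u) (X' * Y t + X t * Y') s t := by
  intro i j
  simp only [Matrix.mul_apply, Matrix.add_apply, ← Finset.sum_add_distrib]
  exact HasDerivWithinAt.fun_sum fun k _ => (hX i k).mul (hY k j)

theorem HasOpDeriv.add {X Y : ℝ → Op d} {X' Y' : Op d} {s t : ℝ} (hX : HasOpDeriv X X' s t)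
    (hY : HasOpDeriv Y Y' s t) : HasOpDeriv (fun u => X u + Y u) (X' + Y') s t :=
  fun i j => (hX i j).add (hY i j)

theorem HasOpDeriv.const_smul {X : ℝ → Op d} {X' : Op d} {s t : ℝ} (hX : HasOpDeriv X X' s t)
    (c : ℂ) : HasOpDeriv (fun u => c • X u) (c • X') s t :=
  fun i j => (hX i j).const_smul c

theorem HasOpDeriv.congr_deriv {X : ℝ → Op d} {X' X'' : Op d} {s t : ℝ}
    (hX : HasOpDeriv X X' s t) (h : X' = X'') : HasOpDeriv X X'' s t :=
  h ▸ hX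

theorem HasOpDeriv.conjTranspose {X : ℝ → Op d} {X' : Op d} {s t : ℝ}
    (hX : HasOpDeriv X X' s t) : HasOpDeriv (fun u => (X u)ᴴ) X'ᴴ s t :=
  fun i j => (hX j i).star

theorem hasOpDeriv_const (C : Op d) (s t : ℝ) : HasOpDeriv (fun _ => C) 0 s t :=
  fun _ _ => hasDerivWithinAt_const _ _ _

theorem HasOpDeriv.mono {X : ℝ → Op d} {X' : Op d} {s s' t : ℝ} (hX : HasOpDeriv X X' s t)
    (h : s ≤ s') : HasOpDeriv X X' s' t :=
  fun i j => (hX i j).mono (Ici_subset_Ici.2 h)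

theorem continuousOn_of_hasOpDeriv {X X' : ℝ → Op d} {s : ℝ}
    (hX : ∀ t, s ≤ t → HasOpDeriv X (X' t) s t) : ContinuousOn X (Ici s) :=
  continuousOn_pi.2 fun i => continuousOn_pi.2 fun j => fun t ht => (hX t ht i j).continuousWithinAt

theorem continuousOn_entry {X : ℝ → Op d} {S : Set ℝ} (h : ContinuousOn X S) (i j : Fin d) :
    ContinuousOn (fun t => X t i j) S :=
  continuousOn_pi.1 (continuousOn_pi.1 h i) j

theorem continuousOn_conjTranspose {X : ℝ → Op d} {S : Set ℝ} (h : ContinuousOn X S) :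
    ContinuousOn (fun t => (X t)ᴴ) S :=
  (continuous_id.matrix_conjTranspose).comp_continuousOn h

theorem hasOpDeriv_timeIntegral {F : ℝ → Op d} {s t : ℝ} (hF : ContinuousOn F (Ici s))
    (ht : s ≤ t) : HasOpDeriv (timeIntegral F s) (F t) s t :=
  fun i j => hasDerivWithinAt_Ici_integral (continuousOn_entry hF i j) ht

@[simp]
theorem timeIntegral_self (F : ℝ → Op d) (s : ℝ) : timeIntegral F s s = 0 := by
  ext i j
  simp [timeIntegral]

/-- A linear map on operators as a continuous real-linear map on arrays of entries. -/
noncomputable def opCLM (f : Op d →ₗ[ℂ] Op d) :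
    (Fin d → Fin d → ℂ) →L[ℝ] (Fin d → Fin d → ℂ) :=
  LinearMap.toContinuousLinearMap
    (((Matrix.ofLinearEquiv ℂ).symm.toLinearMap ∘ₗ f ∘ₗ
      (Matrix.ofLinearEquiv ℂ).toLinearMap).restrictScalars ℝ)

theorem continuousOn_opCLM {f : ℝ → Op d →ₗ[ℂ] Op d} {S : Set ℝ}
    (hf : ∀ X, ContinuousOn (fun t => f t X) S) : ContinuousOn (fun t => opCLM (f t)) S :=
  continuousOn_clm_apply.2 fun X => hf (Matrix.of X)

/-- The solution of the operator equation `X' = f X`, `X(s) = X₀`. -/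
noncomputable def opFlow (f : ℝ → Op d →ₗ[ℂ] Op d) (s : ℝ) (X : Op d) (t : ℝ) : Op d :=
  Matrix.of (linearFlow (fun u => opCLM (f u)) s (Matrix.of.symm X) t)

theorem opFlow_self (f : ℝ → Op d →ₗ[ℂ] Op d) (s : ℝ) (X : Op d) : opFlow f s X s = X := by
  rw [opFlow, linearFlow_self]
  rfl

theorem hasOpDeriv_opFlow {f : ℝ → Op d →ₗ[ℂ] Op d} {s : ℝ}
    (hf : ∀ X, ContinuousOn (fun t => f t X) (Ici s)) (X : Op d) {t : ℝ} (ht : s ≤ t) :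
    HasOpDeriv (opFlow f s X) (f t (opFlow f s X t)) s t :=
  hasOpDeriv_of_pi (hasDerivWithinAt_linearFlow (continuousOn_opCLM hf) _ ht)

theorem eq_of_hasOpDeriv {f : ℝ → Op d →ₗ[ℂ] Op d} {s : ℝ}
    (hf : ∀ X, ContinuousOn (fun t => f t X) (Ici s)) {X Y g : ℝ → Op d}
    (hX : ∀ t, s ≤ t → HasOpDeriv X (f t (X t) + g t) s t)
    (hY : ∀ t, s ≤ t → HasOpDeriv Y (f t (Y t) + g t) s t) (h0 : X s = Y s)
    {t : ℝ} (ht : s ≤ t) : X t = Y t :=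
  eq_of_hasDerivWithinAt_linear (E := Fin d → Fin d → ℂ) (continuousOn_opCLM hf)
    (x := fun u i j => X u i j) (y := fun u i j => Y u i j) (g := fun u i j => g u i j)
    (fun t ht => (hX t ht).pi) (fun t ht => (hY t ht).pi) h0 ht

theorem eq_of_hasOpDeriv_same {X Y g : ℝ → Op d} {s : ℝ}
    (hX : ∀ t, s ≤ t → HasOpDeriv X (g t) s t) (hY : ∀ t, s ≤ t → HasOpDeriv Y (g t) s t)
    (h0 : X s = Y s) {t : ℝ} (ht : s ≤ t) : X t = Y t :=
  eq_of_hasOpDeriv (f := fun _ => 0) (g := g) (fun _ => continuousOn_const)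
    (fun t ht => by simpa using hX t ht) (fun t ht => by simpa using hY t ht) h0 ht

theorem timeIntegral_eq_integral {F : ℝ → Fin d → Fin d → ℂ} {a b : ℝ}
    (h : IntervalIntegrable F volume a b) :
    timeIntegral (fun u => Matrix.of (F u)) a b = Matrix.of (∫ u in a..b, F u) := by
  ext i j
  exact (((ContinuousLinearMap.proj (R := ℝ) (φ := fun _ : Fin d => ℂ) j).comp
    (ContinuousLinearMap.proj (R := ℝ) (φ := fun _ : Fin d => Fin d → ℂ) i)).intervalIntegral_comp_comm
      h)

/-- Left multiplication by a time-dependent operator. -/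
noncomputable def leftMul (B : ℝ → Op d) (t : ℝ) : Op d →ₗ[ℂ] Op d :=
  LinearMap.mulLeft ℂ (B t)

theorem continuousOn_leftMul {B : ℝ → Op d} {S : Set ℝ} (hB : ContinuousOn B S) (X : Op d) :
    ContinuousOn (fun t => leftMul B t X) S :=
  hB.mul continuousOn_const

/-- The Dyson recursion is the Volterra recursion for left multiplication by `B`, started at the
identity. Convergence and the differential equation of the time-ordered exponential are inherited
from there. -/
theorem dysonTerm_eq_volterraTerm {B : ℝ → Op d} {s : ℝ} (hB : ContinuousOn B (Ici s)) (n : ℕ)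
    {t : ℝ} (ht : s ≤ t) : dysonTerm B s n t =
      Matrix.of (volterraTerm (fun u => opCLM (leftMul B u)) s (Matrix.of.symm 1) n t) := by
  induction n generalizing t with
  | zero => rfl
  | succ n ih =>
    have hc := continuousOn_opCLM (continuousOn_leftMul hB)
    rw [volterraTerm, ← timeIntegral_eq_integral (continuousOn_Ici_intervalIntegrable
      (hc.clm_apply (continuousOn_volterraTerm hc _ n)) le_rfl ht)]
    ext i j
    refine intervalIntegral.integral_congr fun u hu => ?_
    rw [uIcc_of_le ht] at hu
    rw [ih hu.1]
    rfl

theorem timeOrderedExp_eq_opFlow {B : ℝ → Op d} {s : ℝ} (hB : ContinuousOn B (Ici s))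
    {t : ℝ} (ht : s ≤ t) : timeOrderedExp B t s = opFlow (leftMul B) s 1 t := by
  rw [timeOrderedExp, tsum_congr fun n => dysonTerm_eq_volterraTerm hB n ht]
  rfl

theorem timeOrderedExp_self (B : ℝ → Op d) (s : ℝ) : timeOrderedExp B s s = 1 := by
  rw [timeOrderedExp, tsum_eq_single 0 fun n hn => ?_]
  · rfl
  · obtain ⟨k, rfl⟩ := Nat.exists_eq_succ_of_ne_zero hn
    simp [dysonTerm]

theorem HasOpDeriv.congr {X Y : ℝ → Op d} {X' : Op d} {s t : ℝ} (hX : HasOpDeriv X X' s t)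
    (h : ∀ u, s ≤ u → Y u = X u) (ht : s ≤ t) : HasOpDeriv Y X' s t :=
  fun i j => (hX i j).congr (fun u hu => by rw [h u hu]) (by rw [h t ht])

theorem hasOpDeriv_timeOrderedExp {B : ℝ → Op d} {s : ℝ} (hB : ContinuousOn B (Ici s))
    {t : ℝ} (ht : s ≤ t) :
    HasOpDeriv (fun u => timeOrderedExp B u s) (B t * timeOrderedExp B t s) s t := by
  rw [timeOrderedExp_eq_opFlow hB ht]
  exact (hasOpDeriv_opFlow (continuousOn_leftMul hB) 1 ht).congr
    (fun u hu => timeOrderedExp_eq_opFlow hB hu) ht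

/-- The inverse of the time-ordered exponential. -/
noncomputable def timeOrderedExpInv (B : ℝ → Op d) (t s : ℝ) : Op d :=
  (timeOrderedExp (fun u => -(B u)ᴴ) t s)ᴴ

/-- Taking adjoints in `X' = -B† X` puts the coefficient on the right, which is the equation
satisfied by an inverse. -/
theorem hasOpDeriv_timeOrderedExpInv {B : ℝ → Op d} {s : ℝ} (hB : ContinuousOn B (Ici s))
    {t : ℝ} (ht : s ≤ t) : HasOpDeriv (fun u => timeOrderedExpInv B u s)
      (-(timeOrderedExpInv B t s * B t)) s t := by
  have h := (hasOpDeriv_timeOrderedExp (B := fun u => -(B u)ᴴ)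
    (continuousOn_conjTranspose hB).neg ht).conjTranspose
  simpa [timeOrderedExpInv] using h

theorem timeOrderedExpInv_mul {B : ℝ → Op d} {s : ℝ} (hB : ContinuousOn B (Ici s))
    {t : ℝ} (ht : s ≤ t) : timeOrderedExpInv B t s * timeOrderedExp B t s = 1 := by
  refine eq_of_hasOpDeriv_same (g := fun _ => 0)
    (X := fun u => timeOrderedExpInv B u s * timeOrderedExp B u s) (Y := fun _ => 1)
    (fun u hu => ?_) (fun u _ => hasOpDeriv_const _ _ _) ?_ ht
  · convert (hasOpDeriv_timeOrderedExpInv hB hu).mul (hasOpDeriv_timeOrderedExp hB hu) using 1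
    rw [neg_mul, Matrix.mul_assoc, neg_add_cancel]
  · simp [timeOrderedExpInv, timeOrderedExp_self]

theorem timeOrderedExp_mul_inv {B : ℝ → Op d} {s : ℝ} (hB : ContinuousOn B (Ici s))
    {t : ℝ} (ht : s ≤ t) : timeOrderedExp B t s * timeOrderedExpInv B t s = 1 :=
  mul_eq_one_comm.1 (timeOrderedExpInv_mul hB ht)

/-- As functions of the upper time both sides solve `X' = B X` and equal `1` at time `u`. The right
side makes the dependence on the lower time explicit, which gives continuity in `u` and the
variation of constants formula. -/
theorem timeOrderedExp_eq_mul_inv {B : ℝ → Op d} {s u t : ℝ} (hB : ContinuousOn B (Ici s))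
    (hu : s ≤ u) (ht : u ≤ t) :
    timeOrderedExp B t u = timeOrderedExp B t s * timeOrderedExpInv B u s := by
  have hB' := hB.mono (Ici_subset_Ici.2 hu)
  refine eq_of_hasOpDeriv (f := leftMul B) (g := fun _ => 0) (continuousOn_leftMul hB')
    (X := fun t => timeOrderedExp B t u)
    (Y := fun t => timeOrderedExp B t s * timeOrderedExpInv B u s)
    (fun v hv => ?_) (fun v hv => ?_) ?_ ht
  · simpa [leftMul] using hasOpDeriv_timeOrderedExp hB' hv
  · have := ((hasOpDeriv_timeOrderedExp hB (hu.trans hv)).mono hu).mul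
      (hasOpDeriv_const (timeOrderedExpInv B u s) u v)
    simpa [leftMul, Matrix.mul_assoc] using this
  · simp only [timeOrderedExp_self, timeOrderedExp_mul_inv hB hu]

theorem continuousOn_timeOrderedExp {B : ℝ → Op d} {s : ℝ} (hB : ContinuousOn B (Ici s)) :
    ContinuousOn (fun u => timeOrderedExp B u s) (Ici s) :=
  continuousOn_of_hasOpDeriv fun _ => hasOpDeriv_timeOrderedExp hB

theorem continuousOn_timeOrderedExpInv {B : ℝ → Op d} {s : ℝ} (hB : ContinuousOn B (Ici s)) :
    ContinuousOn (fun u => timeOrderedExpInv B u s) (Ici s) :=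
  continuousOn_of_hasOpDeriv fun _ => hasOpDeriv_timeOrderedExpInv hB

end OperatorODE

/-! ### Completely positive maps -/

section CompletelyPositive

variable {d : ℕ}

/-- The blockwise map `id_k ⊗ Φ`. -/
def blockMap (Φ : Op d → Op d) {k : ℕ} (X : Matrix (Fin k × Fin d) (Fin k × Fin d) ℂ) :
    Matrix (Fin k × Fin d) (Fin k × Fin d) ℂ :=
  Matrix.of fun p q => Φ (Matrix.of fun i j => X (p.1, i) (q.1, j)) p.2 q.2

theorem isCompletelyPositive_sum {ι : Type*} (S : Finset ι) {Φ : ι → Op d → Op d}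
    (h : ∀ l ∈ S, IsCompletelyPositive (Φ l)) :
    IsCompletelyPositive fun ρ => ∑ l ∈ S, Φ l ρ := by
  refine ⟨⟨fun x y => ?_, fun c x => ?_⟩, fun k X hX => ?_⟩
  · rw [← Finset.sum_add_distrib]
    exact Finset.sum_congr rfl fun l hl => (h l hl).1.map_add x y
  · rw [Finset.smul_sum]
    exact Finset.sum_congr rfl fun l hl => (h l hl).1.map_smul c x
  · convert Matrix.posSemidef_sum S (fun l hl => (h l hl).2 k X hX) using 1
    ext p q
    simp [Matrix.sum_apply]

/-- The extension of `ρ ↦ K ρ K†` by the identity is conjugation by `1 ⊗ K`, and conjugation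
preserves positive semidefiniteness. -/
theorem blockMap_conj {k : ℕ} (K : Op d) (X : Matrix (Fin k × Fin d) (Fin k × Fin d) ℂ) :
    blockMap (fun ρ => K * ρ * Kᴴ) X =
      Matrix.kroneckerMap (· * ·) (1 : Matrix (Fin k) (Fin k) ℂ) K * X *
        (Matrix.kroneckerMap (· * ·) (1 : Matrix (Fin k) (Fin k) ℂ) K)ᴴ := by
  ext ⟨p, i⟩ ⟨q, j⟩
  simp only [blockMap, Matrix.of_apply, Matrix.mul_apply, Fintype.sum_prod_type,
    Matrix.conjTranspose_apply, Matrix.kroneckerMap_apply, Matrix.one_apply]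
  simp only [ite_mul, one_mul, zero_mul, apply_ite star, star_zero, mul_ite, mul_zero,
    Finset.sum_ite_irrel, Finset.sum_const_zero, Finset.sum_ite_eq, Finset.mem_univ, if_true]

theorem isCompletelyPositive_conj {c : ℝ} (hc : 0 ≤ c) (K : Op d) :
    IsCompletelyPositive fun ρ => (c : ℂ) • (K * ρ * Kᴴ) := by
  refine ⟨⟨fun x y => ?_, fun a x => ?_⟩, fun k X hX => ?_⟩
  · simp [Matrix.mul_add, Matrix.add_mul]
  · simp [smul_comm a]
  · have h := ((hX.mul_mul_conjTranspose_same
      (Matrix.kroneckerMap (· * ·) (1 : Matrix (Fin k) (Fin k) ℂ) K)).smul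
        (a := (c : ℂ)) (by exact_mod_cast hc))
    rw [← blockMap_conj] at h
    exact h

/-- The blockwise map commutes with the entrywise integral, and the quadratic form of an integral is
the integral of nonnegative quadratic forms. -/
theorem isCompletelyPositive_timeIntegral {Φ : ℝ → Op d → Op d} {a b : ℝ} (hab : a ≤ b)
    (h : ∀ u ∈ Icc a b, IsCompletelyPositive (Φ u))
    (hc : ∀ ρ, ContinuousOn (fun u => Φ u ρ) (Icc a b)) :
    IsCompletelyPositive fun ρ => timeIntegral (fun u => Φ u ρ) a b := by
  have hint : ∀ ρ i j, IntervalIntegrable (fun u => Φ u ρ i j) volume a b := fun ρ i j =>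
    (continuousOn_entry (hc ρ) i j).intervalIntegrable_of_Icc hab
  refine ⟨⟨fun x y => ?_, fun c x => ?_⟩, fun k X hX => ?_⟩
  · ext i j
    simp only [timeIntegral, Matrix.of_apply, Matrix.add_apply]
    rw [← intervalIntegral.integral_add (hint x i j) (hint y i j)]
    refine intervalIntegral.integral_congr fun u hu => ?_
    rw [uIcc_of_le hab] at hu
    simp [(h u hu).1.map_add x y]
  · ext i j
    simp only [timeIntegral, Matrix.of_apply, Matrix.smul_apply]
    rw [← intervalIntegral.integral_smul]
    refine intervalIntegral.integral_congr fun u hu => ?_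
    rw [uIcc_of_le hab] at hu
    simp [(h u hu).1.map_smul c x]
  · have hI : ∀ p q, IntervalIntegrable (fun u => blockMap (Φ u) X p q) volume a b :=
      fun p q => hint _ _ _
    have hpos : ∀ u ∈ Icc a b, (blockMap (Φ u) X).PosSemidef := fun u hu => (h u hu).2 k X hX
    change (Matrix.of fun p q => ∫ u in a..b, blockMap (Φ u) X p q).PosSemidef
    rw [Matrix.posSemidef_iff_dotProduct_mulVec]
    refine ⟨?_, fun x => ?_⟩
    · ext p q
      simp only [Matrix.conjTranspose_apply, Matrix.of_apply]
      rw [Complex.star_def, ← intervalIntegral.intervalIntegral_conj]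
      refine intervalIntegral.integral_congr fun u hu => ?_
      rw [uIcc_of_le hab] at hu
      exact (hpos u hu).1.apply p q
    · have key : star x ⬝ᵥ ((Matrix.of fun p q => ∫ u in a..b, blockMap (Φ u) X p q) *ᵥ x) =
          ∫ u in a..b, star x ⬝ᵥ (blockMap (Φ u) X *ᵥ x) := by
        simp only [dotProduct, Matrix.mulVec, Matrix.of_apply]
        have hq : ∀ p q, IntervalIntegrable (fun u => blockMap (Φ u) X p q * x q) volume a b :=
          fun p q => (hI p q).mul_const _
        have hp : ∀ p, IntervalIntegrable (fun u => ∑ q, blockMap (Φ u) X p q * x q)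
          volume a b := fun p => by
            simpa only [Finset.sum_fn] using IntervalIntegrable.sum Finset.univ fun q _ => hq p q
        rw [intervalIntegral.integral_finsetSum fun p _ => (hp p).const_mul _]
        refine Finset.sum_congr rfl fun p _ => ?_
        rw [intervalIntegral.integral_const_mul,
          intervalIntegral.integral_finsetSum fun q _ => hq p q]
        simp_rw [intervalIntegral.integral_mul_const]
      rw [key]
      -- Nonnegativity in the complex order includes a vanishing imaginary part, so the integrand is
      -- real and the sign can be read off from a real integral.
      have hre : ∫ u in a..b, star x ⬝ᵥ (blockMap (Φ u) X *ᵥ x) =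
          ((∫ u in a..b, (star x ⬝ᵥ (blockMap (Φ u) X *ᵥ x)).re : ℝ) : ℂ) := by
        rw [← intervalIntegral.integral_ofReal]
        refine intervalIntegral.integral_congr fun u hu => ?_
        rw [uIcc_of_le hab] at hu
        have h0 := (Matrix.posSemidef_iff_dotProduct_mulVec.1 (hpos u hu)).2 x
        exact Complex.ext rfl (Complex.nonneg_iff.1 h0).2.symm
      rw [hre]
      refine Complex.zero_le_real.2 (intervalIntegral.integral_nonneg hab fun u hu => ?_)
      exact (Complex.nonneg_iff.1
        ((Matrix.posSemidef_iff_dotProduct_mulVec.1 (hpos u hu)).2 x)).1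

end CompletelyPositive

/-! ### Canonical form of Hermiticity-preserving maps -/

section Choi

variable {d : ℕ}

/-- The Choi matrix of a linear map. -/
def choiMatrix (Φ : Op d →ₗ[ℂ] Op d) : Matrix (Fin d × Fin d) (Fin d × Fin d) ℂ :=
  Matrix.of fun p q => Φ (Matrix.single p.2 q.2 1) p.1 q.1

theorem choiMatrix_isHermitian {Φ : Op d →ₗ[ℂ] Op d} (h : ∀ X, Φ Xᴴ = (Φ X)ᴴ) :
    (choiMatrix Φ).IsHermitian := by
  ext p q
  simp only [choiMatrix, Matrix.conjTranspose_apply, Matrix.of_apply]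
  rw [← Matrix.conjTranspose_apply, ← h, Matrix.conjTranspose_single, star_one]

theorem apply_eq_sum_choiMatrix (Φ : Op d →ₗ[ℂ] Op d) (ρ : Op d) (i k : Fin d) :
    Φ ρ i k = ∑ j, ∑ l, ρ j l * choiMatrix Φ (i, j) (k, l) := by
  conv_lhs => rw [Matrix.matrix_eq_sum_single ρ]
  simp only [map_sum, Matrix.sum_apply, choiMatrix, Matrix.of_apply]
  refine Finset.sum_congr rfl fun j _ => Finset.sum_congr rfl fun l _ => ?_
  rw [← mul_one (ρ j l), ← smul_eq_mul, ← Matrix.smul_single, map_smul]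
  simp

/-- Preservation of adjoints makes the Choi matrix Hermitian. In its spectral decomposition each
eigenvector, an array indexed by pairs, is read as an operator `W n`, with the eigenvalue as its
coefficient. -/
theorem exists_canonical_form {Φ : Op d →ₗ[ℂ] Op d} (h : ∀ X, Φ Xᴴ = (Φ X)ᴴ) :
    ∃ (f : Fin (d ^ 2) → ℝ) (W : Fin (d ^ 2) → Op d),
      ∀ ρ, Φ ρ = ∑ n, (f n : ℂ) • (W n * ρ * (W n)ᴴ) := by
  have hC := choiMatrix_isHermitian h
  -- Eigenpairs are naturally indexed by pairs of basis indices; `e` relabels them by `1, …, d²`.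
  let e : Fin (d ^ 2) ≃ Fin d × Fin d := (finCongr (sq d)).trans finProdFinEquiv.symm
  let U := (hC.eigenvectorUnitary : Matrix (Fin d × Fin d) (Fin d × Fin d) ℂ)
  have hU : ∀ p q, choiMatrix Φ p q =
      ∑ n, (hC.eigenvalues n : ℂ) * (U p n * star (U q n)) := by
    intro p q
    conv_lhs => rw [hC.spectral_theorem]
    simp [Matrix.mul_apply, Matrix.diagonal_apply, Unitary.conjStarAlgAut_apply, U]
    refine Finset.sum_congr rfl fun n _ => ?_
    ring
  refine ⟨fun n => hC.eigenvalues (e n), fun n => Matrix.of fun i j => U (i, j) (e n),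
    fun ρ => ?_⟩
  rw [e.sum_comp (fun n => (hC.eigenvalues n : ℂ) • ((Matrix.of fun i j => U (i, j) n) * ρ *
    (Matrix.of fun i j => U (i, j) n)ᴴ))]
  ext i k
  rw [apply_eq_sum_choiMatrix]
  simp only [hU, Matrix.sum_apply, Matrix.smul_apply, Matrix.mul_apply, Matrix.of_apply,
    Matrix.conjTranspose_apply, Finset.mul_sum, Finset.sum_mul, smul_eq_mul]
  calc _ = ∑ j, ∑ n, ∑ l, ρ j l * ((hC.eigenvalues n : ℂ) * (U (i, j) n * star (U (k, l) n))) :=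
        Finset.sum_congr rfl fun j _ => Finset.sum_comm
    _ = ∑ n, ∑ j, ∑ l, ρ j l * ((hC.eigenvalues n : ℂ) * (U (i, j) n * star (U (k, l) n))) :=
        Finset.sum_comm
    _ = _ := by
        refine Finset.sum_congr rfl fun n _ => ?_
        rw [Finset.sum_comm]
        refine Finset.sum_congr rfl fun l _ => Finset.sum_congr rfl fun j _ => ?_
        ring

theorem real_sign_mul_abs (x : ℝ) : Real.sign x * |x| = x := by
  rcases lt_trichotomy x 0 with h | rfl | h
  · rw [Real.sign_of_neg h, abs_of_neg h]; ring
  · simp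
  · rw [Real.sign_of_pos h, abs_of_pos h]; ring

/-- The positive parts of the eigenvalues go to one map and the negative parts to the other.
Absorbing `√|f n|` into the operator leaves only the sign as coefficient. -/
theorem exists_completelyPositive_decomposition {Φ : Op d →ₗ[ℂ] Op d}
    (h : ∀ X, Φ Xᴴ = (Φ X)ᴴ) :
    ∃ Φp Φm : Op d → Op d, IsCompletelyPositive Φp ∧ IsCompletelyPositive Φm ∧
      (∀ ρ, Φ ρ = Φp ρ - Φm ρ) ∧
      ∃ (f : Fin (d ^ 2) → ℝ) (V : Fin (d ^ 2) → Op d), ∀ ρ,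
        Φp ρ - Φm ρ = ∑ n, (Real.sign (f n) : ℂ) • (V n * ρ * (V n)ᴴ) := by
  obtain ⟨f, W, hW⟩ := exists_canonical_form h
  have hdiff : ∀ ρ, Φ ρ = ∑ n, ((max (f n) 0 : ℝ) : ℂ) • (W n * ρ * (W n)ᴴ) -
      ∑ n, ((max (-f n) 0 : ℝ) : ℂ) • (W n * ρ * (W n)ᴴ) := fun ρ => by
    rw [hW, ← Finset.sum_sub_distrib]
    refine Finset.sum_congr rfl fun n _ => ?_
    rw [← sub_smul, ← Complex.ofReal_sub]
    congr 2
    rcases le_total (f n) 0 with h0 | h0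
    · rw [max_eq_right h0, max_eq_left (neg_nonneg.2 h0)]; ring
    · rw [max_eq_left h0, max_eq_right (neg_nonpos.2 h0)]; ring
  refine ⟨_, _, isCompletelyPositive_sum Finset.univ fun n _ =>
    isCompletelyPositive_conj (le_max_right (f n) 0) (W n),
    isCompletelyPositive_sum Finset.univ fun n _ =>
    isCompletelyPositive_conj (le_max_right (-f n) 0) (W n), hdiff, f,
    fun n => (Real.sqrt |f n| : ℂ) • W n, fun ρ => ?_⟩
  rw [← hdiff, hW]
  refine Finset.sum_congr rfl fun n _ => ?_
  rw [Matrix.conjTranspose_smul, Matrix.smul_mul, Matrix.smul_mul, Matrix.mul_smul, smul_smul,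
    smul_smul]
  congr 1
  rw [Complex.star_def, Complex.conj_ofReal, mul_assoc, ← Complex.ofReal_mul,
    Real.mul_self_sqrt (abs_nonneg _), ← Complex.ofReal_mul, real_sign_mul_abs]

end Choi

/-! ### The propagator, the one-jump map and the master equation -/

section Master

variable {d m : ℕ}

/-- The effective non-Hermitian generator `-(i H + ∑_l w_l L_l† L_l / 2)`. -/
noncomputable def effectiveGenerator (H : ℝ → Op d) (L : Fin m → ℝ → Op d) (w : Fin m → ℝ → ℝ)
    (t : ℝ) : Op d :=
  -(Complex.I • H t + ∑ l, (w l t / 2 : ℂ) • ((L l t)ᴴ * L l t))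

/-- The jump part `∑_l v_l L_l ρ L_l†` of the generator. -/
noncomputable def jumpPart (L : Fin m → ℝ → Op d) (v : Fin m → ℝ → ℝ) (t : ℝ) (ρ : Op d) : Op d :=
  ∑ l, (v l t : ℂ) • (L l t * ρ * (L l t)ᴴ)

/-- The linear map `ρ ↦ K ρ + ρ K†`. -/
noncomputable def sandwichGenerator (K : ℝ → Op d) (t : ℝ) : Op d →ₗ[ℂ] Op d :=
  LinearMap.mulLeft ℂ (K t) + LinearMap.mulRight ℂ (K t)ᴴ

/-- The jump part as a linear map. -/
noncomputable def jumpPartLin (L : Fin m → ℝ → Op d) (v : Fin m → ℝ → ℝ) (t : ℝ) :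
    Op d →ₗ[ℂ] Op d :=
  ∑ l, (v l t : ℂ) • (LinearMap.mulRight ℂ (L l t)ᴴ ∘ₗ LinearMap.mulLeft ℂ (L l t))

theorem sandwichGenerator_apply (K : ℝ → Op d) (t : ℝ) (ρ : Op d) :
    sandwichGenerator K t ρ = K t * ρ + ρ * (K t)ᴴ := rfl

theorem jumpPartLin_apply (L : Fin m → ℝ → Op d) (v : Fin m → ℝ → ℝ) (t : ℝ) (ρ : Op d) :
    jumpPartLin L v t ρ = jumpPart L v t ρ := by
  simp [jumpPartLin, jumpPart]

variable {t₀ : ℝ} {H : ℝ → Op d} {L : Fin m → ℝ → Op d} {w v : Fin m → ℝ → ℝ}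

theorem continuousOn_ofReal_smul {f : ℝ → ℝ} {X : ℝ → Op d} {S : Set ℝ}
    (hf : ContinuousOn f S) (hX : ContinuousOn X S) :
    ContinuousOn (fun t => (f t : ℂ) • X t) S :=
  (Complex.continuous_ofReal.comp_continuousOn hf).smul hX

theorem continuousOn_effectiveGenerator {S : Set ℝ} (hH : ContinuousOn H S)
    (hL : ∀ l, ContinuousOn (L l) S) (hw : ∀ l, ContinuousOn (w l) S) :
    ContinuousOn (effectiveGenerator H L w) S := by
  have h1 : ContinuousOn (fun t => Complex.I • H t) S :=
    (continuous_const_smul Complex.I).comp_continuousOn hH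
  have h2 : ∀ l, ContinuousOn (fun t => (w l t / 2 : ℂ) • ((L l t)ᴴ * L l t)) S := fun l =>
    ((Complex.continuous_ofReal.comp_continuousOn (hw l)).div_const 2).smul
      ((continuousOn_conjTranspose (hL l)).mul (hL l))
  have h3 : ContinuousOn (fun t => ∑ l, (w l t / 2 : ℂ) • ((L l t)ᴴ * L l t)) S :=
    continuousOn_finsetSum _ fun l _ => h2 l
  exact (h1.add h3).neg

theorem continuousOn_jumpPart {S : Set ℝ} (hL : ∀ l, ContinuousOn (L l) S)
    (hv : ∀ l, ContinuousOn (v l) S) {X : ℝ → Op d} (hX : ContinuousOn X S) :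
    ContinuousOn (fun t => jumpPart L v t (X t)) S :=
  continuousOn_finsetSum _ fun l _ => continuousOn_ofReal_smul (hv l)
    (((hL l).mul hX).mul (continuousOn_conjTranspose (hL l)))

theorem continuousOn_sandwichGenerator {K : ℝ → Op d} {S : Set ℝ} (hK : ContinuousOn K S)
    (X : Op d) : ContinuousOn (fun t => sandwichGenerator K t X) S :=
  (hK.mul continuousOn_const).add (continuousOn_const.mul (continuousOn_conjTranspose hK))

/-- Commutator and anticommutator terms combine into `Kρ + ρK†`; self-adjointness of `H` makes the
adjoint of `-iH` provide the second half of the commutator. Only the gain terms `w L ρ L†` remain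
apart. -/
theorem masterGenerator_eq {t : ℝ} (hHsa : (H t).IsHermitian) (ρ : Op d) :
    masterGenerator H L w t ρ =
      sandwichGenerator (effectiveGenerator H L w) t ρ + jumpPart L w t ρ := by
  simp only [masterGenerator, sandwichGenerator_apply, effectiveGenerator, jumpPart, dissipator,
    Ring.lie_def, Matrix.conjTranspose_neg, Matrix.conjTranspose_add, Matrix.conjTranspose_sum,
    Matrix.conjTranspose_smul, hHsa.eq, Matrix.conjTranspose_mul,
    Matrix.conjTranspose_conjTranspose, Complex.star_def, Complex.conj_I, map_div₀,
    Complex.conj_ofReal, Complex.conj_ofNat, Matrix.neg_mul, Matrix.mul_neg, Matrix.add_mul,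
    Matrix.mul_add, Finset.sum_mul, Finset.mul_sum, Matrix.smul_mul, Matrix.mul_smul]
  have h : ∀ l, (w l t : ℂ) • (1 / 2 : ℂ) • (L l t * (ρ * (L l t)ᴴ) - ρ * (L l t)ᴴ * L l t +
      (L l t * ρ * (L l t)ᴴ - (L l t)ᴴ * (L l t * ρ))) =
      (w l t : ℂ) • (L l t * ρ * (L l t)ᴴ) - (w l t / 2 : ℂ) • ((L l t)ᴴ * L l t * ρ)
        - (w l t / 2 : ℂ) • (ρ * ((L l t)ᴴ * L l t)) := fun l => by
    simp only [Matrix.mul_assoc]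
    module
  simp only [h, Finset.sum_sub_distrib]
  module

/-- The generator of the master equation as a linear map. -/
noncomputable def masterLin (H : ℝ → Op d) (L : Fin m → ℝ → Op d) (w : Fin m → ℝ → ℝ)
    (t : ℝ) : Op d →ₗ[ℂ] Op d :=
  sandwichGenerator (effectiveGenerator H L w) t + jumpPartLin L w t

theorem masterLin_apply (t : ℝ) (ρ : Op d) : masterLin H L w t ρ =
    sandwichGenerator (effectiveGenerator H L w) t ρ + jumpPart L w t ρ := by
  rw [masterLin, LinearMap.add_apply, jumpPartLin_apply]

theorem masterLin_conjTranspose (t : ℝ) (ρ : Op d) :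
    masterLin H L w t ρᴴ = (masterLin H L w t ρ)ᴴ := by
  simp only [masterLin_apply, sandwichGenerator_apply, jumpPart, Matrix.conjTranspose_add,
    Matrix.conjTranspose_mul, Matrix.conjTranspose_sum, Matrix.conjTranspose_smul,
    Matrix.conjTranspose_conjTranspose, Complex.star_def, Complex.conj_ofReal, Matrix.mul_assoc]
  rw [add_comm (effectiveGenerator H L w t * ρᴴ)]

theorem trace_masterGenerator (t : ℝ) (ρ : Op d) : (masterGenerator H L w t ρ).trace = 0 := by
  simp [masterGenerator, dissipator, Ring.lie_def, Matrix.trace_add, Matrix.trace_sub,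
    Matrix.trace_sum, Matrix.trace_mul_comm (H t), Matrix.trace_mul_comm _ (ρ * _),
    Matrix.trace_mul_comm (_ * ρ)]

section

variable (hH : ContinuousOn H (Ici t₀)) (hL : ∀ l, ContinuousOn (L l) (Ici t₀))
  (hw : ∀ l, ContinuousOn (w l) (Ici t₀)) (hv : ∀ l, ContinuousOn (v l) (Ici t₀))

include hH hL hw

theorem continuousOn_masterLin (X : Op d) : ContinuousOn (fun t => masterLin H L w t X) (Ici t₀) := by
  simp only [masterLin_apply]
  exact (continuousOn_sandwichGenerator (continuousOn_effectiveGenerator hH hL hw) X).add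
    (continuousOn_jumpPart hL hw continuousOn_const)

/-- The flow of the master equation is linear. -/
theorem exists_masterFlow : ∃ Λ : ℝ → Op d →ₗ[ℂ] Op d,
    (∀ ρ, Λ t₀ ρ = ρ) ∧
    (∀ ρ t, t₀ ≤ t → HasOpDeriv (fun u => Λ u ρ) (masterLin H L w t (Λ t ρ)) t₀ t) ∧
    ∀ t, t₀ ≤ t → ∀ ρ, Λ t ρᴴ = (Λ t ρ)ᴴ := by
  have hc := continuousOn_masterLin hH hL hw
  let F := opFlow (masterLin H L w) t₀
  have hF : ∀ ρ t, t₀ ≤ t → HasOpDeriv (F ρ) (masterLin H L w t (F ρ t) + 0) t₀ t :=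
    fun ρ t ht => by simpa using hasOpDeriv_opFlow hc ρ ht
  -- Additivity, homogeneity and compatibility with the adjoint all come from uniqueness: in each
  -- case both sides solve the same initial value problem.
  have hadd : ∀ x y t, t₀ ≤ t → F (x + y) t = F x t + F y t := fun x y t ht => by
    refine eq_of_hasOpDeriv (g := fun _ => 0) hc (hF (x + y)) (Y := fun t => F x t + F y t)
      (fun u hu => ?_) (by simp only [F, opFlow_self]) ht
    simpa only [map_add, add_zero] using (hF x u hu).add (hF y u hu)
  have hsmul : ∀ (c : ℂ) x t, t₀ ≤ t → F (c • x) t = c • F x t := fun c x t ht => by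
    refine eq_of_hasOpDeriv (g := fun _ => 0) hc (hF (c • x)) (Y := fun t => c • F x t)
      (fun u hu => ?_) (by simp only [F, opFlow_self]) ht
    simpa only [map_smul, add_zero] using (hF x u hu).const_smul c
  have hstar : ∀ x t, t₀ ≤ t → F xᴴ t = (F x t)ᴴ := fun x t ht => by
    refine eq_of_hasOpDeriv (g := fun _ => 0) hc (hF xᴴ) (Y := fun t => (F x t)ᴴ)
      (fun u hu => ?_) (by simp only [F, opFlow_self]) ht
    rw [add_zero, masterLin_conjTranspose]
    simpa only [add_zero] using (hF x u hu).conjTranspose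
  classical
  -- Linearity is known only for `t ≥ t₀`; the zero map is a default value for earlier times.
  refine ⟨fun t => if ht : t₀ ≤ t then
    { toFun := fun ρ => F ρ t, map_add' := fun x y => hadd x y t ht,
      map_smul' := fun c x => hsmul c x t ht } else 0, fun ρ => ?_, fun ρ t ht => ?_,
    fun t ht ρ => ?_⟩
  · simp [F, opFlow_self]
  · have h := (hF ρ t ht).congr (Y := fun u => (if hu : t₀ ≤ u then
      ({ toFun := fun ρ => F ρ u, map_add' := fun x y => hadd x y u hu,
         map_smul' := fun c x => hsmul c x u hu } : Op d →ₗ[ℂ] Op d) else 0) ρ)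
      (fun u hu => by simp [hu]) ht
    simpa [ht] using h
  · simpa [ht] using hstar ρ t ht

theorem propagator_eq_mul_inv {u t : ℝ} (hu : t₀ ≤ u) (ht : u ≤ t) :
    propagator H L w t u = propagator H L w t t₀ *
      timeOrderedExpInv (effectiveGenerator H L w) u t₀ :=
  timeOrderedExp_eq_mul_inv (continuousOn_effectiveGenerator hH hL hw) hu ht

theorem continuousOn_propagator_right (t : ℝ) :
    ContinuousOn (fun u => propagator H L w t u) (Icc t₀ t) :=
  (continuousOn_const.mul ((continuousOn_timeOrderedExpInv
    (continuousOn_effectiveGenerator hH hL hw)).mono Icc_subset_Ici_self)).congr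
    fun _ hu => propagator_eq_mul_inv hH hL hw hu.1 hu.2

theorem continuousOn_propagator_left :
    ContinuousOn (fun u => propagator H L w u t₀) (Ici t₀) :=
  continuousOn_timeOrderedExp (continuousOn_effectiveGenerator hH hL hw)

include hv

theorem continuousOn_oneJump_integrand (t : ℝ) (l : Fin m) (ρ : Op d) :
    ContinuousOn (fun u => (v l u : ℂ) •
      (propagator H L w t u * L l u * propagator H L w u t₀ * ρ *
        (propagator H L w u t₀)ᴴ * (L l u)ᴴ * (propagator H L w t u)ᴴ)) (Icc t₀ t) := by
  have h1 := continuousOn_propagator_right hH hL hw t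
  have h2 := (continuousOn_propagator_left hH hL hw).mono (Icc_subset_Ici_self : Icc t₀ t ⊆ _)
  have h3 := (hL l).mono (Icc_subset_Ici_self : Icc t₀ t ⊆ _)
  exact continuousOn_ofReal_smul ((hv l).mono Icc_subset_Ici_self)
    ((((((h1.mul h3).mul h2).mul continuousOn_const).mul (continuousOn_conjTranspose h2)).mul
      (continuousOn_conjTranspose h3)).mul (continuousOn_conjTranspose h1))

theorem isCompletelyPositive_oneJumpMap {t : ℝ} (ht : t₀ ≤ t)
    (hpos : ∀ l u, t₀ ≤ u → 0 ≤ v l u) : IsCompletelyPositive (oneJumpMap H L w v t₀ t) := by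
  refine isCompletelyPositive_sum Finset.univ fun l _ =>
    isCompletelyPositive_timeIntegral ht (fun u hu => ?_)
      (continuousOn_oneJump_integrand hH hL hw hv t l)
  convert isCompletelyPositive_conj (hpos l u hu.1)
    (propagator H L w t u * L l u * propagator H L w u t₀) using 2
  simp only [Matrix.conjTranspose_mul, Matrix.mul_assoc]

end

theorem oneJumpMap_sub (hH : ContinuousOn H (Ici t₀)) (hL : ∀ l, ContinuousOn (L l) (Ici t₀))
    (hw : ∀ l, ContinuousOn (w l) (Ici t₀)) {v₁ v₂ : Fin m → ℝ → ℝ}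
    (h₁ : ∀ l, ContinuousOn (v₁ l) (Ici t₀)) (h₂ : ∀ l, ContinuousOn (v₂ l) (Ici t₀))
    {t : ℝ} (ht : t₀ ≤ t) (ρ : Op d) :
    oneJumpMap H L w (fun l u => v₁ l u - v₂ l u) t₀ t ρ =
      oneJumpMap H L w v₁ t₀ t ρ - oneJumpMap H L w v₂ t₀ t ρ := by
  simp only [oneJumpMap]
  rw [← Finset.sum_sub_distrib]
  refine Finset.sum_congr rfl fun l _ => ?_
  ext i j
  simp only [timeIntegral, Matrix.of_apply, Matrix.sub_apply]
  rw [← intervalIntegral.integral_sub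
    ((continuousOn_entry (continuousOn_oneJump_integrand hH hL hw h₁ t l ρ)
      i j).intervalIntegrable_of_Icc ht)
    ((continuousOn_entry (continuousOn_oneJump_integrand hH hL hw h₂ t l ρ)
      i j).intervalIntegrable_of_Icc ht)]
  simp only [Complex.ofReal_sub, sub_smul, Matrix.sub_apply]

theorem timeIntegral_sum {ι : Type*} (S : Finset ι) {F : ι → ℝ → Op d} {a b : ℝ} (hab : a ≤ b)
    (hF : ∀ l ∈ S, ContinuousOn (F l) (Icc a b)) :
    timeIntegral (fun u => ∑ l ∈ S, F l u) a b = ∑ l ∈ S, timeIntegral (F l) a b := by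
  ext i j
  simp only [timeIntegral, Matrix.of_apply, Matrix.sum_apply]
  exact intervalIntegral.integral_finsetSum fun l hl =>
    (continuousOn_entry (hF l hl) i j).intervalIntegrable_of_Icc hab

theorem timeIntegral_mul_mul {F : ℝ → Op d} {a b : ℝ} (hab : a ≤ b)
    (hF : ContinuousOn F (Icc a b)) (A B : Op d) :
    timeIntegral (fun u => A * F u * B) a b = A * timeIntegral F a b * B := by
  have hint : ∀ i j, IntervalIntegrable (fun u => F u i j) volume a b := fun i j =>
    (continuousOn_entry hF i j).intervalIntegrable_of_Icc hab
  ext i j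
  simp only [timeIntegral, Matrix.of_apply, Matrix.mul_apply]
  rw [intervalIntegral.integral_finsetSum]
  · refine Finset.sum_congr rfl fun k _ => ?_
    rw [intervalIntegral.integral_mul_const, intervalIntegral.integral_finsetSum]
    · simp_rw [intervalIntegral.integral_const_mul]
    · exact fun l _ => (hint l k).const_mul _
  · intro k _
    refine IntervalIntegrable.mul_const ?_ _
    simpa only [Finset.sum_fn] using
      IntervalIntegrable.sum Finset.univ fun l _ => (hint l k).const_mul (A i l)

/-- By the product rule the conjugation of `X` by the propagator solves the same equation with the
same initial value. This describes the trajectories without jumps. -/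
theorem eq_propagator_conj (hH : ContinuousOn H (Ici t₀)) (hL : ∀ l, ContinuousOn (L l) (Ici t₀))
    (hw : ∀ l, ContinuousOn (w l) (Ici t₀)) {R : ℝ → Op d} {X : Op d} (h0 : R t₀ = X)
    (hR : ∀ t, t₀ ≤ t → HasOpDeriv R
      (sandwichGenerator (effectiveGenerator H L w) t (R t)) t₀ t) {t : ℝ} (ht : t₀ ≤ t) :
    R t = propagator H L w t t₀ * X * (propagator H L w t t₀)ᴴ := by
  have hK := continuousOn_effectiveGenerator hH hL hw
  refine eq_of_hasOpDeriv (g := fun _ => 0) (continuousOn_sandwichGenerator hK)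
    (fun u hu => by simpa using hR u hu) (Y := fun t => propagator H L w t t₀ * X *
      (propagator H L w t t₀)ᴴ) (fun u hu => ?_) ?_ ht
  · have hG := hasOpDeriv_timeOrderedExp hK hu
    refine ((hG.mul (hasOpDeriv_const X t₀ u)).mul hG.conjTranspose).congr_deriv ?_
    change _ = sandwichGenerator (effectiveGenerator H L w) u (timeOrderedExp
      (effectiveGenerator H L w) u t₀ * X * (timeOrderedExp (effectiveGenerator H L w) u t₀)ᴴ) + 0
    simp only [sandwichGenerator_apply, Matrix.conjTranspose_mul, Matrix.mul_assoc,
      Matrix.mul_zero, add_zero]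
  · simp [h0, propagator, timeOrderedExp_self]

/-- Variation of constants: with `F = G⁻¹`, the solution of the equation with source `J(G X G†)` is
`G_t (∫ F_u J(G_u X G_u†) F_u† du) G_t†`, and the cocycle relation `G_{t,u} = G_t F_u` turns it into
the one-jump operator sum. -/
theorem eq_oneJumpMap (hH : ContinuousOn H (Ici t₀)) (hL : ∀ l, ContinuousOn (L l) (Ici t₀))
    (hw : ∀ l, ContinuousOn (w l) (Ici t₀)) {R₀ R₁ : ℝ → Op d} {X : Op d} (h0 : R₀ t₀ = X)
    (hR₀ : ∀ t, t₀ ≤ t → HasOpDeriv R₀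
      (sandwichGenerator (effectiveGenerator H L w) t (R₀ t)) t₀ t) (h1 : R₁ t₀ = 0)
    (hR₁ : ∀ t, t₀ ≤ t → HasOpDeriv R₁
      (sandwichGenerator (effectiveGenerator H L w) t (R₁ t) + jumpPart L w t (R₀ t)) t₀ t)
    {t : ℝ} (ht : t₀ ≤ t) : R₁ t = oneJumpMap H L w w t₀ t X := by
  have hK := continuousOn_effectiveGenerator hH hL hw
  set G := fun u => propagator H L w u t₀ with hGdef
  set F := fun u => timeOrderedExpInv (effectiveGenerator H L w) u t₀ with hFdef
  have hG : ContinuousOn G (Ici t₀) := continuousOn_propagator_left hH hL hw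
  have hF : ContinuousOn F (Ici t₀) := continuousOn_timeOrderedExpInv hK
  have hGF : ∀ u, t₀ ≤ u → G u * F u = 1 := fun u hu => timeOrderedExp_mul_inv hK hu
  let T := fun (l : Fin m) (u : ℝ) => F u * ((w l u : ℂ) • (L l u * (G u * X * (G u)ᴴ) *
    (L l u)ᴴ)) * (F u)ᴴ
  have hT : ∀ l, ContinuousOn (T l) (Ici t₀) := fun l =>
    (hF.mul (continuousOn_ofReal_smul (hw l) (((hL l).mul ((hG.mul continuousOn_const).mul
      (continuousOn_conjTranspose hG))).mul (continuousOn_conjTranspose (hL l))))).mul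
      (continuousOn_conjTranspose hF)
  have hsum : ContinuousOn (fun u => ∑ l, T l u) (Ici t₀) := continuousOn_finsetSum _ fun l _ => hT l
  have hTsum : ∀ u, ∑ l, T l u = F u * jumpPart L w u (G u * X * (G u)ᴴ) * (F u)ᴴ := fun u => by
    simp only [T, jumpPart, Finset.mul_sum, Finset.sum_mul]
  have hone : oneJumpMap H L w w t₀ t X =
      G t * timeIntegral (fun u => ∑ l, T l u) t₀ t * (G t)ᴴ := by
    rw [timeIntegral_sum _ ht fun l _ => (hT l).mono Icc_subset_Ici_self, Finset.mul_sum,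
      Finset.sum_mul]
    refine Finset.sum_congr rfl fun l _ => ?_
    rw [← timeIntegral_mul_mul ht ((hT l).mono Icc_subset_Ici_self)]
    ext i j
    refine intervalIntegral.integral_congr fun u hu => ?_
    rw [uIcc_of_le ht] at hu
    have := propagator_eq_mul_inv hH hL hw hu.1 hu.2
    simp only [this, T, hGdef, hFdef, Matrix.conjTranspose_mul, Matrix.mul_assoc,
      Matrix.mul_smul, Matrix.smul_mul]
  rw [hone]
  refine eq_of_hasOpDeriv (g := fun u => jumpPart L w u (R₀ u)) (continuousOn_sandwichGenerator hK)
    hR₁ (Y := fun t => G t * timeIntegral (fun u => ∑ l, T l u) t₀ t * (G t)ᴴ) (fun u hu => ?_)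
    ?_ ht
  · have hGd := hasOpDeriv_timeOrderedExp hK hu
    refine ((hGd.mul (hasOpDeriv_timeIntegral hsum hu)).mul hGd.conjTranspose).congr_deriv ?_
    -- Differentiating the integral leaves the source pulled back by `F`; the outer factors `G`
    -- cancel it.
    have h3 : G u * (∑ l, T l u) * (G u)ᴴ = jumpPart L w u (R₀ u) := by
      rw [hTsum, eq_propagator_conj hH hL hw h0 hR₀ hu]
      have h4 : (F u)ᴴ * (G u)ᴴ = 1 := by
        rw [← Matrix.conjTranspose_mul, hGF u hu, Matrix.conjTranspose_one]
      calc _ = (G u * F u) * jumpPart L w u (G u * X * (G u)ᴴ) * ((F u)ᴴ * (G u)ᴴ) := by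
            simp only [Matrix.mul_assoc]
        _ = _ := by rw [h4, hGF u hu, Matrix.one_mul, Matrix.mul_one]
    change (effectiveGenerator H L w u * G u * timeIntegral (fun u => ∑ l, T l u) t₀ u
      + G u * (∑ l, T l u)) * (G u)ᴴ + G u * timeIntegral (fun u => ∑ l, T l u) t₀ u *
        (effectiveGenerator H L w u * G u)ᴴ = _
    rw [Matrix.add_mul, h3, sandwichGenerator_apply, Matrix.conjTranspose_mul]
    simp only [Matrix.mul_assoc]
    abel
  · simp [h1]

end Master

/-! ### Counting paths and their jump integrals -/

section JumpPath

/-- Nondecreasing right-continuous `ℕ`-valued paths on `[t₀, ∞)`. -/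
structure IsJumpPath (t₀ : ℝ) (N : ℝ → ℕ) : Prop where
  mono : MonotoneOn N (Ici t₀)
  right_cont : ∀ t, t₀ ≤ t → ContinuousWithinAt N (Ici t) t

/-- The size of the jump of a counting path. -/
noncomputable def jumpSize (N : ℝ → ℕ) (s : ℝ) : ℕ := N s - Function.leftLim N s

variable {t₀ : ℝ} {N : ℝ → ℕ}

theorem jumpIntegral_def {E : Type*} [AddCommMonoid E] (N : ℝ → ℕ) (f : ℝ → E) (a b : ℝ) :
    jumpIntegral N f a b = ∑ᶠ s ∈ Ioc a b, jumpSize N s • f s := rfl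

theorem leftLim_eq_of_eventually {n : ℕ} {t : ℝ} (h : ∀ᶠ s in 𝓝[<] t, N s = n) :
    Function.leftLim N t = n :=
  leftLim_eq_of_tendsto (tendsto_const_nhds.congr' (h.mono fun _ hs => hs.symm))

namespace IsJumpPath

theorem eventually_right (h : IsJumpPath t₀ N) {t : ℝ} (ht : t₀ ≤ t) :
    ∀ᶠ s in 𝓝[≥] t, N s = N t := by
  have := h.right_cont t ht
  rw [ContinuousWithinAt, nhds_discrete, Filter.tendsto_pure] at this
  exact this

/-- On `[t₀, t)` the path takes natural values bounded by `N t`, so its supremum is attained; by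
monotonicity the path is constant from that time until `t`. -/
theorem eventually_left (h : IsJumpPath t₀ N) {t : ℝ} (ht : t₀ < t) :
    ∀ᶠ s in 𝓝[<] t, N s = Function.leftLim N t := by
  suffices hs : ∃ n, ∀ᶠ s in 𝓝[<] t, N s = n by
    obtain ⟨n, hn⟩ := hs
    rwa [leftLim_eq_of_eventually hn]
  have hbdd : BddAbove (N '' Ico t₀ t) := ⟨N t, by
    rintro _ ⟨s, hs, rfl⟩
    exact h.mono hs.1 (mem_Ici.2 ht.le) hs.2.le⟩
  obtain ⟨s₀, hs₀, hmax⟩ := Nat.sSup_mem (⟨_, mem_image_of_mem N ⟨le_rfl, ht⟩⟩ :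
    (N '' Ico t₀ t).Nonempty) hbdd
  refine ⟨N s₀, ?_⟩
  filter_upwards [Ioo_mem_nhdsLT hs₀.2] with s hs
  have hs' : s ∈ Ico t₀ t := ⟨hs₀.1.trans hs.1.le, hs.2⟩
  exact le_antisymm (hmax ▸ le_csSup hbdd (mem_image_of_mem N hs'))
    (h.mono hs₀.1 hs'.1 hs.1.le)

theorem leftLim_le (h : IsJumpPath t₀ N) {t : ℝ} (ht : t₀ < t) :
    Function.leftLim N t ≤ N t := by
  obtain ⟨s, hs, hs'⟩ := ((h.eventually_left ht).and (Ioo_mem_nhdsLT ht)).exists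
  exact hs ▸ h.mono hs'.1.le ht.le hs'.2.le

theorem le_leftLim (h : IsJumpPath t₀ N) {s t : ℝ} (hs : t₀ ≤ s) (ht : s < t) :
    N s ≤ Function.leftLim N t := by
  obtain ⟨u, hu, hu'⟩ := ((h.eventually_left (hs.trans_lt ht)).and (Ioo_mem_nhdsLT ht)).exists
  exact hu ▸ h.mono hs (hs.trans hu'.1.le) hu'.1.le

theorem leftLim_add_jumpSize (h : IsJumpPath t₀ N) {t : ℝ} (ht : t₀ < t) :
    Function.leftLim N t + jumpSize N t = N t :=
  Nat.add_sub_cancel' (h.leftLim_le ht)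

theorem eventually_left_zero (h : IsJumpPath t₀ N) {t : ℝ} (ht : t₀ < t) :
    ∀ᶠ s in 𝓝[<] t, jumpSize N s = 0 := by
  obtain ⟨a, ha, hc⟩ := (mem_nhdsLT_iff_exists_Ioo_subset' ht).1 (h.eventually_left ht)
  filter_upwards [Ioo_mem_nhdsLT ha] with s hs
  have : ∀ᶠ u in 𝓝[<] s, N u = Function.leftLim N t := by
    filter_upwards [Ioo_mem_nhdsLT hs.1] with u hu using hc ⟨hu.1, hu.2.trans hs.2⟩
  rw [jumpSize, leftLim_eq_of_eventually this, show N s = _ from hc hs, Nat.sub_self]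

theorem eventually_right_zero (h : IsJumpPath t₀ N) {t : ℝ} (ht : t₀ ≤ t) :
    ∀ᶠ s in 𝓝[>] t, ∀ u ∈ Ioc t s, jumpSize N u = 0 := by
  obtain ⟨a, ha, hc⟩ := mem_nhdsGE_iff_exists_Ico_subset.1 (h.eventually_right ht)
  filter_upwards [Ioo_mem_nhdsGT ha] with s hs u hu
  have hua : u < a := hu.2.trans_lt hs.2
  have : ∀ᶠ v in 𝓝[<] u, N v = N t := by
    filter_upwards [Ioo_mem_nhdsLT hu.1] with v hv using hc ⟨hv.1.le, hv.2.trans hua⟩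
  rw [jumpSize, leftLim_eq_of_eventually this, show N u = N t from hc ⟨hu.1.le, hua⟩, Nat.sub_self]

/-- The path is strictly increasing along its jump times and takes only the finitely many values up
to `N b`. Hence the finitely supported sum in `jumpIntegral` is never replaced by the default value
zero. -/
theorem finite_jumps (h : IsJumpPath t₀ N) {a : ℝ} (ha : t₀ ≤ a) (b : ℝ) :
    {s ∈ Ioc a b | jumpSize N s ≠ 0}.Finite := by
  have hlt : ∀ s ∈ {s ∈ Ioc a b | jumpSize N s ≠ 0}, Function.leftLim N s < N s := fun s hs =>
    Nat.lt_of_sub_ne_zero hs.2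
  have hmono : StrictMonoOn N {s ∈ Ioc a b | jumpSize N s ≠ 0} := fun s hs s' hs' hss' =>
    (h.le_leftLim (ha.trans hs.1.1.le) hss').trans_lt (hlt s' hs')
  refine Set.Finite.of_finite_image ((finite_Iic (N b)).subset ?_) hmono.injOn
  rintro _ ⟨s, hs, rfl⟩
  exact h.mono (ha.trans hs.1.1.le) (ha.trans (hs.1.1.le.trans hs.1.2)) hs.1.2

variable {E : Type*} [AddCommMonoid E]

theorem finite_support (h : IsJumpPath t₀ N) {a : ℝ} (ha : t₀ ≤ a) (b : ℝ) (f : ℝ → E) :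
    (Ioc a b ∩ Function.support fun s => jumpSize N s • f s).Finite :=
  (h.finite_jumps ha b).subset fun s hs => ⟨hs.1, fun h0 => hs.2 (by simp [h0])⟩

theorem jumpIntegral_eq_sum (h : IsJumpPath t₀ N) {a : ℝ} (ha : t₀ ≤ a) (b : ℝ) (f : ℝ → E) :
    jumpIntegral N f a b = ∑ s ∈ (h.finite_jumps ha b).toFinset, jumpSize N s • f s := by
  rw [jumpIntegral_def]
  refine finsum_mem_eq_sum_of_inter_support_eq _ ?_
  ext s
  simp only [mem_inter_iff, Function.mem_support, Finite.coe_toFinset, mem_ofPred_eq]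
  refine ⟨fun hs => ⟨⟨hs.1, fun h0 => hs.2 (by simp [h0])⟩, hs.2⟩, fun hs => ⟨hs.1.1, hs.2⟩⟩

theorem jumpIntegral_add (h : IsJumpPath t₀ N) (f : ℝ → E) {a b c : ℝ} (ha : t₀ ≤ a)
    (hab : a ≤ b) (hbc : b ≤ c) :
    jumpIntegral N f a b + jumpIntegral N f b c = jumpIntegral N f a c := by
  simp only [jumpIntegral_def]
  rw [← Ioc_union_Ioc_eq_Ioc hab hbc, finsum_mem_union' (Ioc_disjoint_Ioc_of_le le_rfl)
    (h.finite_support ha b f) (h.finite_support (ha.trans hab) c f)]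

theorem eventually_jumpIntegral_right (h : IsJumpPath t₀ N) (f : ℝ → E) {t : ℝ} (ht : t₀ ≤ t) :
    ∀ᶠ s in 𝓝[>] t, jumpIntegral N f t s = 0 := by
  filter_upwards [h.eventually_right_zero ht] with s hs
  exact finsum_mem_of_eqOn_zero fun u hu => by
    change jumpSize N u • f u = 0
    rw [hs u hu, zero_smul]

theorem eventually_jumpIntegral_left (h : IsJumpPath t₀ N) (f : ℝ → E) {t : ℝ} (ht : t₀ < t) :
    ∀ᶠ s in 𝓝[<] t, jumpIntegral N f s t = jumpSize N t • f t := by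
  obtain ⟨a, ha, hc⟩ := (mem_nhdsLT_iff_exists_Ioo_subset' ht).1 (h.eventually_left_zero ht)
  filter_upwards [Ioo_mem_nhdsLT ha] with s hs
  rw [jumpIntegral_def, ← finsum_mem_singleton (a := t) (f := fun s => jumpSize N s • f s)]
  refine finsum_mem_inter_support_eq _ _ _ ?_
  ext u
  simp only [mem_inter_iff, Function.mem_support, mem_Ioc, mem_singleton_iff]
  refine and_congr_left fun hu => ⟨fun hu' => ?_, fun hu' => ⟨hu'.symm ▸ hs.2, hu'.le⟩⟩
  by_contra hne
  refine hu ?_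
  rw [show jumpSize N u = 0 from hc ⟨hs.1.trans hu'.1, lt_of_le_of_ne hu'.2 hne⟩, zero_smul]

end IsJumpPath

theorem jumpIntegral_self {E : Type*} [AddCommMonoid E] (N : ℝ → ℕ) (f : ℝ → E) (a : ℝ) :
    jumpIntegral N f a a = 0 := by
  rw [jumpIntegral, Ioc_self, finsum_mem_empty]

end JumpPath

/-! ### Càdlàg paths -/

section Cadlag

variable {E : Type*} [NormedAddCommGroup E] {t₀ : ℝ} {x : ℝ → E}

/-- The one-sided limits bound the path near each time, and compactness of the interval makes the
bound global. -/
theorem IsCadlagFrom.exists_bound (h : IsCadlagFrom t₀ x) (T : ℝ) :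
    ∃ C, ∀ t ∈ Icc t₀ T, ‖x t‖ ≤ C := by
  refine isCompact_Icc.induction_on (p := fun S => ∃ C, ∀ t ∈ S ∩ Icc t₀ T, ‖x t‖ ≤ C)
    ⟨0, by simp⟩ ?_ ?_ ?_ |>.imp fun C hC t ht => hC t ⟨ht, ht⟩
  · rintro S S' hS ⟨C, hC⟩
    exact ⟨C, fun t ht => hC t ⟨hS ht.1, ht.2⟩⟩
  · rintro S S' ⟨C, hC⟩ ⟨C', hC'⟩
    refine ⟨max C C', fun t ht => ?_⟩
    rcases ht.1 with h1 | h1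
    · exact (hC t ⟨h1, ht.2⟩).trans (le_max_left _ _)
    · exact (hC' t ⟨h1, ht.2⟩).trans (le_max_right _ _)
  · intro t ht
    have hev : ∀ (l : Filter ℝ) (y : E), Filter.Tendsto x l (𝓝 y) → ∀ᶠ s in l, ‖x s‖ ≤ ‖y‖ + 1 :=
      fun l y hl => (hl.norm.eventually (gt_mem_nhds (lt_add_one ‖y‖))).mono fun s hs => hs.le
    have hr := hev _ _ (h.1 t ht.1)
    obtain ⟨C, hl⟩ : ∃ C, ∀ᶠ s in 𝓝[<] t, s ∈ Icc t₀ T → ‖x s‖ ≤ C := by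
      rcases ht.1.eq_or_lt with rfl | hlt
      · refine ⟨0, ?_⟩
        filter_upwards [self_mem_nhdsWithin] with s hs hs'
        exact absurd hs'.1 (not_le.2 hs)
      · obtain ⟨y, hy⟩ := h.2 t hlt
        exact ⟨_, (hev _ _ hy).mono fun s hs _ => hs⟩
    have hall : ∀ᶠ s in 𝓝 t, s ∈ Icc t₀ T → ‖x s‖ ≤ max C (‖x t‖ + 1) := by
      rw [← nhdsLT_sup_nhdsGE, Filter.eventually_sup]
      exact ⟨hl.mono fun s hs hs' => (hs hs').trans (le_max_left _ _),
        hr.mono fun s hs _ => hs.trans (le_max_right _ _)⟩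
    exact ⟨_, mem_nhdsWithin_of_mem_nhds hall, _, fun s hs => hs.1 hs.2⟩

/-- Rounding the time up to a grid gives step functions, and right continuity makes their values
converge to those of `x`. -/
theorem aestronglyMeasurable_of_right_cont (h : ∀ t, t₀ ≤ t → ContinuousWithinAt x (Ici t) t) :
    AEStronglyMeasurable x (volume.restrict (Ici t₀)) := by
  let q : ℕ → ℝ → ℝ := fun n s => t₀ + (⌈(s - t₀) * (n + 1)⌉ : ℝ) / (n + 1)
  have hq : ∀ n, AEStronglyMeasurable (fun s => x (q n s)) (volume.restrict (Ici t₀)) := fun n =>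
    ((StronglyMeasurable.of_discrete (f := fun k : ℤ => x (t₀ + (k : ℝ) / (n + 1)))).comp_measurable
      (Int.measurable_ceil.comp (by fun_prop : Measurable fun s : ℝ =>
        (s - t₀) * (n + 1)))).aestronglyMeasurable
  have hge : ∀ n s, s ≤ q n s := fun n s => by
    have h0 : (0 : ℝ) < n + 1 := by positivity
    have := Int.le_ceil ((s - t₀) * (n + 1))
    rw [← le_div_iff₀ h0] at this
    simp only [q]; linarith
  have hle : ∀ n s, q n s ≤ s + 1 / ((n : ℝ) + 1) := fun n s => by
    have h0 : (0 : ℝ) < n + 1 := by positivity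
    have := (Int.ceil_lt_add_one ((s - t₀) * (n + 1))).le
    have h1 := div_le_div_of_nonneg_right this h0.le
    rw [add_div, mul_div_cancel_right₀ _ h0.ne'] at h1
    simp only [q]; linarith
  refine aestronglyMeasurable_of_tendsto_ae Filter.atTop hq ?_
  filter_upwards [ae_restrict_mem measurableSet_Ici] with s hs
  refine (h s hs).tendsto.comp (tendsto_nhdsWithin_iff.2 ⟨?_, .of_forall fun n => hge n s⟩)
  refine tendsto_of_tendsto_of_tendsto_of_le_of_le tendsto_const_nhds ?_ (fun n => hge n s)
    fun n => hle n s
  simpa using tendsto_one_div_add_atTop_nhds_zero_nat.const_add s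

theorem IsCadlagFrom.intervalIntegrable (h : IsCadlagFrom t₀ x) {a b : ℝ} (ha : t₀ ≤ a)
    (hb : t₀ ≤ b) : IntervalIntegrable x volume a b := by
  have key : ∀ T, t₀ ≤ T → IntervalIntegrable x volume t₀ T := fun T hT => by
    rw [intervalIntegrable_iff_integrableOn_Ioc_of_le hT]
    obtain ⟨C, hC⟩ := h.exists_bound T
    have hsub : Ioc t₀ T ⊆ Ici t₀ := fun s hs => hs.1.le
    refine IntegrableOn.of_bound (by simp)
      ((aestronglyMeasurable_of_right_cont h.1).mono_set hsub) C ?_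
    filter_upwards [ae_restrict_mem measurableSet_Ioc] with s hs using hC s ⟨hs.1.le, hs.2⟩
  exact (key a ha).symm.trans (key b hb)

theorem IsCadlagFrom.tendsto_leftLim (h : IsCadlagFrom t₀ x) {t : ℝ} (ht : t₀ < t) :
    Filter.Tendsto x (𝓝[<] t) (𝓝 (Function.leftLim x t)) :=
  tendsto_leftLim_of_tendsto (h.2 t ht)

variable [NormedSpace ℝ E] [CompleteSpace E]

/-- The primitive of a càdlàg path has it as its right derivative. -/
theorem IsCadlagFrom.hasDerivWithinAt_integral (h : IsCadlagFrom t₀ x) {t : ℝ} (ht : t₀ ≤ t) :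
    HasDerivWithinAt (fun u => ∫ s in t₀..u, x s) (x t) (Ici t) t := by
  refine intervalIntegral.integral_hasDerivWithinAt_right (t := Ioi t)
    (h.intervalIntegrable le_rfl ht) ⟨Ici t₀, ?_, aestronglyMeasurable_of_right_cont h.1⟩
    ((h.1 t ht).mono Ioi_subset_Ici_self)
  filter_upwards [self_mem_nhdsWithin] with s hs using ht.trans (le_of_lt hs)

omit [CompleteSpace E] in
theorem IsCadlagFrom.continuousOn_integral (h : IsCadlagFrom t₀ x) (T : ℝ) (hT : t₀ ≤ T) :
    ContinuousOn (fun u => ∫ s in t₀..u, x s) (Icc t₀ T) := by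
  have := intervalIntegral.continuousOn_primitive_interval (f := x) (μ := volume) (a := t₀) (b := T)
    (by rw [uIcc_of_le hT]; exact (intervalIntegrable_iff_integrableOn_Icc_of_le hT).1
          (h.intervalIntegrable le_rfl hT))
  rwa [uIcc_of_le hT] at this

/-- A path with drift `F` and jumps `f_l` along the counting paths `N_l`. -/
structure IsJumpDiff (t₀ : ℝ) {m : ℕ} (N : Fin m → ℝ → ℕ) (F : ℝ → E) (f : Fin m → ℝ → E)
    (x : ℝ → E) : Prop where
  deriv : ∀ t, t₀ ≤ t → HasDerivWithinAt x (F t) (Ici t) t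
  left : ∀ t, t₀ < t → Filter.Tendsto x (𝓝[<] t) (𝓝 (x t - ∑ l, jumpSize (N l) t • f l t))

variable {m : ℕ} {N : Fin m → ℝ → ℕ} {F : ℝ → E} {f : Fin m → ℝ → E}

omit [CompleteSpace E] in
theorem IsJumpDiff.isCadlagFrom (h : IsJumpDiff t₀ N F f x) : IsCadlagFrom t₀ x :=
  ⟨fun t ht => (h.deriv t ht).continuousWithinAt, fun t ht => ⟨_, h.left t ht⟩⟩

omit [CompleteSpace E] in
theorem IsJumpDiff.leftLim (h : IsJumpDiff t₀ N F f x) {t : ℝ} (ht : t₀ < t) :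
    Function.leftLim x t = x t - ∑ l, jumpSize (N l) t • f l t :=
  leftLim_eq_of_tendsto (h.left t ht)

/-- Jump integrals are constant for a short time to the right of `t`, so only the drift contributes
to the right derivative; just to the left of `t` they lack exactly the jump at `t`. -/
theorem isJumpDiff_of_integral_eq (hN : ∀ l, IsJumpPath t₀ (N l)) (hF : IsCadlagFrom t₀ F)
    {x₀ : E} (hx : ∀ t, t₀ ≤ t → x t = x₀ + (∫ s in t₀..t, F s) +
      ∑ l, jumpIntegral (N l) (f l) t₀ t) : IsJumpDiff t₀ N F f x := by
  refine ⟨fun t ht => ?_, fun t ht => ?_⟩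
  · have hJ : ∀ᶠ s in 𝓝[≥] t, ∑ l, jumpIntegral (N l) (f l) t₀ s =
        ∑ l, jumpIntegral (N l) (f l) t₀ t := by
      rw [← Ioi_insert, nhdsWithin_insert, Filter.eventually_sup]
      refine ⟨by simp, ?_⟩
      have := Filter.eventually_all.2 fun l => (hN l).eventually_jumpIntegral_right (f l) ht
      filter_upwards [this, self_mem_nhdsWithin] with s hs hts
      refine Finset.sum_congr rfl fun l _ => ?_
      rw [← (hN l).jumpIntegral_add (f l) le_rfl ht (le_of_lt hts), hs l, add_zero]
    refine (((hF.hasDerivWithinAt_integral ht).const_add x₀).add_const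
      (∑ l, jumpIntegral (N l) (f l) t₀ t)).congr_of_eventuallyEq ?_ (hx t ht)
    filter_upwards [hJ, self_mem_nhdsWithin] with s hs hts
    rw [hx s (ht.trans hts), hs]
  · have hI : Filter.Tendsto (fun u => ∫ s in t₀..u, F s) (𝓝[<] t) (𝓝 (∫ s in t₀..t, F s)) := by
      have hc := (hF.continuousOn_integral t ht.le) t ⟨ht.le, le_rfl⟩
      refine hc.tendsto.mono_left ?_
      rw [nhdsWithin_Icc_eq_nhdsLE ht]
      exact nhdsWithin_mono _ Iio_subset_Iic_self
    have hJ := Filter.eventually_all.2 fun l => (hN l).eventually_jumpIntegral_left (f l) ht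
    have key : (fun s => x₀ + (∫ u in t₀..s, F u) + (∑ l, jumpIntegral (N l) (f l) t₀ t -
        ∑ l, jumpSize (N l) t • f l t)) =ᶠ[𝓝[<] t] x := by
      filter_upwards [hJ, Ioo_mem_nhdsLT ht] with s hs hts
      rw [hx s hts.1.le, ← Finset.sum_sub_distrib]
      congr 1
      refine Finset.sum_congr rfl fun l _ => ?_
      rw [← (hN l).jumpIntegral_add (f l) le_rfl hts.1.le hts.2.le, hs l, add_sub_cancel_right]
    refine Filter.Tendsto.congr' key ?_
    rw [hx t ht.le, add_sub_assoc]
    exact (hI.const_add x₀).add_const _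

/-- The integral expression has the same right derivatives and the same jumps as `x`, so the
difference is continuous with zero right derivative, hence constant. This converse replaces Itô's
formula. -/
theorem IsJumpDiff.eq_integral_add (h : IsJumpDiff t₀ N F f x) (hN : ∀ l, IsJumpPath t₀ (N l))
    (hF : IsCadlagFrom t₀ F) {t : ℝ} (ht : t₀ ≤ t) :
    x t = x t₀ + (∫ s in t₀..t, F s) + ∑ l, jumpIntegral (N l) (f l) t₀ t := by
  have h' : IsJumpDiff t₀ N F f
      (fun t => x t₀ + (∫ s in t₀..t, F s) + ∑ l, jumpIntegral (N l) (f l) t₀ t) :=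
    isJumpDiff_of_integral_eq hN hF fun _ _ => rfl
  let y := fun t => x t - (x t₀ + (∫ s in t₀..t, F s) + ∑ l, jumpIntegral (N l) (f l) t₀ t)
  have hd : ∀ s, t₀ ≤ s → HasDerivWithinAt y 0 (Ici s) s := fun s hs => by
    have := (h.deriv s hs).sub (h'.deriv s hs)
    rwa [sub_self] at this
  have hc : ContinuousOn y (Icc t₀ t) := fun s hs => by
    rcases hs.1.eq_or_lt with rfl | hlt
    · exact ((hd t₀ le_rfl).continuousWithinAt).mono Icc_subset_Ici_self
    · refine ContinuousAt.continuousWithinAt ?_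
      rw [continuousAt_iff_continuous_left'_right']
      refine ⟨?_, ((hd s hs.1).continuousWithinAt).mono Ioi_subset_Ici_self⟩
      have := (h.left s hlt).sub (h'.left s hlt)
      rw [sub_sub_sub_cancel_right] at this
      exact this
  have := constant_of_has_deriv_right_zero hc (fun s hs => hd s hs.1) t ⟨ht, le_rfl⟩
  have h0 : y t₀ = 0 := by simp [y, jumpIntegral_self]
  rw [h0] at this
  exact sub_eq_zero.1 this

end Cadlag

/-! ### Growth of paths with jumps -/

section Growth

/-- The supremum of the times up to which `Q` holds throughout satisfies `Q` by the left-hand step,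
and the right-hand step excludes that it lies before `b`. -/
theorem real_induction {Q : ℝ → Prop} {a b : ℝ} (h0 : Q a)
    (hr : ∀ t ∈ Ico a b, (∀ s ∈ Icc a t, Q s) → ∀ᶠ s in 𝓝[>] t, Q s)
    (hl : ∀ t ∈ Ioc a b, (∀ s ∈ Ico a t, Q s) → Q t) : ∀ t ∈ Icc a b, Q t := by
  intro t₁ ht₁
  let S := {t | t ∈ Icc a b ∧ ∀ s ∈ Icc a t, Q s}
  have hab : a ≤ b := ht₁.1.trans ht₁.2
  have haS : a ∈ S := ⟨⟨le_rfl, hab⟩, fun s hs => by rwa [le_antisymm hs.2 hs.1]⟩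
  have hbdd : BddAbove S := ⟨b, fun t ht => ht.1.2⟩
  set c := sSup S
  have hac : a ≤ c := le_csSup hbdd haS
  have hcb : c ≤ b := csSup_le ⟨a, haS⟩ fun t ht => ht.1.2
  have hlt : ∀ s ∈ Ico a c, Q s := fun s hs => by
    obtain ⟨t, ht, hst⟩ := exists_lt_of_lt_csSup ⟨a, haS⟩ hs.2
    exact ht.2 s ⟨hs.1, hst.le⟩
  have hQc : Q c := by
    rcases hac.eq_or_lt with h | h
    · rwa [← h]
    · exact hl c ⟨h, hcb⟩ hlt
  have hcS : ∀ s ∈ Icc a c, Q s := fun s hs => by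
    rcases hs.2.eq_or_lt with h | h
    · rwa [h]
    · exact hlt s ⟨hs.1, h⟩
  rcases hcb.eq_or_lt with h | h
  · exact hcS t₁ ⟨ht₁.1, ht₁.2.trans h.ge⟩
  · exfalso
    obtain ⟨u, hu, hc⟩ := (mem_nhdsGT_iff_exists_Ioc_subset).1 (hr c ⟨hac, h⟩ hcS)
    have hmem : min u b ∈ S := by
      refine ⟨⟨le_min (hac.trans (le_of_lt hu)) hab, min_le_right _ _⟩, fun s hs => ?_⟩
      rcases le_or_gt s c with hsc | hsc
      · exact hcS s ⟨hs.1, hsc⟩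
      · exact hc ⟨hsc, hs.2.trans (min_le_left _ _)⟩
    exact absurd (le_csSup hbdd hmem) (not_le.2 (lt_min hu h))

/-- Gronwall's inequality with jumps, by induction over the continuum: drift is absorbed by the
exponential and each jump by a factor `κ`. The added `1` in the prefactor keeps the barrier strictly
positive, and the added `1` in the rate leaves room for the error of the right derivative. -/
theorem norm_le_of_jump_growth {E : Type*} [NormedAddCommGroup E] [NormedSpace ℝ E] {t₀ T : ℝ}
    {x x' xl : ℝ → E} {N : ℝ → ℕ} {a κ : ℝ} (ha : 0 ≤ a) (hκ : 1 ≤ κ) (hN : IsJumpPath t₀ N)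
    (hx : ∀ t ∈ Ico t₀ T, HasDerivWithinAt x (x' t) (Ici t) t)
    (hx' : ∀ t ∈ Ico t₀ T, ‖x' t‖ ≤ a * ‖x t‖)
    (hxl : ∀ t ∈ Ioc t₀ T, Filter.Tendsto x (𝓝[<] t) (𝓝 (xl t)))
    (hj : ∀ t ∈ Ioc t₀ T, ‖x t‖ ≤ κ ^ jumpSize N t * ‖xl t‖) :
    ∀ t ∈ Icc t₀ T, ‖x t‖ ≤ (‖x t₀‖ + 1) * Real.exp ((a + 1) * (t - t₀)) * κ ^ N t := by
  have hκ0 : 0 < κ := one_pos.trans_le hκ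
  set C := ‖x t₀‖ + 1 with hC
  have hC0 : 0 < C := by positivity
  have hpos : ∀ t, 0 < C * Real.exp ((a + 1) * (t - t₀)) * κ ^ N t := fun t => by positivity
  refine real_induction ?_ (fun t ht hQ => ?_) (fun t ht hQ => ?_)
  · simp only [sub_self, mul_zero, Real.exp_zero, mul_one]
    have : 1 ≤ κ ^ N t₀ := one_le_pow₀ hκ
    nlinarith
  · have hNr := (hN.eventually_right ht.1).filter_mono (nhdsWithin_mono t Ioi_subset_Ici_self)
    have hQt := hQ t ⟨ht.1, le_rfl⟩
    rcases hQt.lt_or_eq with hlt | heq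
    · have h1 : ContinuousWithinAt (fun s => ‖x s‖ -
          C * Real.exp ((a + 1) * (s - t₀)) * κ ^ N t) (Ioi t) t :=
        (((hx t ht).continuousWithinAt.mono Ioi_subset_Ici_self).norm).sub
          (by fun_prop)
      filter_upwards [h1.tendsto.eventually (gt_mem_nhds (sub_neg.2 hlt)), hNr] with s hs hNs
      rw [hNs]
      exact (sub_neg.1 hs).le
    -- When the barrier is touched, `‖x t‖` itself serves as the tolerance in the little-o estimate,
    -- and the spare unit of the growth rate pays for it.
    · have hxt : 0 < ‖x t‖ := heq ▸ hpos t
      have h1 := (hasDerivWithinAt_iff_isLittleO.1 (hx t ht)).def hxt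
      filter_upwards [h1.filter_mono (nhdsWithin_mono t Ioi_subset_Ici_self), hNr,
        self_mem_nhdsWithin] with s hs hNs hts
      have hst : 0 < s - t := sub_pos.2 hts
      rw [Real.norm_of_nonneg hst.le] at hs
      rw [hNs]
      calc ‖x s‖ = ‖x t + ((s - t) • x' t + (x s - x t - (s - t) • x' t))‖ := by congr 1; abel
        _ ≤ ‖x t‖ + ((s - t) * (a * ‖x t‖) + ‖x t‖ * (s - t)) := by
            refine (norm_add_le _ _).trans (add_le_add le_rfl ((norm_add_le _ _).trans
              (add_le_add ?_ hs)))
            rw [norm_smul, Real.norm_of_nonneg hst.le]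
            exact mul_le_mul_of_nonneg_left (hx' t ht) hst.le
        _ = ‖x t‖ * ((a + 1) * (s - t) + 1) := by ring
        _ ≤ ‖x t‖ * Real.exp ((a + 1) * (s - t)) :=
            mul_le_mul_of_nonneg_left (Real.add_one_le_exp _) hxt.le
        _ = _ := by
            rw [heq, show (a + 1) * (s - t₀) = (a + 1) * (t - t₀) + (a + 1) * (s - t) by ring,
              Real.exp_add]
            ring
  · have hxl' : ‖xl t‖ ≤ C * Real.exp ((a + 1) * (t - t₀)) * κ ^ Function.leftLim N t := by
      refine le_of_tendsto (hxl t ht).norm ?_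
      filter_upwards [hN.eventually_left ht.1, Ioo_mem_nhdsLT ht.1] with s hs hst
      refine (hQ s ⟨hst.1.le, hst.2⟩).trans ?_
      rw [hs]
      have := hst.2.le
      gcongr
    calc ‖x t‖ ≤ κ ^ jumpSize N t * ‖xl t‖ := hj t ht
      _ ≤ κ ^ jumpSize N t * (C * Real.exp ((a + 1) * (t - t₀)) * κ ^ Function.leftLim N t) := by
          gcongr
      _ = _ := by
          rw [← hN.leftLim_add_jumpSize ht.1, pow_add]
          ring

end Growth

/-! ### Solution paths -/

section CadlagAlgebra

variable {E E' : Type*} [TopologicalSpace E] [TopologicalSpace E'] {t₀ : ℝ}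

theorem IsCadlagFrom.continuous_comp {x : ℝ → E} (h : IsCadlagFrom t₀ x) {f : E → E'}
    (hf : Continuous f) : IsCadlagFrom t₀ fun t => f (x t) :=
  ⟨fun t ht => hf.continuousAt.comp_continuousWithinAt (h.1 t ht), fun t ht =>
    (h.2 t ht).elim fun y hy => ⟨f y, (hf.tendsto y).comp hy⟩⟩

theorem IsCadlagFrom.prodMk {x : ℝ → E} {y : ℝ → E'} (hx : IsCadlagFrom t₀ x)
    (hy : IsCadlagFrom t₀ y) : IsCadlagFrom t₀ fun t => (x t, y t) :=
  ⟨fun t ht => (hx.1 t ht).prodMk (hy.1 t ht), fun t ht => by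
    obtain ⟨a, ha⟩ := hx.2 t ht
    obtain ⟨b, hb⟩ := hy.2 t ht
    exact ⟨(a, b), ha.prodMk_nhds hb⟩⟩

theorem isCadlagFrom_of_continuousOn {x : ℝ → E} (h : ContinuousOn x (Ici t₀)) :
    IsCadlagFrom t₀ x :=
  ⟨fun t ht => (h t ht).mono (Ici_subset_Ici.2 ht), fun t ht => ⟨x t,
    ((h.continuousAt (Ici_mem_nhds ht)).tendsto).mono_left nhdsWithin_le_nhds⟩⟩

theorem IsJumpPath.isCadlagFrom {N : ℝ → ℕ} (h : IsJumpPath t₀ N) : IsCadlagFrom t₀ N :=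
  ⟨h.right_cont, fun _ ht => ⟨_, tendsto_const_nhds.congr'
    ((h.eventually_left ht).mono fun _ hs => hs.symm)⟩⟩

theorem isCadlagFrom_sum {ι : Type*} [AddCommMonoid E] [ContinuousAdd E] (S : Finset ι)
    {x : ι → ℝ → E} (h : ∀ l ∈ S, IsCadlagFrom t₀ (x l)) :
    IsCadlagFrom t₀ fun t => ∑ l ∈ S, x l t := by
  classical
  induction S using Finset.induction_on with
  | empty => simpa using isCadlagFrom_of_continuousOn (continuousOn_const (c := (0 : E)))
  | insert a S ha ih =>
    simp only [Finset.sum_insert ha]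
    exact ((h a (Finset.mem_insert_self _ _)).prodMk (ih fun l hl =>
      h l (Finset.mem_insert_of_mem hl))).continuous_comp continuous_add

theorem isJumpPath_sum {m : ℕ} {N : Fin m → ℝ → ℕ} (h : ∀ l, IsJumpPath t₀ (N l)) :
    IsJumpPath t₀ fun t => ∑ l, N l t :=
  ⟨fun _ hs _ ht hst => Finset.sum_le_sum fun l _ => (h l).mono hs ht hst,
    (isCadlagFrom_sum Finset.univ fun l _ => (h l).isCadlagFrom).1⟩

theorem leftLim_sum {m : ℕ} {N : Fin m → ℝ → ℕ} (h : ∀ l, IsJumpPath t₀ (N l)) {t : ℝ}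
    (ht : t₀ < t) : Function.leftLim (fun t => ∑ l, N l t) t = ∑ l, Function.leftLim (N l) t :=
  leftLim_eq_of_eventually ((Filter.eventually_all.2 fun l => (h l).eventually_left ht).mono
    fun _ hs => Finset.sum_congr rfl fun l _ => hs l)

theorem jumpSize_sum {m : ℕ} {N : Fin m → ℝ → ℕ} (h : ∀ l, IsJumpPath t₀ (N l)) {t : ℝ}
    (ht : t₀ < t) : jumpSize (fun t => ∑ l, N l t) t = ∑ l, jumpSize (N l) t := by
  have h1 := (isJumpPath_sum h).leftLim_add_jumpSize ht
  have h2 : ∑ l, N l t = ∑ l, Function.leftLim (N l) t + ∑ l, jumpSize (N l) t := by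
    rw [← Finset.sum_add_distrib]
    exact Finset.sum_congr rfl fun l _ => ((h l).leftLim_add_jumpSize ht).symm
  rw [leftLim_sum h ht] at h1
  omega

theorem sum_le_one_cases {m : ℕ} {k : Fin m → ℕ} (h : ∑ l, k l ≤ 1) :
    (∀ l, k l = 0) ∨ ∃ l, k l = 1 ∧ ∀ l', l' ≠ l → k l' = 0 := by
  by_cases h0 : ∀ l, k l = 0
  · exact .inl h0
  push Not at h0
  obtain ⟨l, hl⟩ := h0
  have h1 := Finset.add_sum_erase Finset.univ k (Finset.mem_univ l)
  have h2 : ∑ x ∈ Finset.univ.erase l, k x = 0 := by omega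
  refine .inr ⟨l, by omega, fun l' hl' => ?_⟩
  exact (Finset.sum_eq_zero_iff.1 h2) l' (Finset.mem_erase.2 ⟨hl', Finset.mem_univ _⟩)

theorem sum_smul_of_single {m : ℕ} {E : Type*} [AddCommMonoid E] {k : Fin m → ℕ} {l : Fin m}
    (h1 : k l = 1) (h0 : ∀ l', l' ≠ l → k l' = 0) (g : Fin m → E) : ∑ l', k l' • g l' = g l := by
  rw [Finset.sum_eq_single l (fun l' _ hl' => by rw [h0 l' hl', zero_smul]) (by simp), h1, one_smul]

theorem jumpIntegral_apply {d : ℕ} {N : ℝ → ℕ} (h : IsJumpPath t₀ N) {a : ℝ} (ha : t₀ ≤ a)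
    (b : ℝ) (f : ℝ → Op d) (i j : Fin d) :
    jumpIntegral N f a b i j = jumpIntegral N (fun s => f s i j) a b := by
  rw [h.jumpIntegral_eq_sum ha, h.jumpIntegral_eq_sum ha, Matrix.sum_apply]
  rfl

end CadlagAlgebra

/-! ### Pathwise dynamics of (φ, λ) and of σ. -/

section SolutionPath

variable {d m : ℕ} {t₀ : ℝ}

/-- The pathwise content of the equations for `(φ, λ)`, driven by counting paths without
simultaneous jumps. -/
structure IsSolutionPath (t₀ : ℝ) (A : ℝ → Op d) (L : Fin m → ℝ → Op d) (w r : Fin m → ℝ → ℝ)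
    (N : Fin m → ℝ → ℕ) (z : Fin d → ℂ) (φ : ℝ → Fin d → ℂ) (lam : ℝ → ℝ) : Prop where
  jump : ∀ l, IsJumpPath t₀ (N l)
  simple : ∀ t, t₀ < t → ∑ l, jumpSize (N l) t ≤ 1
  cadlag_φ : IsCadlagFrom t₀ φ
  cadlag_lam : IsCadlagFrom t₀ lam
  eq_φ : ∀ t, t₀ ≤ t → φ t = z + (∫ s in t₀..t, A s *ᵥ φ s) +
    ∑ l, jumpIntegral (N l) (fun s => L l s *ᵥ Function.leftLim φ s - Function.leftLim φ s) t₀ t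
  eq_lam : ∀ t, t₀ ≤ t → lam t = 1 +
    ∑ l, jumpIntegral (N l) (fun s => Function.leftLim lam s * (w l s / r l s - 1)) t₀ t

/-- The weighted operator `λ φ φ†`. -/
noncomputable def weightedProj (φ : Fin d → ℂ) (lam : ℝ) : Op d :=
  (lam : ℂ) • Matrix.vecMulVec φ (star φ)

theorem weightedProj_apply (φ : Fin d → ℂ) (lam : ℝ) (i j : Fin d) :
    weightedProj φ lam i j = lam * (φ i * star (φ j)) := rfl

theorem continuous_weightedProj :
    Continuous fun p : (Fin d → ℂ) × ℝ => weightedProj p.1 p.2 := by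
  refine continuous_pi fun i => continuous_pi fun j => ?_
  simp only [weightedProj_apply]
  fun_prop

/-- This translates the jump update of the vector and of the weight into the jump update of `σ`. -/
theorem mul_weightedProj_mul (B : Op d) (c : ℝ) (φ : Fin d → ℂ) (lam : ℝ) :
    (c : ℂ) • (B * weightedProj φ lam * Bᴴ) = weightedProj (B *ᵥ φ) (c * lam) := by
  rw [weightedProj, weightedProj, Matrix.mul_smul, Matrix.smul_mul, Matrix.mul_vecMulVec,
    Matrix.vecMulVec_mul, Matrix.star_mulVec, smul_smul, Complex.ofReal_mul]

/-- The jump coefficient of `σ` weighted by a function of the number of jumps. -/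
noncomputable def countedJump (L : Fin m → ℝ → Op d) (w r : Fin m → ℝ → ℝ) (g : ℕ → ℂ)
    (i j : Fin d) (l : Fin m) (t : ℝ) (σ : Op d) (n : ℕ) : ℂ :=
  (((w l t / r l t : ℝ) : ℂ) • (L l t * σ * (L l t)ᴴ)) i j * g (n + 1) - σ i j * g n

namespace IsSolutionPath

variable {A : ℝ → Op d} {L : Fin m → ℝ → Op d} {w r : Fin m → ℝ → ℝ} {N : Fin m → ℝ → ℕ}
  {z : Fin d → ℂ} {φ : ℝ → Fin d → ℂ} {lam : ℝ → ℝ}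

theorem φ_zero (h : IsSolutionPath t₀ A L w r N z φ lam) : φ t₀ = z := by
  simpa [jumpIntegral_self] using h.eq_φ t₀ le_rfl

theorem lam_zero (h : IsSolutionPath t₀ A L w r N z φ lam) : lam t₀ = 1 := by
  simpa [jumpIntegral_self] using h.eq_lam t₀ le_rfl

theorem isJumpDiff_φ (h : IsSolutionPath t₀ A L w r N z φ lam) (hA : ContinuousOn A (Ici t₀)) :
    IsJumpDiff t₀ N (fun t => A t *ᵥ φ t)
      (fun l s => L l s *ᵥ Function.leftLim φ s - Function.leftLim φ s) φ :=
  isJumpDiff_of_integral_eq h.jump (((isCadlagFrom_of_continuousOn hA).prodMk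
    h.cadlag_φ).continuous_comp (f := fun p : Op d × (Fin d → ℂ) => p.1 *ᵥ p.2)
      (continuous_fst.matrix_mulVec continuous_snd)) h.eq_φ

theorem isJumpDiff_lam (h : IsSolutionPath t₀ A L w r N z φ lam) :
    IsJumpDiff t₀ N (fun _ => (0 : ℝ))
      (fun l s => Function.leftLim lam s * (w l s / r l s - 1)) lam :=
  isJumpDiff_of_integral_eq h.jump (isCadlagFrom_of_continuousOn continuousOn_const)
    (x₀ := 1) fun t ht => by simpa using h.eq_lam t ht

/-- As at most one channel jumps, and by one unit, the increments `Lφ₋ - φ₋` and `λ₋(w/r - 1)` turn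
the left limits into `Lφ₋` and `(w/r)λ₋`. -/
theorem jump_cases (h : IsSolutionPath t₀ A L w r N z φ lam) (hA : ContinuousOn A (Ici t₀))
    {t : ℝ} (ht : t₀ < t) :
    ((∀ l, jumpSize (N l) t = 0) ∧ φ t = Function.leftLim φ t ∧ lam t = Function.leftLim lam t) ∨
    ∃ l, jumpSize (N l) t = 1 ∧ (∀ l', l' ≠ l → jumpSize (N l') t = 0) ∧
      φ t = L l t *ᵥ Function.leftLim φ t ∧
      lam t = w l t / r l t * Function.leftLim lam t := by
  have h1 := (h.isJumpDiff_φ hA).leftLim ht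
  have h2 := h.isJumpDiff_lam.leftLim ht
  rcases sum_le_one_cases (h.simple t ht) with h0 | ⟨l, hl, hl'⟩
  · refine .inl ⟨h0, ?_, ?_⟩
    · simpa [h0] using h1.symm
    · simpa [h0] using h2.symm
  · refine .inr ⟨l, hl, hl', ?_, ?_⟩
    · rw [sum_smul_of_single hl hl', eq_sub_iff_add_eq, add_sub_cancel] at h1
      exact h1.symm
    · rw [sum_smul_of_single hl hl'] at h2
      linear_combination -h2

theorem tendsto_left (h : IsSolutionPath t₀ A L w r N z φ lam) {t : ℝ} (ht : t₀ < t) :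
    Filter.Tendsto (fun u => weightedProj (φ u) (lam u)) (𝓝[<] t)
      (𝓝 (weightedProj (Function.leftLim φ t) (Function.leftLim lam t))) :=
  (continuous_weightedProj.tendsto (Function.leftLim φ t, Function.leftLim lam t)).comp
    ((h.cadlag_φ.tendsto_leftLim ht).prodMk_nhds (h.cadlag_lam.tendsto_leftLim ht))

theorem leftLim_weightedProj (h : IsSolutionPath t₀ A L w r N z φ lam) {t : ℝ} (ht : t₀ < t) :
    Function.leftLim (fun u => weightedProj (φ u) (lam u)) t =
      weightedProj (Function.leftLim φ t) (Function.leftLim lam t) :=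
  leftLim_eq_of_tendsto (h.tendsto_left ht)

theorem isCadlagFrom_weightedProj (h : IsSolutionPath t₀ A L w r N z φ lam) :
    IsCadlagFrom t₀ fun u => weightedProj (φ u) (lam u) :=
  (h.cadlag_φ.prodMk h.cadlag_lam).continuous_comp continuous_weightedProj

/-- To the right of `t` the weight has zero derivative and the jump count is constant, so only the
drift of `φ` and of its conjugate contributes. -/
theorem hasDerivWithinAt_counted (h : IsSolutionPath t₀ A L w r N z φ lam)
    (hA : ContinuousOn A (Ici t₀)) (g : ℕ → ℂ) (i j : Fin d) {t : ℝ} (ht : t₀ ≤ t) :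
    HasDerivWithinAt (fun u => weightedProj (φ u) (lam u) i j * g (∑ l, N l u))
      (sandwichGenerator A t (weightedProj (φ t) (lam t)) i j * g (∑ l, N l t)) (Ici t) t := by
  have h1 := fun i => hasDerivWithinAt_pi.1 ((h.isJumpDiff_φ hA).deriv t ht) i
  have h2 := (h.isJumpDiff_lam.deriv t ht).ofReal_comp
  have h3 := (h2.mul ((h1 i).mul (h1 j).star)).mul_const (g (∑ l, N l t))
  have h4 : sandwichGenerator A t (weightedProj (φ t) (lam t)) i j =
      lam t * ((A t *ᵥ φ t) i * star (φ t j) + φ t i * star ((A t *ᵥ φ t) j)) := by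
    rw [sandwichGenerator_apply, weightedProj, Matrix.mul_smul, Matrix.smul_mul,
      Matrix.mul_vecMulVec, Matrix.vecMulVec_mul, ← Matrix.star_mulVec, ← smul_add]
    rfl
  rw [h4]
  refine (h3.congr_of_eventuallyEq (f₁ := fun u => weightedProj (φ u) (lam u) i j *
    g (∑ l, N l u)) ?_ rfl).congr_deriv (by simp)
  filter_upwards [(isJumpPath_sum h.jump).eventually_right ht] with u hu
  rw [hu]
  rfl

/-- At a jump the count goes from `n` to `n + 1`, so the new value `(w/r) L σ₋ L†` carries `g (n +
1)` while the subtracted old value carries `g n`. -/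
theorem isJumpDiff_counted (h : IsSolutionPath t₀ A L w r N z φ lam)
    (hA : ContinuousOn A (Ici t₀)) (g : ℕ → ℂ) (i j : Fin d) :
    IsJumpDiff t₀ N
      (fun t => sandwichGenerator A t (weightedProj (φ t) (lam t)) i j * g (∑ l, N l t))
      (fun l t => countedJump L w r g i j l t
        (Function.leftLim (fun u => weightedProj (φ u) (lam u)) t)
        (Function.leftLim (fun u => ∑ l, N l u) t))
      (fun u => weightedProj (φ u) (lam u) i j * g (∑ l, N l u)) := by
  refine ⟨fun t ht => h.hasDerivWithinAt_counted hA g i j ht, fun t ht => ?_⟩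
  have hM := isJumpPath_sum h.jump
  have hlim : Filter.Tendsto (fun u => weightedProj (φ u) (lam u) i j * g (∑ l, N l u)) (𝓝[<] t)
      (𝓝 (weightedProj (Function.leftLim φ t) (Function.leftLim lam t) i j *
        g (Function.leftLim (fun u => ∑ l, N l u) t))) := by
    refine Filter.Tendsto.mul (((continuous_id.matrix_elem i j).tendsto
      (weightedProj (Function.leftLim φ t) (Function.leftLim lam t))).comp (h.tendsto_left ht)) ?_
    exact tendsto_const_nhds.congr' ((hM.eventually_left ht).mono fun u hu => by rw [← hu])
  convert hlim using 2
  have hsum := hM.leftLim_add_jumpSize ht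
  rw [jumpSize_sum h.jump ht] at hsum
  rw [h.leftLim_weightedProj ht]
  rcases h.jump_cases hA ht with ⟨h0, hφ, hl⟩ | ⟨l, h1, h0, hφ, hl⟩
  · simp only [h0, Finset.sum_const_zero, add_zero] at hsum
    simp only [h0, zero_smul, Finset.sum_const_zero, sub_zero]
    rw [hsum, hφ, hl]
  · have hone : ∑ l, jumpSize (N l) t = 1 := by
      simpa using sum_smul_of_single h1 h0 fun _ => (1 : ℕ)
    rw [hone] at hsum
    rw [sum_smul_of_single h1 h0, countedJump, mul_weightedProj_mul, ← hφ, ← hl, ← hsum]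
    ring

end IsSolutionPath

/-! ### Bounds on solution paths -/

/-- The sum of the moduli of the entries. -/
noncomputable def entrySum (B : Op d) : ℝ := ∑ i, ∑ j, ‖B i j‖

theorem entrySum_nonneg (B : Op d) : 0 ≤ entrySum B :=
  Finset.sum_nonneg fun _ _ => Finset.sum_nonneg fun _ _ => norm_nonneg _

theorem norm_mulVec_le (B : Op d) (v : Fin d → ℂ) : ‖B *ᵥ v‖ ≤ entrySum B * ‖v‖ := by
  refine (pi_norm_le_iff_of_nonneg (mul_nonneg (entrySum_nonneg B) (norm_nonneg v))).2 fun i => ?_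
  rw [Matrix.mulVec, dotProduct]
  refine (norm_sum_le _ _).trans ?_
  have h1 : ∑ j, ‖B i j * v j‖ ≤ (∑ j, ‖B i j‖) * ‖v‖ := by
    rw [Finset.sum_mul]
    refine Finset.sum_le_sum fun j _ => ?_
    rw [norm_mul]
    exact mul_le_mul_of_nonneg_left (norm_le_pi_norm v j) (norm_nonneg _)
  refine h1.trans (mul_le_mul_of_nonneg_right ?_ (norm_nonneg v))
  exact Finset.single_le_sum (f := fun i => ∑ j, ‖B i j‖)
    (fun i _ => Finset.sum_nonneg fun _ _ => norm_nonneg _) (Finset.mem_univ i)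

theorem exists_entrySum_bound {B : ℝ → Op d} (hB : ContinuousOn B (Ici t₀)) (T : ℝ) :
    ∃ C, 0 ≤ C ∧ ∀ t ∈ Icc t₀ T, entrySum (B t) ≤ C := by
  have hc : ContinuousOn (fun t => entrySum (B t)) (Icc t₀ T) :=
    continuousOn_finsetSum _ fun i _ => continuousOn_finsetSum _ fun j _ =>
      (continuousOn_entry (hB.mono Icc_subset_Ici_self) i j).norm
  obtain ⟨C, hC⟩ := isCompact_Icc.exists_bound_of_continuousOn hc
  exact ⟨max C 0, le_max_right _ _, fun t ht =>
    ((le_abs_self _).trans (hC t ht)).trans (le_max_left _ _)⟩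

/-- A jump multiplies the norm of `φ` by at most `κ₁` and that of `λ` by at most `κ₂`, hence `σ` by
at most `κ₂κ₁²`. The constants depend only on the coefficients on `[t₀, T]` and on `z`, so the bound
is uniform over trajectories apart from the jump count. -/
theorem exists_solutionPath_bound {A : ℝ → Op d} {L : Fin m → ℝ → Op d} {w r : Fin m → ℝ → ℝ}
    (hA : ContinuousOn A (Ici t₀)) (hL : ∀ l, ContinuousOn (L l) (Ici t₀))
    (hwr : ∀ l, ContinuousOn (fun t => w l t / r l t) (Ici t₀)) (z : Fin d → ℂ) (T : ℝ) :
    ∃ C κ : ℝ, 0 ≤ C ∧ 1 ≤ κ ∧ ∀ (N : Fin m → ℝ → ℕ) (φ : ℝ → Fin d → ℂ) (lam : ℝ → ℝ),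
      IsSolutionPath t₀ A L w r N z φ lam → ∀ t ∈ Icc t₀ T, ∀ i j,
        ‖weightedProj (φ t) (lam t) i j‖ ≤ C * κ ^ (∑ l, N l T) := by
  obtain ⟨a, ha0, ha⟩ := exists_entrySum_bound hA T
  choose b hb0 hb using fun l => exists_entrySum_bound (hL l) T
  choose c hc using fun l => isCompact_Icc.exists_bound_of_continuousOn
    ((hwr l).mono (Icc_subset_Ici_self : Icc t₀ T ⊆ Ici t₀))
  -- The summand `1` ensures `κ ≥ 1`, so that the powers at time `t` are dominated by those at time
  -- `T`.
  set κ₁ : ℝ := 1 + ∑ l, b l with hκ₁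
  set κ₂ : ℝ := 1 + ∑ l, |c l| with hκ₂
  have h1κ₁ : 1 ≤ κ₁ := by
    have := Finset.sum_nonneg fun (l : Fin m) (_ : l ∈ Finset.univ) => hb0 l
    linarith
  have h1κ₂ : 1 ≤ κ₂ := by
    have := Finset.sum_nonneg fun (l : Fin m) (_ : l ∈ Finset.univ) => abs_nonneg (c l)
    linarith
  have hbκ : ∀ l, b l ≤ κ₁ := fun l => by
    have := Finset.single_le_sum (fun l _ => hb0 l) (Finset.mem_univ l)
    linarith
  have hcκ : ∀ l, |c l| ≤ κ₂ := fun l => by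
    have := Finset.single_le_sum (fun l _ => abs_nonneg (c l)) (Finset.mem_univ l)
    linarith
  set D₁ := (‖z‖ + 1) * Real.exp ((a + 1) * (T - t₀)) with hD₁
  -- This is the growth estimate with drift bound `0` and initial value `1`, as λ changes only by
  -- jumps.
  set D₂ := (‖(1 : ℝ)‖ + 1) * Real.exp ((0 + 1) * (T - t₀)) with hD₂
  have hD₁0 : 0 ≤ D₁ := by positivity
  have hD₂0 : 0 ≤ D₂ := by positivity
  refine ⟨D₂ * (D₁ * D₁), κ₂ * (κ₁ * κ₁), by positivity,
    one_le_mul_of_one_le_of_one_le h1κ₂ (one_le_mul_of_one_le_of_one_le h1κ₁ h1κ₁),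
    fun N φ lam h t ht i j => ?_⟩
  have hM := isJumpPath_sum h.jump
  have hφ : ‖φ t‖ ≤ D₁ * κ₁ ^ (∑ l, N l T) := by
    have h1 := norm_le_of_jump_growth ha0 h1κ₁ hM (x := φ) (T := T)
      (fun t ht => (h.isJumpDiff_φ hA).deriv t ht.1)
      (fun t ht => (norm_mulVec_le _ _).trans (mul_le_mul_of_nonneg_right
        (ha t ⟨ht.1, ht.2.le⟩) (norm_nonneg _)))
      (fun t ht => h.cadlag_φ.tendsto_leftLim ht.1) (fun t ht => ?_) t ht
    · rw [h.φ_zero] at h1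
      refine h1.trans ?_
      have := ht.2
      have := hM.mono ht.1 (ht.1.trans ht.2 : t₀ ≤ T) ht.2
      simp only [hD₁]
      gcongr
    · rw [jumpSize_sum h.jump ht.1]
      rcases h.jump_cases hA ht.1 with ⟨h0, hφ, -⟩ | ⟨l, h1, h0, hφ, -⟩
      · simp [h0, ← hφ]
      · have hone : ∑ l, jumpSize (N l) t = 1 := by
          simpa using sum_smul_of_single h1 h0 fun _ => (1 : ℕ)
        rw [hone, pow_one, hφ]
        exact (norm_mulVec_le _ _).trans (mul_le_mul_of_nonneg_right
          ((hb l t ⟨ht.1.le, ht.2⟩).trans (hbκ l)) (norm_nonneg _))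
  have hlam : ‖lam t‖ ≤ D₂ * κ₂ ^ (∑ l, N l T) := by
    have h1 := norm_le_of_jump_growth le_rfl h1κ₂ hM (x := lam) (T := T)
      (fun t ht => h.isJumpDiff_lam.deriv t ht.1) (fun t ht => by simp)
      (fun t ht => h.cadlag_lam.tendsto_leftLim ht.1) (fun t ht => ?_) t ht
    · rw [h.lam_zero] at h1
      refine h1.trans ?_
      have := ht.2
      have := hM.mono ht.1 (ht.1.trans ht.2 : t₀ ≤ T) ht.2
      simp only [hD₂]
      gcongr
    · rw [jumpSize_sum h.jump ht.1]
      rcases h.jump_cases hA ht.1 with ⟨h0, -, hφ⟩ | ⟨l, h1, h0, -, hφ⟩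
      · simp [h0, ← hφ]
      · have hone : ∑ l, jumpSize (N l) t = 1 := by
          simpa using sum_smul_of_single h1 h0 fun _ => (1 : ℕ)
        rw [hone, pow_one, hφ, norm_mul]
        exact mul_le_mul_of_nonneg_right (((hc l t ⟨ht.1.le, ht.2⟩).trans (le_abs_self _)).trans
          (hcκ l)) (norm_nonneg _)
  rw [weightedProj_apply, norm_mul, norm_mul, norm_star, Complex.norm_real]
  calc _ ≤ (D₂ * κ₂ ^ (∑ l, N l T)) * ((D₁ * κ₁ ^ (∑ l, N l T)) * (D₁ * κ₁ ^ (∑ l, N l T))) := by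
        gcongr
        · exact (norm_le_pi_norm _ i).trans hφ
        · exact (norm_le_pi_norm _ j).trans hφ
    _ = _ := by rw [mul_pow, mul_pow]; ring

end SolutionPath

/-! ### The stochastic evolution equation of the weighted operator -/

section SigmaEquation

variable {d m : ℕ} {t₀ : ℝ} {H : ℝ → Op d} {L : Fin m → ℝ → Op d} {w r : Fin m → ℝ → ℝ}

theorem drift_eq (t : ℝ) : drift H L w r t =
    effectiveGenerator H L w t + ∑ l, ((r l t / 2 : ℝ) : ℂ) • (1 : Op d) := by
  simp only [drift, effectiveGenerator, smul_sub, Finset.sum_sub_distrib, smul_smul,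
    Complex.ofReal_div, Complex.ofReal_ofNat]
  have h1 : ∀ x : ℂ, (1 / 2 : ℂ) * x = x / 2 := fun x => by ring
  simp only [h1]
  module

theorem continuousOn_drift {S : Set ℝ} (hH : ContinuousOn H S) (hL : ∀ l, ContinuousOn (L l) S)
    (hw : ∀ l, ContinuousOn (w l) S) (hr : ∀ l, ContinuousOn (r l) S) :
    ContinuousOn (drift H L w r) S := by
  rw [funext fun t => drift_eq (H := H) (L := L) (w := w) (r := r) t]
  have h2 : ContinuousOn (fun t => ∑ l, ((r l t / 2 : ℝ) : ℂ) • (1 : Op d)) S :=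
    continuousOn_finsetSum _ fun l _ => continuousOn_ofReal_smul ((hr l).div_const 2)
      continuousOn_const
  exact (continuousOn_effectiveGenerator hH hL hw).add h2

/-- The scalar `r/2` in the drift acts once from the left and once from the right, and so
contributes `r ρ`. -/
theorem sandwichGenerator_drift (t : ℝ) (ρ : Op d) :
    sandwichGenerator (drift H L w r) t ρ =
      sandwichGenerator (effectiveGenerator H L w) t ρ + ∑ l, (r l t : ℂ) • ρ := by
  simp only [sandwichGenerator_apply, drift_eq, Matrix.conjTranspose_add,
    Matrix.conjTranspose_sum, Matrix.conjTranspose_smul, Matrix.conjTranspose_one,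
    Matrix.add_mul, Matrix.mul_add, Finset.sum_mul, Finset.mul_sum, Matrix.smul_mul,
    Matrix.mul_smul, Matrix.one_mul, Matrix.mul_one, Complex.star_def, Complex.conj_ofReal]
  have : ∑ l, (r l t : ℂ) • ρ = ∑ l, ((r l t / 2 : ℝ) : ℂ) • ρ + ∑ l, ((r l t / 2 : ℝ) : ℂ) • ρ := by
    rw [← Finset.sum_add_distrib]
    refine Finset.sum_congr rfl fun l _ => ?_
    rw [← add_smul, ← Complex.ofReal_add, add_halves]
  rw [this]
  abel

theorem sum_rate_smul_jumpCoeff {t : ℝ} (hr : ∀ l, 0 < r l t) (ρ : Op d) :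
    ∑ l, (r l t : ℂ) • jumpCoeff (L l t) (w l t) (r l t) ρ =
      jumpPart L w t ρ - ∑ l, (r l t : ℂ) • ρ := by
  rw [jumpPart, ← Finset.sum_sub_distrib]
  refine Finset.sum_congr rfl fun l _ => ?_
  rw [jumpCoeff, smul_sub, smul_smul, ← Complex.ofReal_mul, mul_div_cancel₀ _ (hr l).ne']

/-- Subtracting `r((w/r)LρL† - ρ)` removes the gain terms of the generator and adds `r ρ`, which is
the contribution of the rates to the drift. -/
theorem masterGenerator_sub_eq {t : ℝ} (hHsa : (H t).IsHermitian) (hr : ∀ l, 0 < r l t)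
    (ρ : Op d) :
    masterGenerator H L w t ρ - ∑ l, (r l t : ℂ) • jumpCoeff (L l t) (w l t) (r l t) ρ =
      sandwichGenerator (drift H L w r) t ρ := by
  rw [sum_rate_smul_jumpCoeff hr, sandwichGenerator_drift, masterGenerator_eq hHsa]
  abel

theorem isCadlagFrom_sandwichGenerator {K : ℝ → Op d} (hK : ContinuousOn K (Ici t₀))
    {S : ℝ → Op d} (hS : IsCadlagFrom t₀ S) :
    IsCadlagFrom t₀ fun t => sandwichGenerator K t (S t) :=
  ((isCadlagFrom_of_continuousOn hK).prodMk hS).continuous_comp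
    (f := fun p : Op d × Op d => p.1 * p.2 + p.2 * (p.1)ᴴ)
    ((continuous_fst.mul continuous_snd).add (continuous_snd.mul continuous_fst.matrix_conjTranspose))

theorem isCadlagFrom_smul_conj {c : ℝ → ℝ} {B : ℝ → Op d} (hc : ContinuousOn c (Ici t₀))
    (hB : ContinuousOn B (Ici t₀)) {S : ℝ → Op d} (hS : IsCadlagFrom t₀ S) :
    IsCadlagFrom t₀ fun t => (c t : ℂ) • (B t * S t * (B t)ᴴ) :=
  (((isCadlagFrom_of_continuousOn hc).prodMk (isCadlagFrom_of_continuousOn hB)).prodMk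
    hS).continuous_comp (f := fun p : (ℝ × Op d) × Op d => (p.1.1 : ℂ) • (p.1.2 * p.2 * (p.1.2)ᴴ))
    ((Complex.continuous_ofReal.comp (continuous_fst.comp continuous_fst)).smul
      (((continuous_snd.comp continuous_fst).mul continuous_snd).mul
        (continuous_snd.comp continuous_fst).matrix_conjTranspose))

theorem IsCadlagFrom.entry {S : ℝ → Op d} (hS : IsCadlagFrom t₀ S) (i j : Fin d) :
    IsCadlagFrom t₀ fun t => S t i j :=
  hS.continuous_comp (continuous_id.matrix_elem i j)

theorem IsCadlagFrom.mul {x y : ℝ → ℂ} (hx : IsCadlagFrom t₀ x) (hy : IsCadlagFrom t₀ y) :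
    IsCadlagFrom t₀ fun t => x t * y t :=
  (hx.prodMk hy).continuous_comp continuous_mul

/-- This is the product rule for the constant weight `g = 1`, with the drift rewritten as master
generator minus compensators. -/
theorem IsSolutionPath.sigma_equation {N : Fin m → ℝ → ℕ} {z : Fin d → ℂ} {φ : ℝ → Fin d → ℂ}
    {lam : ℝ → ℝ} (h : IsSolutionPath t₀ (drift H L w r) L w r N z φ lam)
    (hH : ContinuousOn H (Ici t₀)) (hHsa : ∀ t, t₀ ≤ t → (H t).IsHermitian)
    (hL : ∀ l, ContinuousOn (L l) (Ici t₀)) (hw : ∀ l, ContinuousOn (w l) (Ici t₀))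
    (hr : ∀ l, ContinuousOn (r l) (Ici t₀)) (hpos : ∀ l t, t₀ ≤ t → 0 < r l t) {t : ℝ}
    (ht : t₀ ≤ t) :
    weightedProj (φ t) (lam t) = Matrix.vecMulVec z (star z)
      + timeIntegral (fun s => masterGenerator H L w s (weightedProj (φ s) (lam s))) t₀ t
      + ∑ l, (jumpIntegral (N l) (fun s => jumpCoeff (L l s) (w l s) (r l s)
            (Function.leftLim (fun u => weightedProj (φ u) (lam u)) s)) t₀ t
          - timeIntegral (fun s => (r l s : ℂ) •
              jumpCoeff (L l s) (w l s) (r l s) (weightedProj (φ s) (lam s))) t₀ t) := by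
  have hA := continuousOn_drift hH hL hw hr
  have hS := h.isCadlagFrom_weightedProj
  have hSA := isCadlagFrom_sandwichGenerator hA hS
  have hrJ : ∀ l, IsCadlagFrom t₀ fun s => (r l s : ℂ) • jumpCoeff (L l s) (w l s) (r l s)
      (weightedProj (φ s) (lam s)) := fun l => by
    have h1 := isCadlagFrom_smul_conj ((hw l).div (hr l) fun t ht => (hpos l t ht).ne') (hL l) hS
    have h2 : IsCadlagFrom t₀ fun s => ((r l s : ℝ), (((w l s / r l s : ℝ) : ℂ) •
        (L l s * weightedProj (φ s) (lam s) * (L l s)ᴴ), weightedProj (φ s) (lam s))) :=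
      (isCadlagFrom_of_continuousOn (hr l)).prodMk (h1.prodMk hS)
    exact h2.continuous_comp (f := fun p : ℝ × (Op d × Op d) => (p.1 : ℂ) • (p.2.1 - p.2.2))
      ((Complex.continuous_ofReal.comp continuous_fst).smul
        ((continuous_fst.comp continuous_snd).sub (continuous_snd.comp continuous_snd)))
  ext i j
  have hrint : ∀ l, IntervalIntegrable (fun s => ((r l s : ℂ) • jumpCoeff (L l s) (w l s) (r l s)
      (weightedProj (φ s) (lam s))) i j) volume t₀ t := fun l =>
    ((hrJ l).entry i j).intervalIntegrable le_rfl ht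
  have hsum : IntervalIntegrable (fun s => ∑ l, ((r l s : ℂ) • jumpCoeff (L l s) (w l s) (r l s)
      (weightedProj (φ s) (lam s))) i j) volume t₀ t := by
    simpa only [Finset.sum_fn] using IntervalIntegrable.sum Finset.univ fun l _ => hrint l
  have hmaster : ∫ s in t₀..t, masterGenerator H L w s (weightedProj (φ s) (lam s)) i j =
      (∫ s in t₀..t, sandwichGenerator (drift H L w r) s (weightedProj (φ s) (lam s)) i j) +
      ∑ l, ∫ s in t₀..t, ((r l s : ℂ) • jumpCoeff (L l s) (w l s) (r l s)
        (weightedProj (φ s) (lam s))) i j := by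
    rw [← intervalIntegral.integral_finsetSum fun l _ => hrint l, ← intervalIntegral.integral_add
      ((hSA.entry i j).intervalIntegrable le_rfl ht) hsum]
    refine intervalIntegral.integral_congr fun s hs => ?_
    rw [uIcc_of_le ht] at hs
    have := masterGenerator_sub_eq (hHsa s hs.1) (fun l => hpos l s hs.1) (L := L) (w := w)
      (weightedProj (φ s) (lam s))
    rw [sub_eq_iff_eq_add] at this
    simp only [this, Matrix.add_apply, Matrix.sum_apply]
  have hmain := (h.isJumpDiff_counted hA (fun _ => 1) i j).eq_integral_add h.jump
    (by simpa using hSA.entry i j) ht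
  simp only [mul_one, countedJump, h.φ_zero, h.lam_zero] at hmain
  rw [hmain]
  simp only [Matrix.add_apply, Matrix.sum_apply, Matrix.sub_apply, Finset.sum_sub_distrib,
    timeIntegral, Matrix.of_apply, hmaster]
  rw [Finset.sum_congr rfl fun l (_ : l ∈ Finset.univ) => jumpIntegral_apply (h.jump l) le_rfl t
    (fun s => jumpCoeff (L l s) (w l s) (r l s)
      (Function.leftLim (fun u => weightedProj (φ u) (lam u)) s)) i j]
  simp only [weightedProj_apply, jumpCoeff, Matrix.sub_apply, Matrix.vecMulVec_apply, Pi.star_apply,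
    Complex.ofReal_one, one_mul]
  ring

end SigmaEquation

/-! ### Poisson systems -/

section Poisson

theorem integrable_pow_poissonMeasure (q : NNReal) {κ : ℝ} (hκ : 0 ≤ κ) :
    Integrable (fun n : ℕ => κ ^ n) (poissonMeasure q) := by
  rw [integrable_poissonMeasure_iff]
  refine ((Real.summable_pow_div_factorial ((q : ℝ) * κ)).mul_left (Real.exp (-q))).congr fun n => ?_
  rw [Real.norm_of_nonneg (pow_nonneg hκ n), mul_pow]
  ring

theorem integrable_cast_poissonMeasure (q : NNReal) :
    Integrable (fun n : ℕ => (n : ℝ)) (poissonMeasure q) := by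
  refine (integrable_pow_poissonMeasure q (κ := 2) (by norm_num)).mono'
    (Measurable.of_discrete.aestronglyMeasurable) (.of_forall fun n => ?_)
  rw [Real.norm_of_nonneg n.cast_nonneg]
  exact_mod_cast n.lt_two_pow_self.le

theorem integral_cast_poissonMeasure (q : NNReal) :
    ∫ n, (n : ℝ) ∂(poissonMeasure q) = q := by
  refine (hasSum_integral_poissonMeasure (integrable_cast_poissonMeasure q)).unique ?_
  rw [← hasSum_nat_add_iff' 1]
  have h1 := (hasSum_one_poissonMeasure q).mul_left (q : ℝ)
  rw [mul_one] at h1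
  simp only [Finset.range_one, Finset.sum_singleton, Nat.cast_zero, smul_zero, sub_zero]
  refine h1.congr_fun fun n => ?_
  have : (n.factorial : ℝ) ≠ 0 := by positivity
  have h2 : (n : ℝ) + 1 ≠ 0 := by positivity
  rw [Nat.factorial_succ, smul_eq_mul]
  push_cast
  field_simp
  ring

theorem poissonMeasure_one_le (q : NNReal) :
    poissonMeasure q {n | 1 ≤ n} ≤ ENNReal.ofReal q := by
  have hset : {n : ℕ | 1 ≤ n} = {0}ᶜ := by
    ext n
    simp only [mem_ofPred_eq, mem_compl_iff, mem_singleton_iff]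
    omega
  rw [hset, ← ofReal_measureReal (measure_ne_top _ _), probReal_compl_eq_one_sub (by simp),
    poissonMeasure_real_singleton]
  refine ENNReal.ofReal_le_ofReal ?_
  have := Real.add_one_le_exp (-(q : ℝ))
  simp only [pow_zero, mul_one, Nat.factorial_zero, Nat.cast_one, div_one]
  linarith

/-- From `e^{-q} ≥ 1 - q` one gets `1 - e^{-q}(1 + q) ≤ 1 - (1 - q)(1 + q) = q²`. The quadratic
order is what excludes simultaneous jumps. -/
theorem poissonMeasure_two_le (q : NNReal) :
    poissonMeasure q {n | 2 ≤ n} ≤ ENNReal.ofReal (q ^ 2) := by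
  have hset : {n : ℕ | 2 ≤ n} = ({0} ∪ {1})ᶜ := by
    ext n
    simp only [mem_ofPred_eq, mem_compl_iff, mem_union, mem_singleton_iff]
    omega
  rw [hset, ← ofReal_measureReal (measure_ne_top _ _), probReal_compl_eq_one_sub (by simp),
    measureReal_union (by simp) (by simp), poissonMeasure_real_singleton,
    poissonMeasure_real_singleton]
  refine ENNReal.ofReal_le_ofReal ?_
  have h1 := Real.add_one_le_exp (-(q : ℝ))
  have h2 : (0 : ℝ) ≤ q := q.2
  simp only [pow_zero, mul_one, Nat.factorial_zero, Nat.cast_one, div_one, pow_one,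
    Nat.factorial_one]
  nlinarith

/-! ### Moments of the jump count and almost sure absence of simultaneous jumps. -/

variable {Ω : Type*} [mΩ : MeasurableSpace Ω] {P : Measure Ω} {ℱ : Filtration ℝ mΩ} {t₀ : ℝ}
  {m : ℕ} {r : Fin m → ℝ → ℝ} {ϖ : Fin m → ℝ → Ω → ℕ}

namespace IsPoissonSystem

theorem measurable (h : IsPoissonSystem P ℱ t₀ r ϖ) (l : Fin m) {t : ℝ} (ht : t₀ ≤ t) :
    Measurable (ϖ l t) :=
  (h.adapted l t ht).mono (ℱ.le t) le_rfl

theorem measurable_incr (h : IsPoissonSystem P ℱ t₀ r ϖ) (l : Fin m) {s t : ℝ} (hs : t₀ ≤ s)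
    (ht : s ≤ t) : Measurable fun ω => ϖ l t ω - ϖ l s ω :=
  (h.measurable l (hs.trans ht)).sub (h.measurable l hs)

theorem ae_isJumpPath (h : IsPoissonSystem P ℱ t₀ r ϖ) :
    ∀ᵐ ω ∂P, ∀ l, IsJumpPath t₀ fun t => ϖ l t ω := by
  filter_upwards [h.mono, h.right_cont] with ω h1 h2 l using ⟨h1 l, h2 l⟩

theorem measure_incr (h : IsPoissonSystem P ℱ t₀ r ϖ) (l : Fin m) {s t : ℝ} (hs : t₀ ≤ s)
    (ht : s ≤ t) (k : ℕ) : P {ω | k ≤ ϖ l t ω - ϖ l s ω} =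
      poissonMeasure (∫ u in s..t, r l u).toNNReal {n | k ≤ n} := by
  rw [← h.law l s t hs ht, Measure.map_apply (h.measurable_incr l hs ht) .of_discrete]
  rfl

theorem exists_rate_bound (hr : ∀ l, ContinuousOn (r l) (Ici t₀)) (T : ℝ) :
    ∃ R, 0 ≤ R ∧ ∀ l s t, t₀ ≤ s → s ≤ t → t ≤ T →
      (((∫ u in s..t, r l u).toNNReal : NNReal) : ℝ) ≤ R * (t - s) := by
  choose c hc using fun l => isCompact_Icc.exists_bound_of_continuousOn
    ((hr l).mono (Icc_subset_Ici_self : Icc t₀ T ⊆ Ici t₀))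
  refine ⟨∑ l, |c l|, Finset.sum_nonneg fun l _ => abs_nonneg _, fun l s t hs hst ht => ?_⟩
  have h0 : 0 ≤ ∑ l, |c l| := Finset.sum_nonneg fun l _ => abs_nonneg _
  rw [Real.coe_toNNReal']
  refine max_le ?_ (mul_nonneg h0 (sub_nonneg.2 hst))
  have h1 := intervalIntegral.norm_integral_le_of_norm_le_const (f := r l) (a := s) (b := t)
    (C := |c l|) fun u hu => by
      rw [uIoc_of_le hst] at hu
      exact (hc l u ⟨hs.trans hu.1.le, hu.2.trans ht⟩).trans (le_abs_self _)
  rw [abs_of_nonneg (sub_nonneg.2 hst)] at h1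
  refine (le_abs_self _).trans (h1.trans (mul_le_mul_of_nonneg_right ?_ (sub_nonneg.2 hst)))
  exact Finset.single_le_sum (fun l _ => abs_nonneg (c l)) (Finset.mem_univ l)

theorem integral_incr (h : IsPoissonSystem P ℱ t₀ r ϖ) (hpos : ∀ l t, t₀ ≤ t → 0 < r l t)
    (l : Fin m) {s t : ℝ} (hs : t₀ ≤ s) (ht : s ≤ t) :
    ∫ ω, ((ϖ l t ω - ϖ l s ω : ℕ) : ℝ) ∂P = ∫ u in s..t, r l u := by
  have h1 := integral_map (μ := P) (h.measurable_incr l hs ht).aemeasurable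
    (f := fun n : ℕ => (n : ℝ)) Measurable.of_discrete.aestronglyMeasurable
  rw [← h1, h.law l s t hs ht, integral_cast_poissonMeasure, Real.coe_toNNReal]
  exact intervalIntegral.integral_nonneg ht fun u hu => (hpos l u (hs.trans hu.1)).le

/-- The sum of the counts is at most `m` times the largest one, so the power is bounded by `∑ l, (κ
^ m) ^ ϖ l T`, up to the constant `1` which covers `m = 0`. Only exponential moments of the marginal
laws are then needed. -/
theorem integrable_pow (h : IsPoissonSystem P ℱ t₀ r ϖ) [IsProbabilityMeasure P] {κ : ℝ}
    (hκ : 1 ≤ κ) {T : ℝ} (hT : t₀ ≤ T) : Integrable (fun ω => κ ^ (∑ l, ϖ l T ω)) P := by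
  have hκ0 : 0 ≤ κ := zero_le_one.trans hκ
  have h1 : ∀ l, Integrable (fun ω => (κ ^ m) ^ (ϖ l T ω)) P := fun l => by
    have h2 := (integrable_pow_poissonMeasure (∫ u in t₀..T, r l u).toNNReal (pow_nonneg hκ0 m))
    rw [← h.law l t₀ T le_rfl hT] at h2
    refine ((integrable_map_measure Measurable.of_discrete.aestronglyMeasurable
      (h.measurable_incr l le_rfl hT).aemeasurable).1 h2).congr ?_
    filter_upwards [h.zero] with ω hω
    simp [hω l]
  have h2 : Integrable (fun ω => 1 + ∑ l, (κ ^ m) ^ (ϖ l T ω)) P :=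
    (integrable_const 1).add (integrable_finsetSum _ fun l _ => h1 l)
  refine h2.mono' ?_ (.of_forall fun ω => ?_)
  · exact ((Measurable.of_discrete (f := fun n : ℕ => κ ^ n)).comp (Finset.measurable_fun_sum _
      fun l _ => h.measurable l hT)).aestronglyMeasurable
  · rw [Real.norm_of_nonneg (by positivity)]
    rcases isEmpty_or_nonempty (Fin m) with hm | hm
    · simp
    · obtain ⟨l, -, hl⟩ := Finset.exists_max_image Finset.univ (fun l => ϖ l T ω)
        Finset.univ_nonempty
      have h3 : ∑ l, ϖ l T ω ≤ m * ϖ l T ω := by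
        simpa using Finset.sum_le_card_nsmul Finset.univ (fun l => ϖ l T ω) _ hl
      calc κ ^ (∑ l, ϖ l T ω) ≤ κ ^ (m * ϖ l T ω) := pow_le_pow_right₀ hκ h3
        _ = (κ ^ m) ^ ϖ l T ω := pow_mul _ _ _
        _ ≤ ∑ l, (κ ^ m) ^ ϖ l T ω :=
            Finset.single_le_sum (f := fun l => (κ ^ m) ^ ϖ l T ω) (fun l _ => by positivity)
              (Finset.mem_univ l)
        _ ≤ _ := by linarith

theorem indepFun_incr (h : IsPoissonSystem P ℱ t₀ r ϖ) {l l' : Fin m} (hl : l ≠ l') {s t : ℝ}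
    (hs : t₀ ≤ s) (ht : s ≤ t) :
    IndepFun (fun ω => ϖ l t ω - ϖ l s ω) (fun ω => ϖ l' t ω - ϖ l' s ω) P := by
  have hm : Measurable fun x : Ici t₀ → ℕ => x ⟨t, hs.trans ht⟩ - x ⟨s, hs⟩ :=
    (measurable_pi_apply _).sub (measurable_pi_apply _)
  exact (h.indep.indepFun hl).comp hm hm

/-- Two jumps in `(s, t]` require either two in one channel or one in each of two channels. Both
events have probability of order `(t - s)²`; for the second this uses independence of the channels.
-/
theorem measure_two_le (h : IsPoissonSystem P ℱ t₀ r ϖ) {R T : ℝ} (hR0 : 0 ≤ R)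
    (hR : ∀ l s t, t₀ ≤ s → s ≤ t → t ≤ T →
      (((∫ u in s..t, r l u).toNNReal : NNReal) : ℝ) ≤ R * (t - s)) {s t : ℝ} (hs : t₀ ≤ s)
    (hst : s ≤ t) (ht : t ≤ T) :
    P {ω | 2 ≤ ∑ l, (ϖ l t ω - ϖ l s ω)} ≤
      ENNReal.ofReal ((m + m * m) * (R * (t - s)) ^ 2) := by
  have hnn : 0 ≤ R * (t - s) := mul_nonneg hR0 (sub_nonneg.2 hst)
  have hsub : {ω | 2 ≤ ∑ l, (ϖ l t ω - ϖ l s ω)} ⊆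
      (⋃ l, {ω | 2 ≤ ϖ l t ω - ϖ l s ω}) ∪
      ⋃ l, ⋃ l', ⋃ _ : l ≠ l', {ω | 1 ≤ ϖ l t ω - ϖ l s ω} ∩ {ω | 1 ≤ ϖ l' t ω - ϖ l' s ω} := by
    intro ω hω
    by_contra hcon
    simp only [mem_union, mem_iUnion, mem_inter_iff, mem_ofPred_eq, not_or, not_exists, not_and,
      not_le] at hcon hω
    by_cases h0 : ∀ l, ϖ l t ω - ϖ l s ω = 0
    · simp [h0] at hω
    · push Not at h0
      obtain ⟨l, hl⟩ := h0
      have h1 : ∑ l', (ϖ l' t ω - ϖ l' s ω) = ϖ l t ω - ϖ l s ω :=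
        Finset.sum_eq_single l (fun l' _ hne => by
          have := hcon.2 l l' hne.symm (Nat.one_le_iff_ne_zero.2 hl)
          omega) (by simp)
      have := hcon.1 l
      omega
  refine (measure_mono hsub).trans ((measure_union_le _ _).trans ?_)
  have h2 : ∀ l, P {ω | 2 ≤ ϖ l t ω - ϖ l s ω} ≤ ENNReal.ofReal ((R * (t - s)) ^ 2) := fun l => by
    rw [h.measure_incr l hs hst]
    refine (poissonMeasure_two_le _).trans (ENNReal.ofReal_le_ofReal ?_)
    exact pow_le_pow_left₀ (NNReal.coe_nonneg _) (hR l s t hs hst ht) 2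
  have h1 : ∀ l, P {ω | 1 ≤ ϖ l t ω - ϖ l s ω} ≤ ENNReal.ofReal (R * (t - s)) := fun l => by
    rw [h.measure_incr l hs hst]
    exact (poissonMeasure_one_le _).trans (ENNReal.ofReal_le_ofReal (hR l s t hs hst ht))
  have h11 : ∀ l l', l ≠ l' → P ({ω | 1 ≤ ϖ l t ω - ϖ l s ω} ∩ {ω | 1 ≤ ϖ l' t ω - ϖ l' s ω}) ≤
      ENNReal.ofReal ((R * (t - s)) ^ 2) := fun l l' hl => by
    have := (h.indepFun_incr hl hs hst).measure_inter_preimage_eq_mul {n | 1 ≤ n} {n | 1 ≤ n}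
      .of_discrete .of_discrete
    refine (le_of_eq this).trans ?_
    rw [sq, ENNReal.ofReal_mul hnn]
    exact mul_le_mul' (h1 l) (h1 l')
  have hA : P (⋃ l, {ω | 2 ≤ ϖ l t ω - ϖ l s ω}) ≤
      m * ENNReal.ofReal ((R * (t - s)) ^ 2) := by
    refine (measure_iUnion_fintype_le _ _).trans ((Finset.sum_le_sum fun l _ => h2 l).trans ?_)
    simp
  have hB : P (⋃ l, ⋃ l', ⋃ _ : l ≠ l', {ω | 1 ≤ ϖ l t ω - ϖ l s ω} ∩
      {ω | 1 ≤ ϖ l' t ω - ϖ l' s ω}) ≤ m * (m * ENNReal.ofReal ((R * (t - s)) ^ 2)) := by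
    refine (measure_iUnion_fintype_le _ _).trans ((Finset.sum_le_sum fun l _ =>
      (measure_iUnion_fintype_le _ _).trans (Finset.sum_le_sum fun l' _ =>
        (?_ : _ ≤ ENNReal.ofReal ((R * (t - s)) ^ 2)))).trans ?_)
    · by_cases hl : l = l'
      · simp [hl]
      · simpa [hl] using h11 l l' hl
    · simp
  refine (add_le_add hA hB).trans (le_of_eq ?_)
  rw [ENNReal.ofReal_mul (by positivity), ENNReal.ofReal_add (by positivity) (by positivity),
    ENNReal.ofReal_mul (by positivity), ENNReal.ofReal_natCast]
  ring

/-- Cut the interval into `n + 1` cells of length `K/(n + 1)`. A simultaneous jump forces two jumps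
within one cell, which has probability of order `n⁻²` per cell, hence of order `n⁻¹` in total. -/
theorem ae_simple_of_bound (h : IsPoissonSystem P ℱ t₀ r ϖ) (hr : ∀ l, ContinuousOn (r l) (Ici t₀))
    (K : ℕ) : ∀ᵐ ω ∂P, ∀ t ∈ Ioc t₀ (t₀ + K), ∑ l, jumpSize (fun s => ϖ l s ω) t ≤ 1 := by
  obtain ⟨R, hR0, hR⟩ := exists_rate_bound hr (t₀ + K)
  -- Regularity of the paths is built into the exceptional set so that its inclusion in the cell
  -- events is deterministic; since measures are monotone on arbitrary sets, its measurability is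
  -- not needed.
  set bad := {ω | (∀ l, IsJumpPath t₀ fun t => ϖ l t ω) ∧
    ∃ t ∈ Ioc t₀ (t₀ + K), 2 ≤ ∑ l, jumpSize (fun s => ϖ l s ω) t} with hbad
  suffices hP : P bad = 0 by
    filter_upwards [h.ae_isJumpPath, measure_eq_zero_iff_ae_notMem.1 hP] with ω h1 h2 t ht
    by_contra hcon
    exact h2 ⟨h1, t, ht, by omega⟩
  have hle : ∀ n : ℕ, P bad ≤ ENNReal.ofReal ((m + m * m) * (R * K) ^ 2 * (1 / ((n : ℝ) + 1))) := by
    intro n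
    have hn : (0 : ℝ) < n + 1 := by positivity
    set δ : ℝ := K / (n + 1) with hδ
    have hδ0 : 0 ≤ δ := by positivity
    have hnδ : ((n : ℝ) + 1) * δ = K := by rw [hδ]; field_simp
    have hsub : bad ⊆ ⋃ k ∈ Finset.range (n + 1),
        {ω | 2 ≤ ∑ l, (ϖ l (t₀ + (k + 1) * δ) ω - ϖ l (t₀ + k * δ) ω)} := by
      rintro ω ⟨hω, t, ht, h2⟩
      -- The cell length vanishes only for `K = 0`, where there is no time `t` to consider.
      have hδpos : 0 < δ := by
        rcases hδ0.eq_or_lt with h0 | h0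
        · rw [← h0, mul_zero] at hnδ
          rw [← hnδ, add_zero] at ht
          exact absurd ht.1 (not_lt.2 ht.2)
        · exact h0
      -- The ceiling selects the cell open on the left and closed on the right, so that a jump at
      -- `t` is seen by the increment over that cell.
      obtain ⟨k, hk⟩ : ∃ k : ℕ, ⌈(t - t₀) / δ⌉₊ = k + 1 :=
        Nat.exists_eq_succ_of_ne_zero (Nat.ceil_pos.2 (div_pos (sub_pos.2 ht.1) hδpos)).ne'
      have h3 := Nat.le_ceil ((t - t₀) / δ)
      have h4 := Nat.ceil_lt_add_one (div_nonneg (sub_nonneg.2 ht.1.le) hδ0)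
      rw [hk] at h3 h4
      push_cast at h3 h4
      rw [div_le_iff₀ hδpos] at h3
      have h5 : k * δ < t - t₀ := by
        rw [← lt_div_iff₀ hδpos]; linarith
      have hkn : k < n + 1 := by
        have : (k : ℝ) * δ < (n + 1) * δ := by
          rw [hnδ]; have := ht.2; linarith
        exact_mod_cast lt_of_mul_lt_mul_right this hδ0
      simp only [mem_iUnion, Finset.mem_range]
      refine ⟨k, hkn, h2.trans (Finset.sum_le_sum fun l _ => ?_)⟩
      have h6 : t₀ ≤ t₀ + k * δ := le_add_of_nonneg_right (by positivity)
      have h7 := (hω l).le_leftLim h6 (by linarith : t₀ + k * δ < t)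
      have h8 := (hω l).mono (mem_Ici.2 ht.1.le) (mem_Ici.2 (by nlinarith : t₀ ≤ t₀ + (k + 1) * δ))
        (by linarith : t ≤ t₀ + (k + 1) * δ)
      exact tsub_le_tsub h8 h7
    refine (measure_mono hsub).trans ((measure_biUnion_finset_le _ _).trans ?_)
    have hk : ∀ k ∈ Finset.range (n + 1),
        P {ω | 2 ≤ ∑ l, (ϖ l (t₀ + (k + 1) * δ) ω - ϖ l (t₀ + k * δ) ω)} ≤
          ENNReal.ofReal ((m + m * m) * (R * δ) ^ 2) := fun k hk => by
      have hkn : (k : ℝ) + 1 ≤ n + 1 := by exact_mod_cast Finset.mem_range.1 hk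
      have := h.measure_two_le hR0 hR (s := t₀ + k * δ) (t := t₀ + (k + 1) * δ)
        (le_add_of_nonneg_right (by positivity)) (by linarith)
        (by have := mul_le_mul_of_nonneg_right hkn hδ0; linarith)
      rwa [show t₀ + (k + 1) * δ - (t₀ + k * δ) = δ by ring] at this
    refine (Finset.sum_le_sum hk).trans (le_of_eq ?_)
    rw [Finset.sum_const, Finset.card_range, nsmul_eq_mul, ← ENNReal.ofReal_natCast,
      ← ENNReal.ofReal_mul (by positivity), hδ]
    congr 1
    push_cast
    field_simp
  have hlim : Filter.Tendsto (fun n : ℕ => ENNReal.ofReal ((m + m * m) * (R * K) ^ 2 *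
      (1 / ((n : ℝ) + 1)))) Filter.atTop (𝓝 0) := by
    have := ENNReal.tendsto_ofReal
      ((tendsto_one_div_add_atTop_nhds_zero_nat (𝕜 := ℝ)).const_mul ((m + m * m) * (R * K) ^ 2))
    simpa only [mul_zero, ENNReal.ofReal_zero] using this
  exact le_antisymm (ge_of_tendsto' hlim hle) bot_le

theorem ae_simple (h : IsPoissonSystem P ℱ t₀ r ϖ) (hr : ∀ l, ContinuousOn (r l) (Ici t₀)) :
    ∀ᵐ ω ∂P, ∀ t, t₀ < t → ∑ l, jumpSize (fun s => ϖ l s ω) t ≤ 1 := by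
  filter_upwards [ae_all_iff.2 (h.ae_simple_of_bound hr)] with ω hω t ht
  obtain ⟨K, hK⟩ := exists_nat_ge (t - t₀)
  exact hω K t ⟨ht, by linarith⟩

/-- A jump at the fixed time `t` forces an increment over `(s, t]` for every `s < t`, and the
probability of the latter is at most `R(t - s)`. -/
theorem ae_no_jump (h : IsPoissonSystem P ℱ t₀ r ϖ) (hr : ∀ l, ContinuousOn (r l) (Ici t₀))
    {t : ℝ} (ht : t₀ < t) : ∀ᵐ ω ∂P, ∀ l, jumpSize (fun s => ϖ l s ω) t = 0 := by
  obtain ⟨R, hR0, hR⟩ := exists_rate_bound hr t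
  rw [ae_all_iff]
  intro l
  set bad := {ω | (∀ l, IsJumpPath t₀ fun t => ϖ l t ω) ∧ jumpSize (fun s => ϖ l s ω) t ≠ 0}
  suffices hP : P bad = 0 by
    filter_upwards [h.ae_isJumpPath, measure_eq_zero_iff_ae_notMem.1 hP] with ω h1 h2
    by_contra hcon
    exact h2 ⟨h1, hcon⟩
  have hle : ∀ᶠ s in 𝓝[<] t, P bad ≤ ENNReal.ofReal (R * (t - s)) := by
    filter_upwards [Ioo_mem_nhdsLT ht] with s hs
    refine (measure_mono (t := {ω | 1 ≤ ϖ l t ω - ϖ l s ω}) fun ω hω => ?_).trans ?_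
    · have h1 := (hω.1 l).le_leftLim hs.1.le hs.2
      have h2 := hω.2
      simp only [jumpSize] at h1 h2
      simp only [mem_ofPred_eq]
      omega
    · rw [h.measure_incr l hs.1.le hs.2.le]
      exact (poissonMeasure_one_le _).trans (ENNReal.ofReal_le_ofReal
        (hR l s t hs.1.le hs.2.le le_rfl))
  have hlim : Filter.Tendsto (fun s => ENNReal.ofReal (R * (t - s))) (𝓝[<] t) (𝓝 0) := by
    have hc : Continuous fun s => ENNReal.ofReal (R * (t - s)) :=
      ENNReal.continuous_ofReal.comp (by fun_prop)
    have := (hc.tendsto t).mono_left (nhdsWithin_le_nhds (s := Iio t))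
    simpa only [sub_self, mul_zero, ENNReal.ofReal_zero] using this
  exact le_antisymm (ge_of_tendsto hlim hle) bot_le

end IsPoissonSystem

end Poisson

/-! ### Riemann sums -/

section Riemann

/-- The equidistant grid with `n + 1` cells on `[a, b]`. -/
noncomputable def grid (a b : ℝ) (n k : ℕ) : ℝ := a + k * ((b - a) / (n + 1))

/-- The left end of the half-open grid cell `(t_k, t_{k+1}]` which contains `s`. -/
noncomputable def gridLeft (a b : ℝ) (n : ℕ) (s : ℝ) : ℝ :=
  a + ((⌈(s - a) / ((b - a) / (n + 1))⌉ : ℝ) - 1) * ((b - a) / (n + 1))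

variable {a b : ℝ}

theorem grid_step_pos (hab : a < b) (n : ℕ) : 0 < (b - a) / ((n : ℝ) + 1) :=
  div_pos (sub_pos.2 hab) (by positivity)

@[simp]
theorem grid_zero (a b : ℝ) (n : ℕ) : grid a b n 0 = a := by simp [grid]

@[simp]
theorem grid_last (a b : ℝ) (n : ℕ) : grid a b n (n + 1) = b := by
  have : (n : ℝ) + 1 ≠ 0 := by positivity
  simp only [grid]
  push_cast
  field_simp
  ring

theorem grid_mono (hab : a < b) (n : ℕ) : Monotone (grid a b n) := fun i j hij => by
  have := (grid_step_pos hab n).le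
  simp only [grid]
  gcongr

theorem grid_mem (hab : a < b) {n k : ℕ} (hk : k ≤ n + 1) : grid a b n k ∈ Icc a b :=
  ⟨(grid_zero a b n).symm.le.trans (grid_mono hab n (Nat.zero_le k)),
    (grid_mono hab n hk).trans (grid_last a b n).le⟩

theorem gridLeft_eq (hab : a < b) {n k : ℕ} {s : ℝ}
    (hs : s ∈ Ioc (grid a b n k) (grid a b n (k + 1))) : gridLeft a b n s = grid a b n k := by
  have hδ := grid_step_pos hab n
  have h1 : ⌈(s - a) / ((b - a) / (n + 1))⌉ = (k : ℤ) + 1 := by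
    rw [Int.ceil_eq_iff]
    simp only [grid, mem_Ioc] at hs
    push_cast at hs ⊢
    refine ⟨?_, ?_⟩
    · rw [lt_div_iff₀ hδ]; linarith [hs.1]
    · rw [div_le_iff₀ hδ]; linarith [hs.2]
  simp only [gridLeft, grid, h1]
  push_cast
  ring

theorem gridLeft_lt (hab : a < b) (n : ℕ) (s : ℝ) : gridLeft a b n s < s := by
  have hδ := grid_step_pos hab n
  have h1 := Int.ceil_lt_add_one ((s - a) / ((b - a) / (n + 1)))
  have h2 : ((⌈(s - a) / ((b - a) / (n + 1))⌉ : ℝ) - 1) * ((b - a) / (n + 1)) < s - a := by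
    rw [← lt_div_iff₀ hδ]; linarith
  simp only [gridLeft]
  linarith

theorem sub_le_gridLeft (hab : a < b) (n : ℕ) (s : ℝ) :
    s - (b - a) / (n + 1) ≤ gridLeft a b n s := by
  have hδ := grid_step_pos hab n
  have h1 := Int.le_ceil ((s - a) / ((b - a) / (n + 1)))
  rw [div_le_iff₀ hδ] at h1
  simp only [gridLeft]
  linarith

/-- The left end of the cell is strictly below `s`, so values sampled there converge to left limits.
This is how the Itô convention emerges from Riemann sums. -/
theorem tendsto_gridLeft (hab : a < b) (s : ℝ) :
    Filter.Tendsto (fun n => gridLeft a b n s) Filter.atTop (𝓝[<] s) := by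
  refine tendsto_nhdsWithin_iff.2 ⟨?_, .of_forall fun n => gridLeft_lt hab n s⟩
  refine tendsto_of_tendsto_of_tendsto_of_le_of_le ?_ tendsto_const_nhds
    (fun n => sub_le_gridLeft hab n s) fun n => (gridLeft_lt hab n s).le
  have := (tendsto_one_div_add_atTop_nhds_zero_nat (𝕜 := ℝ)).const_mul (b - a)
  simpa only [mul_one_div, mul_zero, sub_zero] using this.const_sub s

theorem gridLeft_mem (hab : a < b) (n : ℕ) {s : ℝ} (hs : s ∈ Ioc a b) :
    gridLeft a b n s ∈ Icc a b := by
  have hδ := grid_step_pos hab n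
  refine ⟨?_, (gridLeft_lt hab n s).le.trans hs.2⟩
  have h1 : (1 : ℤ) ≤ ⌈(s - a) / ((b - a) / (n + 1))⌉ :=
    Int.one_le_ceil_iff.2 (div_pos (sub_pos.2 hs.1) hδ)
  have h2 : (1 : ℝ) ≤ (⌈(s - a) / ((b - a) / (n + 1))⌉ : ℝ) := by exact_mod_cast h1
  have := mul_nonneg (sub_nonneg.2 h2) hδ.le
  simp only [gridLeft]
  linarith

theorem stronglyMeasurable_comp_gridLeft (a b : ℝ) (n : ℕ) (f : ℝ → ℂ) :
    StronglyMeasurable fun s => f (gridLeft a b n s) :=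
  (StronglyMeasurable.of_discrete (f := fun k : ℤ => f (a + ((k : ℝ) - 1) *
    ((b - a) / (n + 1))))).comp_measurable (Int.measurable_ceil.comp
      (by fun_prop : Measurable fun s : ℝ => (s - a) / ((b - a) / (n + 1))))

/-- The Riemann sum is the integral of `ρ` against the path sampled at left grid points; a càdlàg
path is bounded, so dominated convergence applies. -/
theorem tendsto_riemann_integral (hab : a < b) {ρ : ℝ → ℝ} (hρ : ContinuousOn ρ (Icc a b))
    {f : ℝ → ℂ} (hf : IsCadlagFrom a f) :
    Filter.Tendsto (fun n : ℕ => ∑ k ∈ Finset.range (n + 1),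
      ((∫ u in grid a b n k..grid a b n (k + 1), ρ u : ℝ) : ℂ) * f (grid a b n k)) Filter.atTop
      (𝓝 (∫ s in a..b, (ρ s : ℂ) * Function.leftLim f s)) := by
  obtain ⟨C, hC⟩ := hf.exists_bound b
  obtain ⟨D, hD⟩ := isCompact_Icc.exists_bound_of_continuousOn hρ
  have hρm : AEStronglyMeasurable (fun s => (ρ s : ℂ)) (volume.restrict (Ioc a b)) :=
    ((Complex.continuous_ofReal.comp_continuousOn hρ).mono
      Ioc_subset_Icc_self).aestronglyMeasurable measurableSet_Ioc
  have hm : ∀ n, AEStronglyMeasurable (fun s => (ρ s : ℂ) * f (gridLeft a b n s))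
      (volume.restrict (Ioc a b)) := fun n =>
    hρm.mul (stronglyMeasurable_comp_gridLeft a b n f).aestronglyMeasurable
  have hbound : ∀ n, ∀ s ∈ Ioc a b, ‖(ρ s : ℂ) * f (gridLeft a b n s)‖ ≤ D * C := fun n s hs => by
    rw [norm_mul, Complex.norm_real]
    have h1 := hD s ⟨hs.1.le, hs.2⟩
    exact mul_le_mul h1 (hC _ (gridLeft_mem hab n hs)) (norm_nonneg _)
      ((norm_nonneg _).trans h1)
  have hI : ∀ n, IntervalIntegrable (fun s => (ρ s : ℂ) * f (gridLeft a b n s)) volume a b :=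
    fun n => by
      rw [intervalIntegrable_iff_integrableOn_Ioc_of_le hab.le]
      refine IntegrableOn.of_bound (by simp) (hm n) (D * C) ?_
      filter_upwards [ae_restrict_mem measurableSet_Ioc] with s hs using hbound n s hs
  have hsum : ∀ n : ℕ, ∑ k ∈ Finset.range (n + 1),
      ((∫ u in grid a b n k..grid a b n (k + 1), ρ u : ℝ) : ℂ) * f (grid a b n k) =
      ∫ s in a..b, (ρ s : ℂ) * f (gridLeft a b n s) := fun n => by
    have hle : ∀ k, k < n + 1 → grid a b n k ≤ grid a b n (k + 1) := fun k _ =>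
      grid_mono hab n k.le_succ
    have hadj := intervalIntegral.sum_integral_adjacent_intervals (a := grid a b n) (n := n + 1)
      (f := fun s => (ρ s : ℂ) * f (gridLeft a b n s)) (μ := volume) fun k hk =>
        (hI n).mono_set (by
          rw [uIcc_of_le (hle k hk), uIcc_of_le hab.le]
          exact Icc_subset_Icc (grid_mem hab hk.le).1 (grid_mem hab hk).2)
    rw [grid_zero, grid_last] at hadj
    rw [← hadj]
    refine Finset.sum_congr rfl fun k hk => ?_
    have hk' := hle k (Finset.mem_range.1 hk)
    rw [← intervalIntegral.integral_ofReal, ← intervalIntegral.integral_mul_const]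
    refine intervalIntegral.integral_congr_ae (.of_forall fun s hs => ?_)
    rw [uIoc_of_le hk'] at hs
    rw [gridLeft_eq hab hs]
  simp only [hsum]
  refine intervalIntegral.tendsto_integral_filter_of_dominated_convergence (fun _ => D * C)
    (.of_forall fun n => ?_) (.of_forall fun n => .of_forall fun s hs => ?_)
    intervalIntegrable_const (.of_forall fun s hs => ?_)
  · rw [uIoc_of_le hab.le]; exact hm n
  · rw [uIoc_of_le hab.le] at hs; exact hbound n s hs
  · rw [uIoc_of_le hab.le] at hs
    exact ((hf.tendsto_leftLim hs.1).comp (tendsto_gridLeft hab s)).const_mul _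

theorem IsJumpPath.mono_start {t₀ s : ℝ} {N : ℝ → ℕ} (h : IsJumpPath t₀ N) (hs : t₀ ≤ s) :
    IsJumpPath s N :=
  ⟨h.mono.mono (Ici_subset_Ici.2 hs), fun t ht => h.right_cont t (hs.trans ht)⟩

theorem IsJumpPath.jumpIntegral_const {N : ℝ → ℕ} (h : IsJumpPath a N) (c : ℂ) (hab : a ≤ b) :
    jumpIntegral N (fun _ => c) a b = (N b - N a) • c := by
  -- The path `N • c` has zero drift and jumps by `c` for each unit of `N`; its integral equation is
  -- the claim.
  have hd : IsJumpDiff a (fun _ : Fin 1 => N) (fun _ => (0 : ℂ)) (fun _ _ => c)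
      (fun t => N t • c) := by
    refine ⟨fun t ht => ?_, fun t ht => ?_⟩
    · exact (hasDerivWithinAt_const t (Ici t) (N t • c)).congr_of_eventuallyEq
        ((h.eventually_right ht).mono fun s hs => by simp only [hs]) rfl
    · simp only [Finset.univ_unique, Finset.sum_singleton]
      rw [← h.leftLim_add_jumpSize ht, add_smul, add_sub_cancel_right]
      exact tendsto_const_nhds.congr' ((h.eventually_left ht).mono fun s hs => by simp only [hs])
  have := hd.eq_integral_add (fun _ => h) (isCadlagFrom_of_continuousOn continuousOn_const) hab
  simp only [intervalIntegral.integral_zero, add_zero, Finset.univ_unique,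
    Finset.sum_singleton] at this
  have hN : N b = N a + (N b - N a) := (Nat.add_sub_cancel' (h.mono (mem_Ici.2 le_rfl) hab hab)).symm
  rw [hN, add_smul] at this
  exact (add_left_cancel this).symm

/-- The sum equals the jump integral of the path sampled at left grid points, which runs over the
fixed finite set of jump times, so the limit is taken term by term. -/
theorem tendsto_riemann_jumpIntegral (hab : a < b) {N : ℝ → ℕ} (h : IsJumpPath a N) {f : ℝ → ℂ}
    (hf : IsCadlagFrom a f) :
    Filter.Tendsto (fun n : ℕ => ∑ k ∈ Finset.range (n + 1),
      (((N (grid a b n (k + 1)) - N (grid a b n k) : ℕ) : ℂ) * f (grid a b n k))) Filter.atTop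
      (𝓝 (jumpIntegral N (Function.leftLim f) a b)) := by
  have hsum : ∀ n : ℕ, ∑ k ∈ Finset.range (n + 1),
      (((N (grid a b n (k + 1)) - N (grid a b n k) : ℕ) : ℂ) * f (grid a b n k)) =
      jumpIntegral N (fun s => f (gridLeft a b n s)) a b := fun n => by
    have hadj : ∀ j : ℕ, j ≤ n + 1 → ∑ k ∈ Finset.range j, jumpIntegral N
        (fun s => f (gridLeft a b n s)) (grid a b n k) (grid a b n (k + 1)) =
        jumpIntegral N (fun s => f (gridLeft a b n s)) a (grid a b n j) := by
      intro j hj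
      induction j with
      | zero => simp [jumpIntegral_self]
      | succ j ih =>
        rw [Finset.sum_range_succ, ih (by omega), h.jumpIntegral_add _ le_rfl
          (grid_mem hab (by omega : j ≤ n + 1)).1 (grid_mono hab n j.le_succ)]
    have hlast := hadj (n + 1) le_rfl
    rw [grid_last] at hlast
    rw [← hlast]
    refine Finset.sum_congr rfl fun k hk => ?_
    have hk' := grid_mono hab n k.le_succ
    rw [← nsmul_eq_mul, ← (h.mono_start (grid_mem hab
      (Finset.mem_range.1 hk).le).1).jumpIntegral_const _ hk']
    refine finsum_mem_congr rfl fun s hs => ?_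
    simp only [gridLeft_eq hab hs]
  simp only [hsum, h.jumpIntegral_eq_sum le_rfl]
  refine tendsto_finsetSum _ fun s hs => ?_
  have hs' : s ∈ Ioc a b := ((Set.Finite.mem_toFinset _).1 hs).1
  exact ((hf.tendsto_leftLim hs'.1).comp (tendsto_gridLeft hab s)).const_smul _

end Riemann

/-! ### Expectations of time integrals and of Poisson integrals -/

section Compensator

variable {Ω : Type*} [mΩ : MeasurableSpace Ω] {P : Measure Ω} {ℱ : Filtration ℝ mΩ} {t₀ : ℝ}
  {m : ℕ} {r : Fin m → ℝ → ℝ} {ϖ : Fin m → ℝ → Ω → ℕ}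

/-- Adapted càdlàg processes which jump only with the driving processes and which grow at most
exponentially in the number of jumps. -/
structure IsTameProcess (P : Measure Ω) (ℱ : Filtration ℝ mΩ) (t₀ : ℝ)
    (ϖ : Fin m → ℝ → Ω → ℕ) (c : ℝ → Ω → ℂ) : Prop where
  adapted : ∀ t, t₀ ≤ t → Measurable[ℱ t] (c t)
  cadlag : ∀ᵐ ω ∂P, IsCadlagFrom t₀ fun t => c t ω
  left : ∀ᵐ ω ∂P, ∀ t, t₀ < t → (∀ l, jumpSize (fun s => ϖ l s ω) t = 0) →
    Function.leftLim (fun s => c s ω) t = c t ω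
  bound : ∀ T, ∃ C κ : ℝ, 0 ≤ C ∧ 1 ≤ κ ∧ ∀ᵐ ω ∂P, ∀ t ∈ Icc t₀ T,
    ‖c t ω‖ ≤ C * κ ^ (∑ l, ϖ l T ω)

namespace IsTameProcess

variable {c c' : ℝ → Ω → ℂ}

theorem measurable (hc : IsTameProcess P ℱ t₀ ϖ c) {t : ℝ} (ht : t₀ ≤ t) : Measurable (c t) :=
  (hc.adapted t ht).mono (ℱ.le t) le_rfl

theorem mul_continuous (hc : IsTameProcess P ℱ t₀ ϖ c) {f : ℝ → ℂ}
    (hf : ContinuousOn f (Ici t₀)) : IsTameProcess P ℱ t₀ ϖ fun t ω => f t * c t ω := by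
  refine ⟨fun t ht => (hc.adapted t ht).const_mul (f t), ?_, ?_, fun T => ?_⟩
  · filter_upwards [hc.cadlag] with ω hω using (isCadlagFrom_of_continuousOn hf).mul hω
  · filter_upwards [hc.left, hc.cadlag] with ω h1 h2 t ht h0
    refine leftLim_eq_of_tendsto (Filter.Tendsto.mul ?_ ?_)
    · exact ((hf.continuousAt (Ici_mem_nhds ht)).tendsto).mono_left nhdsWithin_le_nhds
    · rw [← h1 t ht h0]
      exact h2.tendsto_leftLim ht
  · obtain ⟨C, κ, hC, hκ, hb⟩ := hc.bound T
    obtain ⟨D, hD⟩ := isCompact_Icc.exists_bound_of_continuousOn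
      (hf.mono (Icc_subset_Ici_self : Icc t₀ T ⊆ Ici t₀))
    refine ⟨|D| * C, κ, by positivity, hκ, ?_⟩
    filter_upwards [hb] with ω hω t ht
    rw [norm_mul, mul_assoc]
    exact mul_le_mul ((hD t ht).trans (le_abs_self _)) (hω t ht) (norm_nonneg _) (abs_nonneg _)

theorem add (hc : IsTameProcess P ℱ t₀ ϖ c) (hc' : IsTameProcess P ℱ t₀ ϖ c') :
    IsTameProcess P ℱ t₀ ϖ fun t ω => c t ω + c' t ω := by
  refine ⟨fun t ht => (hc.adapted t ht).add (hc'.adapted t ht), ?_, ?_, fun T => ?_⟩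
  · filter_upwards [hc.cadlag, hc'.cadlag] with ω h1 h2
    exact (h1.prodMk h2).continuous_comp continuous_add
  · filter_upwards [hc.left, hc.cadlag, hc'.left, hc'.cadlag] with ω h1 h2 h3 h4 t ht h0
    refine leftLim_eq_of_tendsto (Filter.Tendsto.add ?_ ?_)
    · rw [← h1 t ht h0]
      exact h2.tendsto_leftLim ht
    · rw [← h3 t ht h0]
      exact h4.tendsto_leftLim ht
  · obtain ⟨C, κ, hC, hκ, hb⟩ := hc.bound T
    obtain ⟨C', κ', hC', hκ', hb'⟩ := hc'.bound T
    refine ⟨C + C', max κ κ', by positivity, hκ.trans (le_max_left _ _), ?_⟩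
    filter_upwards [hb, hb'] with ω h1 h2 t ht
    have hκ0 : 0 ≤ κ := zero_le_one.trans hκ
    have hκ0' : 0 ≤ κ' := zero_le_one.trans hκ'
    refine (norm_add_le _ _).trans ((add_le_add (h1 t ht) (h2 t ht)).trans ?_)
    rw [add_mul]
    gcongr
    · exact le_max_left _ _
    · exact le_max_right _ _

theorem zero : IsTameProcess P ℱ t₀ ϖ fun _ _ => (0 : ℂ) :=
  ⟨fun _ _ => measurable_const, .of_forall fun _ => isCadlagFrom_of_continuousOn continuousOn_const,
    .of_forall fun _ _ _ _ => leftLim_eq_of_tendsto tendsto_const_nhds,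
    fun _ => ⟨0, 1, le_rfl, le_rfl, by simp⟩⟩

theorem sum {ι : Type*} (S : Finset ι) {c : ι → ℝ → Ω → ℂ}
    (hc : ∀ l ∈ S, IsTameProcess P ℱ t₀ ϖ (c l)) :
    IsTameProcess P ℱ t₀ ϖ fun t ω => ∑ l ∈ S, c l t ω := by
  classical
  induction S using Finset.induction_on with
  | empty => simpa using zero
  | insert a S ha ih =>
    simp only [Finset.sum_insert ha]
    exact (hc a (Finset.mem_insert_self _ _)).add (ih fun l hl =>
      hc l (Finset.mem_insert_of_mem hl))

variable [IsProbabilityMeasure P]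

theorem integrable (hc : IsTameProcess P ℱ t₀ ϖ c) (h : IsPoissonSystem P ℱ t₀ r ϖ) {t : ℝ}
    (ht : t₀ ≤ t) : Integrable (c t) P := by
  obtain ⟨C, κ, hC, hκ, hb⟩ := hc.bound t
  refine ((h.integrable_pow hκ ht).const_mul C).mono' (hc.measurable ht).aestronglyMeasurable ?_
  filter_upwards [hb] with ω hω using hω t ⟨ht, le_rfl⟩

/-- At a fixed time there is almost surely no jump, so almost every path is continuous there
although the paths do jump; dominated convergence does the rest. -/
theorem continuousOn_expectation (hc : IsTameProcess P ℱ t₀ ϖ c) (h : IsPoissonSystem P ℱ t₀ r ϖ)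
    (hr : ∀ l, ContinuousOn (r l) (Ici t₀)) :
    ContinuousOn (fun t => ∫ ω, c t ω ∂P) (Ici t₀) := by
  intro t ht
  obtain ⟨C, κ, hC, hκ, hb⟩ := hc.bound (t + 1)
  have ht1 : t₀ ≤ t + 1 := le_add_of_le_of_nonneg ht zero_le_one
  have hnear : ∀ᶠ s in 𝓝[Ici t₀] t, s ∈ Icc t₀ (t + 1) := by
    filter_upwards [self_mem_nhdsWithin, mem_nhdsWithin_of_mem_nhds (Iio_mem_nhds (lt_add_one t))]
      with s h1 h2 using ⟨h1, le_of_lt h2⟩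
  refine continuousWithinAt_of_dominated (bound := fun ω => C * κ ^ (∑ l, ϖ l (t + 1) ω)) ?_ ?_
    ((h.integrable_pow hκ ht1).const_mul C) ?_
  · exact hnear.mono fun s hs => (hc.measurable hs.1).aestronglyMeasurable
  · refine hnear.mono fun s hs => ?_
    filter_upwards [hb] with ω hω using hω s hs
  · have hno : ∀ᵐ ω ∂P, t₀ < t → ∀ l, jumpSize (fun s => ϖ l s ω) t = 0 := by
      by_cases hlt : t₀ < t
      · filter_upwards [h.ae_no_jump hr hlt] with ω hω _ using hω
      · exact .of_forall fun ω hlt' => absurd hlt' hlt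
    filter_upwards [hc.cadlag, hc.left, hno] with ω h1 h2 h3
    rcases (mem_Ici.1 ht).eq_or_lt with rfl | hlt
    · exact h1.1 _ le_rfl
    · refine ContinuousAt.continuousWithinAt (continuousAt_iff_continuous_left'_right'.2 ⟨?_, ?_⟩)
      · have := h1.tendsto_leftLim hlt
        rwa [h2 t hlt (h3 hlt)] at this
      · exact (h1.1 t ht).mono Ioi_subset_Ici_self

/-- The exchange of expectation and time integral goes through Riemann sums, so that only
measurability at each fixed time enters. -/
theorem integral_timeIntegral (hc : IsTameProcess P ℱ t₀ ϖ c) (h : IsPoissonSystem P ℱ t₀ r ϖ)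
    (hr : ∀ l, ContinuousOn (r l) (Ici t₀)) {T : ℝ} (hT : t₀ ≤ T) :
    Integrable (fun ω => ∫ s in t₀..T, c s ω) P ∧
      ∫ ω, (∫ s in t₀..T, c s ω) ∂P = ∫ s in t₀..T, ∫ ω, c s ω ∂P := by
  rcases hT.eq_or_lt with rfl | hlt
  · simp
  obtain ⟨C, κ, hC, hκ, hb⟩ := hc.bound T
  let X : ℕ → Ω → ℂ := fun n ω => ∑ k ∈ Finset.range (n + 1),
    ((∫ u in grid t₀ T n k..grid t₀ T n (k + 1), (fun _ => (1 : ℝ)) u : ℝ) : ℂ) *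
      c (grid t₀ T n k) ω
  have hgrid : ∀ n k, k ∈ Finset.range (n + 1) → grid t₀ T n k ∈ Icc t₀ T := fun n k hk =>
    grid_mem hlt (Finset.mem_range.1 hk).le
  have hXm : ∀ n, AEStronglyMeasurable (X n) P := fun n =>
    (Finset.measurable_fun_sum _ fun k hk =>
      (hc.measurable (hgrid n k hk).1).const_mul _).aestronglyMeasurable
  have hXb : ∀ n, ∀ᵐ ω ∂P, ‖X n ω‖ ≤ (T - t₀) * (C * κ ^ (∑ l, ϖ l T ω)) := fun n => by
    filter_upwards [hb] with ω hω
    refine (norm_sum_le _ _).trans ?_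
    have hsum : ∑ k ∈ Finset.range (n + 1), (grid t₀ T n (k + 1) - grid t₀ T n k) = T - t₀ := by
      rw [Finset.sum_range_sub, grid_last, grid_zero]
    rw [← hsum, Finset.sum_mul]
    refine Finset.sum_le_sum fun k hk => ?_
    rw [norm_mul, Complex.norm_real, intervalIntegral.integral_const, smul_eq_mul, mul_one,
      Real.norm_of_nonneg (sub_nonneg.2 (grid_mono hlt n k.le_succ))]
    exact mul_le_mul_of_nonneg_left (hω _ (hgrid n k hk))
      (sub_nonneg.2 (grid_mono hlt n k.le_succ))
  have hint : Integrable (fun ω => (T - t₀) * (C * κ ^ (∑ l, ϖ l T ω))) P :=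
    ((h.integrable_pow hκ hT).const_mul C).const_mul _
  have hXlim : ∀ᵐ ω ∂P, Filter.Tendsto (fun n => X n ω) Filter.atTop
      (𝓝 (∫ s in t₀..T, c s ω)) := by
    filter_upwards [hc.cadlag, hc.left, h.ae_isJumpPath] with ω h1 h2 h3
    have h4 := tendsto_riemann_integral hlt (ρ := fun _ => 1) continuousOn_const h1
    -- The path and its left limits differ only at the finitely many jump times, a null set.
    have h5 : ∫ s in t₀..T, ((1 : ℝ) : ℂ) * Function.leftLim (fun t => c t ω) s =
        ∫ s in t₀..T, c s ω := by
      refine intervalIntegral.integral_congr_ae ?_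
      have hfin : (⋃ l, {s ∈ Ioc t₀ T | jumpSize (fun u => ϖ l u ω) s ≠ 0}).Finite :=
        finite_iUnion fun l => (h3 l).finite_jumps le_rfl T
      have hnull := measure_eq_zero_iff_ae_notMem.1 (hfin.measure_zero volume)
      filter_upwards [hnull] with s hs hsT
      rw [uIoc_of_le hT] at hsT
      simp only [mem_iUnion, not_exists] at hs
      rw [Complex.ofReal_one, one_mul, h2 s hsT.1 fun l => by
        by_contra hne
        exact hs l ⟨hsT, hne⟩]
    rw [h5] at h4
    exact h4
  have hlimI := tendsto_integral_of_dominated_convergence _ hXm hint hXb hXlim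
  have hXI : ∀ n, ∫ ω, X n ω ∂P = ∑ k ∈ Finset.range (n + 1),
      ((∫ u in grid t₀ T n k..grid t₀ T n (k + 1), (fun _ => (1 : ℝ)) u : ℝ) : ℂ) *
        ∫ ω, c (grid t₀ T n k) ω ∂P := fun n => by
    rw [integral_finsetSum _ fun k hk => (hc.integrable h (hgrid n k hk).1).const_mul _]
    simp_rw [integral_const_mul]
  have hec := hc.continuousOn_expectation h hr
  have hlimE := tendsto_riemann_integral hlt (ρ := fun _ => 1) continuousOn_const
    (isCadlagFrom_of_continuousOn hec)
  have hE : ∫ s in t₀..T, ((1 : ℝ) : ℂ) * Function.leftLim (fun t => ∫ ω, c t ω ∂P) s =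
      ∫ s in t₀..T, ∫ ω, c s ω ∂P := by
    refine intervalIntegral.integral_congr_ae (.of_forall fun s hs => ?_)
    rw [uIoc_of_le hT] at hs
    rw [Complex.ofReal_one, one_mul]
    exact leftLim_eq_of_tendsto (((hec.continuousAt (Ici_mem_nhds hs.1)).tendsto).mono_left
      nhdsWithin_le_nhds)
  rw [hE] at hlimE
  refine ⟨hint.mono' (aestronglyMeasurable_of_tendsto_ae _ hXm hXlim) ?_,
    tendsto_nhds_unique hlimI (by simpa only [hXI] using hlimE)⟩
  filter_upwards [hXlim, ae_all_iff.2 hXb] with ω h1 h2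
  exact le_of_tendsto h1.norm (.of_forall h2)

omit [IsProbabilityMeasure P] in
-- The increment after `s` is independent of the past, to which `c s` belongs, so the expectation
-- factorizes; the Poisson mean of the increment is the integral of the rate.
theorem integral_incr_mul (hc : IsTameProcess P ℱ t₀ ϖ c) (h : IsPoissonSystem P ℱ t₀ r ϖ)
    (hpos : ∀ l t, t₀ ≤ t → 0 < r l t) (l : Fin m) {s t : ℝ} (hs : t₀ ≤ s) (hst : s ≤ t) :
    ∫ ω, ((ϖ l t ω - ϖ l s ω : ℕ) : ℂ) * c s ω ∂P =
      ((∫ u in s..t, r l u : ℝ) : ℂ) * ∫ ω, c s ω ∂P := by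
  have hind : IndepFun (fun ω => ϖ l t ω - ϖ l s ω) (c s) P := by
    rw [IndepFun_iff_Indep]
    refine indep_of_indep_of_le_left (indep_of_indep_of_le_right (h.indep_past s hs)
      (hc.adapted s hs).comap_le) ?_
    exact le_iSup_of_le l (le_iSup_of_le (⟨t, hst⟩ : Ici s) le_rfl)
  have hcast : IndepFun (fun ω => ((ϖ l t ω - ϖ l s ω : ℕ) : ℂ)) (c s) P :=
    hind.comp (φ := fun n : ℕ => (n : ℂ)) (ψ := id) .of_discrete measurable_id
  have h1 := hcast.integral_mul_eq_mul_integral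
    ((Measurable.of_discrete (f := fun n : ℕ => (n : ℂ))).comp
      (h.measurable_incr l hs hst)).aestronglyMeasurable (hc.measurable hs).aestronglyMeasurable
  simp only [Pi.mul_apply] at h1
  rw [h1, ← h.integral_incr hpos l hs hst, ← integral_complex_ofReal]
  simp

/-- The compensator formula. On each cell of a grid it is the factorization of the increment from
the past value at the left end; both sides pass to the limit of fine grids. -/
theorem integral_jumpIntegral (hc : IsTameProcess P ℱ t₀ ϖ c) (h : IsPoissonSystem P ℱ t₀ r ϖ)
    (hr : ∀ l, ContinuousOn (r l) (Ici t₀)) (hpos : ∀ l t, t₀ ≤ t → 0 < r l t) (l : Fin m)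
    {T : ℝ} (hT : t₀ ≤ T) :
    Integrable (fun ω => jumpIntegral (fun s => ϖ l s ω)
      (Function.leftLim fun s => c s ω) t₀ T) P ∧
      ∫ ω, jumpIntegral (fun s => ϖ l s ω) (Function.leftLim fun s => c s ω) t₀ T ∂P =
        ∫ s in t₀..T, (r l s : ℂ) * ∫ ω, c s ω ∂P := by
  rcases hT.eq_or_lt with rfl | hlt
  · simp [jumpIntegral_self]
  obtain ⟨C, κ, hC, hκ, hb⟩ := hc.bound T
  let X : ℕ → Ω → ℂ := fun n ω => ∑ k ∈ Finset.range (n + 1),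
    ((ϖ l (grid t₀ T n (k + 1)) ω - ϖ l (grid t₀ T n k) ω : ℕ) : ℂ) * c (grid t₀ T n k) ω
  have hgrid : ∀ n k, k ∈ Finset.range (n + 1) → grid t₀ T n k ∈ Icc t₀ T := fun n k hk =>
    grid_mem hlt (Finset.mem_range.1 hk).le
  have hXm : ∀ n, AEStronglyMeasurable (X n) P := fun n =>
    (Finset.measurable_fun_sum _ fun k hk =>
      (((Measurable.of_discrete (f := fun n : ℕ => (n : ℂ))).comp (h.measurable_incr l
        (hgrid n k hk).1 (grid_mono hlt n k.le_succ))).mul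
          (hc.measurable (hgrid n k hk).1))).aestronglyMeasurable
  have hκ0 : 0 ≤ κ := zero_le_one.trans hκ
  -- The increments add up to at most the total count `M`, and `M ≤ 2 ^ M` merges this factor into
  -- the exponential bound.
  have hXb : ∀ n, ∀ᵐ ω ∂P, ‖X n ω‖ ≤ C * (2 * κ) ^ (∑ l, ϖ l T ω) := fun n => by
    filter_upwards [hb, h.ae_isJumpPath] with ω hω hN
    have hmono : Monotone fun k => ϖ l (grid t₀ T n k) ω := fun i j hij => by
      have hi : t₀ ≤ grid t₀ T n i :=
        (grid_zero t₀ T n).symm.le.trans (grid_mono hlt n i.zero_le)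
      have hj := grid_mono hlt n hij
      exact (hN l).mono hi (hi.trans hj) hj
    have hsum : ∑ k ∈ Finset.range (n + 1), (ϖ l (grid t₀ T n (k + 1)) ω -
        ϖ l (grid t₀ T n k) ω) ≤ ∑ l, ϖ l T ω := by
      rw [Finset.sum_range_tsub hmono, grid_last]
      exact (Nat.sub_le _ _).trans (Finset.single_le_sum (f := fun l => ϖ l T ω)
        (fun _ _ => Nat.zero_le _) (Finset.mem_univ l))
    calc ‖X n ω‖ ≤ ∑ k ∈ Finset.range (n + 1), ((ϖ l (grid t₀ T n (k + 1)) ω -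
            ϖ l (grid t₀ T n k) ω : ℕ) : ℝ) * (C * κ ^ (∑ l, ϖ l T ω)) := by
          refine (norm_sum_le _ _).trans (Finset.sum_le_sum fun k hk => ?_)
          rw [norm_mul, Complex.norm_natCast]
          exact mul_le_mul_of_nonneg_left (hω _ (hgrid n k hk)) (Nat.cast_nonneg _)
      _ = ((∑ k ∈ Finset.range (n + 1), (ϖ l (grid t₀ T n (k + 1)) ω -
            ϖ l (grid t₀ T n k) ω) : ℕ) : ℝ) * (C * κ ^ (∑ l, ϖ l T ω)) := by
          rw [← Finset.sum_mul, Nat.cast_sum]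
      _ ≤ (2 : ℝ) ^ (∑ l, ϖ l T ω) * (C * κ ^ (∑ l, ϖ l T ω)) := by
          refine mul_le_mul_of_nonneg_right ?_ (by positivity)
          exact_mod_cast hsum.trans (Nat.lt_two_pow_self).le
      _ = _ := by rw [mul_pow]; ring
  have hint : Integrable (fun ω => C * (2 * κ) ^ (∑ l, ϖ l T ω)) P :=
    (h.integrable_pow (by linarith) hT).const_mul C
  have hXlim : ∀ᵐ ω ∂P, Filter.Tendsto (fun n => X n ω) Filter.atTop
      (𝓝 (jumpIntegral (fun s => ϖ l s ω) (Function.leftLim fun s => c s ω) t₀ T)) := by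
    filter_upwards [hc.cadlag, h.ae_isJumpPath] with ω h1 h3
    exact tendsto_riemann_jumpIntegral hlt (h3 l) h1
  have hlimI := tendsto_integral_of_dominated_convergence _ hXm hint hXb hXlim
  have hXint : ∀ n, ∀ k ∈ Finset.range (n + 1), Integrable (fun ω =>
      ((ϖ l (grid t₀ T n (k + 1)) ω - ϖ l (grid t₀ T n k) ω : ℕ) : ℂ) * c (grid t₀ T n k) ω) P := by
    intro n k hk
    refine hint.mono' (((Measurable.of_discrete (f := fun n : ℕ => (n : ℂ))).comp
      (h.measurable_incr l (hgrid n k hk).1 (grid_mono hlt n k.le_succ))).mul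
        (hc.measurable (hgrid n k hk).1)).aestronglyMeasurable ?_
    filter_upwards [hb, h.ae_isJumpPath] with ω hω hN
    have hle : ϖ l (grid t₀ T n (k + 1)) ω - ϖ l (grid t₀ T n k) ω ≤ ∑ l, ϖ l T ω := by
      have h1 := grid_mem hlt (Finset.mem_range.1 hk : k + 1 ≤ n + 1)
      exact (Nat.sub_le _ _).trans (((hN l).mono h1.1 hT h1.2).trans
        (Finset.single_le_sum (f := fun l => ϖ l T ω) (fun _ _ => Nat.zero_le _)
          (Finset.mem_univ l)))
    rw [norm_mul, Complex.norm_natCast, mul_pow, ← mul_assoc, mul_comm C, mul_assoc]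
    refine mul_le_mul ?_ (hω _ (hgrid n k hk)) (norm_nonneg _) (by positivity)
    exact_mod_cast hle.trans (Nat.lt_two_pow_self).le
  have hXI : ∀ n, ∫ ω, X n ω ∂P = ∑ k ∈ Finset.range (n + 1),
      ((∫ u in grid t₀ T n k..grid t₀ T n (k + 1), r l u : ℝ) : ℂ) *
        ∫ ω, c (grid t₀ T n k) ω ∂P := fun n => by
    rw [integral_finsetSum _ (hXint n)]
    exact Finset.sum_congr rfl fun k hk => hc.integral_incr_mul h hpos l (hgrid n k hk).1
      (grid_mono hlt n k.le_succ)
  have hec := hc.continuousOn_expectation h hr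
  have hlimE := tendsto_riemann_integral hlt ((hr l).mono Icc_subset_Ici_self)
    (isCadlagFrom_of_continuousOn hec)
  have hE : ∫ s in t₀..T, (r l s : ℂ) * Function.leftLim (fun t => ∫ ω, c t ω ∂P) s =
      ∫ s in t₀..T, (r l s : ℂ) * ∫ ω, c s ω ∂P := by
    refine intervalIntegral.integral_congr_ae (.of_forall fun s hs => ?_)
    rw [uIoc_of_le hT] at hs
    rw [leftLim_eq_of_tendsto (((hec.continuousAt (Ici_mem_nhds hs.1)).tendsto).mono_left
      nhdsWithin_le_nhds)]
  rw [hE] at hlimE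
  refine ⟨hint.mono' (aestronglyMeasurable_of_tendsto_ae _ hXm hXlim) ?_,
    tendsto_nhds_unique hlimI (by simpa only [hXI] using hlimE)⟩
  filter_upwards [hXlim, ae_all_iff.2 hXb] with ω h1 h2
  exact le_of_tendsto h1.norm (.of_forall h2)

end IsTameProcess

end Compensator

/-! ### The expectation of a solution, weighted by a function of the number of jumps -/

section LinearEntries

variable {d : ℕ}

theorem linear_apply_eq_sum (Ψ : Op d →ₗ[ℂ] Op d) (ρ : Op d) (i j : Fin d) :
    Ψ ρ i j = ∑ p, ∑ q, Ψ (Matrix.single p q 1) i j * ρ p q := by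
  conv_lhs => rw [Matrix.matrix_eq_sum_single ρ]
  simp only [map_sum, Matrix.sum_apply]
  refine Finset.sum_congr rfl fun p _ => Finset.sum_congr rfl fun q _ => ?_
  have : Matrix.single p q (ρ p q) = ρ p q • Matrix.single p q (1 : ℂ) := by
    rw [Matrix.smul_single, smul_eq_mul, mul_one]
  rw [this, map_smul, Matrix.smul_apply, smul_eq_mul, mul_comm]

/-- The linear map `ρ ↦ c B ρ B†`. -/
noncomputable def conjLin (c : ℂ) (B : Op d) : Op d →ₗ[ℂ] Op d :=
  c • (LinearMap.mulRight ℂ Bᴴ ∘ₗ LinearMap.mulLeft ℂ B)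

theorem continuousOn_conjLin {c : ℝ → ℝ} {B : ℝ → Op d} {S : Set ℝ} (hc : ContinuousOn c S)
    (hB : ContinuousOn B S) (X : Op d) : ContinuousOn (fun t => conjLin (c t : ℂ) (B t) X) S :=
  continuousOn_ofReal_smul hc ((hB.mul continuousOn_const).mul (continuousOn_conjTranspose hB))

theorem tendsto_linear_left {t₀ : ℝ} {Ψ : ℝ → Op d →ₗ[ℂ] Op d}
    (hΨ : ∀ X, ContinuousOn (fun t => Ψ t X) (Ici t₀)) {S : ℝ → Op d} (hS : IsCadlagFrom t₀ S)
    {M : ℝ → ℕ} (hM : IsJumpPath t₀ M) (g : ℕ → ℂ) (i j : Fin d) {t : ℝ} (ht : t₀ < t) :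
    Filter.Tendsto (fun u => Ψ u (S u) i j * g (M u)) (𝓝[<] t)
      (𝓝 (Ψ t (Function.leftLim S t) i j * g (Function.leftLim M t))) := by
  refine Filter.Tendsto.mul ?_ ?_
  · obtain ⟨y, hSt⟩ := hS.2 t ht
    rw [leftLim_eq_of_tendsto hSt, linear_apply_eq_sum]
    refine Filter.Tendsto.congr (fun u => (linear_apply_eq_sum (Ψ u) (S u) i j).symm) ?_
    refine tendsto_finsetSum _ fun p _ => tendsto_finsetSum _ fun q _ => Filter.Tendsto.mul ?_ ?_
    · exact (((continuousOn_entry (hΨ _) i j).continuousAt (Ici_mem_nhds ht)).tendsto).mono_left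
        nhdsWithin_le_nhds
    · exact ((continuous_id.matrix_elem p q).tendsto _).comp hSt
  · exact tendsto_const_nhds.congr' ((hM.eventually_left ht).mono fun u hu => by rw [← hu])

end LinearEntries

/-! ### Evolution equations for the expectations of σ weighted by functions of the jump count. -/

section Counted

variable {Ω : Type*} [mΩ : MeasurableSpace Ω] {P : Measure Ω} {ℱ : Filtration ℝ mΩ} {t₀ : ℝ}
  {d m : ℕ} {H : ℝ → Op d} {L : Fin m → ℝ → Op d} {w r : Fin m → ℝ → ℝ} {A : ℝ → Op d}
  {ϖ : Fin m → ℝ → Ω → ℕ} {z : Fin d → ℂ} {φ : ℝ → Ω → Fin d → ℂ} {lam : ℝ → Ω → ℝ}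

theorem integral_add_add {X Y Z : Ω → ℂ} (hX : Integrable X P) (hY : Integrable Y P)
    (hZ : Integrable Z P) :
    ∫ ω, (X ω + Y ω + Z ω) ∂P = (∫ ω, X ω ∂P) + (∫ ω, Y ω ∂P) + ∫ ω, Z ω ∂P := by
  rw [integral_add (hX.fun_add hY) hZ, integral_add hX hY]

theorem IsOstensibleSolution.ae_isSolutionPath
    (hs : IsOstensibleSolution P ℱ t₀ A L w r ϖ z φ lam) [IsProbabilityMeasure P]
    (h : IsPoissonSystem P ℱ t₀ r ϖ) (hr : ∀ l, ContinuousOn (r l) (Ici t₀)) :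
    ∀ᵐ ω ∂P, IsSolutionPath t₀ A L w r (fun l s => ϖ l s ω) z (fun t => φ t ω)
      (fun t => lam t ω) := by
  filter_upwards [h.ae_isJumpPath, h.ae_simple hr, hs.cadlag_φ, hs.cadlag_lam, hs.eq_φ, hs.eq_lam]
    with ω h1 h2 h3 h4 h5 h6 using ⟨h1, h2, h3, h4, h5, h6⟩

/-- The process `σ_t g(M_t)`, where `M` counts the jumps. -/
noncomputable def counted (ϖ : Fin m → ℝ → Ω → ℕ) (φ : ℝ → Ω → Fin d → ℂ) (lam : ℝ → Ω → ℝ)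
    (g : ℕ → ℂ) (t : ℝ) (ω : Ω) : Op d :=
  g (∑ l, ϖ l t ω) • sigma φ lam t ω

omit mΩ in
theorem counted_apply (g : ℕ → ℂ) (t : ℝ) (ω : Ω) (i j : Fin d) :
    counted ϖ φ lam g t ω i j =
      weightedProj (φ t ω) (lam t ω) i j * g (∑ l, ϖ l t ω) := mul_comm _ _

section

variable (hs : IsOstensibleSolution P ℱ t₀ A L w r ϖ z φ lam) [IsProbabilityMeasure P]
  (h : IsPoissonSystem P ℱ t₀ r ϖ) (hr : ∀ l, ContinuousOn (r l) (Ici t₀))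
  (hA : ContinuousOn A (Ici t₀)) (hL : ∀ l, ContinuousOn (L l) (Ici t₀))
  (hwr : ∀ l, ContinuousOn (fun t => w l t / r l t) (Ici t₀))
  {g : ℕ → ℂ} {C : ℝ} (hg : ∀ n, ‖g n‖ ≤ C)

include hs h hr hA hL hwr hg

theorem isTameProcess_counted (i j : Fin d) :
    IsTameProcess P ℱ t₀ ϖ fun t ω => counted ϖ φ lam g t ω i j := by
  have hC : 0 ≤ C := (norm_nonneg _).trans (hg 0)
  have hsol := hs.ae_isSolutionPath h hr
  simp only [counted_apply]
  refine ⟨fun t ht => ?_, ?_, ?_, fun T => ?_⟩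
  · have hφ := hs.adapted_φ t ht
    have hl := hs.adapted_lam t ht
    have hϖ := fun l => h.adapted l t ht
    simp only [weightedProj_apply]
    refine Measurable.mul (Measurable.mul (Complex.measurable_ofReal.comp hl)
      (Measurable.mul ((measurable_pi_apply i).comp hφ) ?_)) ?_
    · exact continuous_star.measurable.comp ((measurable_pi_apply j).comp hφ)
    · exact (Measurable.of_discrete (f := g)).comp (Finset.measurable_fun_sum _ fun l _ => hϖ l)
  · filter_upwards [hsol] with ω hω using (hω.isJumpDiff_counted hA g i j).isCadlagFrom
  · filter_upwards [hsol] with ω hω t ht h0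
    rw [(hω.isJumpDiff_counted hA g i j).leftLim ht]
    simp [h0]
  · obtain ⟨D, κ, hD, hκ, hb⟩ := exists_solutionPath_bound hA hL hwr z T
    refine ⟨D * C, κ, by positivity, hκ, ?_⟩
    filter_upwards [hsol] with ω hω t ht
    have := hb _ _ _ hω t ht i j
    have hκ0 : 0 ≤ κ := zero_le_one.trans hκ
    rw [norm_mul, mul_right_comm]
    exact mul_le_mul this (hg _) (norm_nonneg _) (by positivity)

theorem isTameProcess_linear {Ψ : ℝ → Op d →ₗ[ℂ] Op d}
    (hΨ : ∀ X, ContinuousOn (fun t => Ψ t X) (Ici t₀)) (i j : Fin d) :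
    IsTameProcess P ℱ t₀ ϖ fun t ω => Ψ t (counted ϖ φ lam g t ω) i j := by
  have e : (fun t ω => Ψ t (counted ϖ φ lam g t ω) i j) = fun t ω => ∑ p, ∑ q,
      Ψ t (Matrix.single p q 1) i j * counted ϖ φ lam g t ω p q := by
    funext t ω
    exact linear_apply_eq_sum _ _ i j
  rw [e]
  exact .sum _ fun p _ => .sum _ fun q _ => (isTameProcess_counted hs h hr hA hL hwr hg p q
    ).mul_continuous (continuousOn_entry (hΨ _) i j)

theorem integral_linear (Ψ : Op d →ₗ[ℂ] Op d) (i j : Fin d) {t : ℝ} (ht : t₀ ≤ t) :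
    ∫ ω, Ψ (counted ϖ φ lam g t ω) i j ∂P = Ψ (expect P (counted ϖ φ lam g t)) i j := by
  have hi := fun p q => (isTameProcess_counted hs h hr hA hL hwr hg p q).integrable h ht
  rw [linear_apply_eq_sum Ψ (expect _ _), integral_congr_ae (.of_forall fun ω =>
    linear_apply_eq_sum Ψ (counted ϖ φ lam g t ω) i j)]
  rw [integral_finsetSum _ fun p _ => integrable_finsetSum _ fun q _ => (hi p q).const_mul _]
  refine Finset.sum_congr rfl fun p _ => ?_
  rw [integral_finsetSum _ fun q _ => (hi p q).const_mul _]
  exact Finset.sum_congr rfl fun q _ => integral_const_mul _ _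

theorem continuousOn_expect_counted : ContinuousOn (fun t => expect P (counted ϖ φ lam g t))
    (Ici t₀) :=
  continuousOn_pi.2 fun i => continuousOn_pi.2 fun j =>
    (isTameProcess_counted hs h hr hA hL hwr hg i j).continuousOn_expectation h hr

omit hr hA hL hwr hg in
theorem expect_counted_start (hr : ∀ l, ContinuousOn (r l) (Ici t₀)) (g : ℕ → ℂ) :
    expect P (counted ϖ φ lam g t₀) = g 0 • Matrix.vecMulVec z (star z) := by
  ext i j
  have : (fun ω => counted ϖ φ lam g t₀ ω i j) =ᵐ[P]
      fun _ => (g 0 • Matrix.vecMulVec z (star z)) i j := by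
    filter_upwards [hs.ae_isSolutionPath h hr, h.zero] with ω h1 h2
    have e1 : φ t₀ ω = z := h1.φ_zero
    have e2 : lam t₀ ω = 1 := h1.lam_zero
    simp [counted, sigma, h2, e1, e2]
  change ∫ ω, counted ϖ φ lam g t₀ ω i j ∂P = _
  rw [integral_congr_ae this]
  simp

/-- Expectations are taken in the pathwise integral equation of `σ g(M)`; the compensator formula
replaces integration against `ϖ l` by integration against `r l`. -/
theorem expect_counted_eq (hpos : ∀ l t, t₀ ≤ t → 0 < r l t) (i j : Fin d) {t : ℝ}
    (ht : t₀ ≤ t) :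
    expect P (counted ϖ φ lam g t) i j = (g 0 • Matrix.vecMulVec z (star z)) i j
      + (∫ s in t₀..t, sandwichGenerator A s (expect P (counted ϖ φ lam g s)) i j)
      + ∑ l, ∫ s in t₀..t, (r l s : ℂ) *
        (conjLin ((w l s / r l s : ℝ) : ℂ) (L l s)
          (expect P (counted ϖ φ lam (fun n => g (n + 1)) s)) i j
          - expect P (counted ϖ φ lam g s) i j) := by
  have hg' : ∀ n, ‖g (n + 1)‖ ≤ C := fun n => hg (n + 1)
  have hsol := hs.ae_isSolutionPath h hr
  have hdrift := isTameProcess_linear hs h hr hA hL hwr hg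
    (continuousOn_sandwichGenerator hA) i j
  have hconj := fun l => isTameProcess_linear hs h hr hA hL hwr hg'
    (continuousOn_conjLin (hwr l) (hL l)) i j
  have hc := isTameProcess_counted hs h hr hA hL hwr hg i j
  -- The integrand is written with current values and with `g (n + 1)`; passing to left limits
  -- yields the jump coefficient immediately before the jump.
  let c : Fin m → ℝ → Ω → ℂ := fun l s ω =>
    conjLin ((w l s / r l s : ℝ) : ℂ) (L l s) (counted ϖ φ lam (fun n => g (n + 1)) s ω) i j
      + (-1) * counted ϖ φ lam g s ω i j
  have hcl : ∀ l, IsTameProcess P ℱ t₀ ϖ (c l) := fun l =>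
    (hconj l).add (hc.mul_continuous (f := fun _ => -1) continuousOn_const)
  obtain ⟨hI1, hE1⟩ := hdrift.integral_timeIntegral h hr ht
  have hJ := fun l => (hcl l).integral_jumpIntegral h hr hpos l ht
  have hpath : (fun ω => counted ϖ φ lam g t ω i j) =ᵐ[P] fun ω =>
      counted ϖ φ lam g t₀ ω i j
      + (∫ s in t₀..t, sandwichGenerator A s (counted ϖ φ lam g s ω) i j)
      + ∑ l, jumpIntegral (fun s => ϖ l s ω) (Function.leftLim fun s => c l s ω) t₀ t := by
    filter_upwards [hsol, hdrift.cadlag] with ω hω hcad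
    have hF : (fun s => sandwichGenerator A s (counted ϖ φ lam g s ω) i j) = fun s =>
        sandwichGenerator A s (weightedProj (φ s ω) (lam s ω)) i j * g (∑ l, ϖ l s ω) := by
      funext s
      rw [counted, map_smul, Matrix.smul_apply, smul_eq_mul, mul_comm]
      rfl
    rw [hF] at hcad ⊢
    have := (hω.isJumpDiff_counted hA g i j).eq_integral_add hω.jump hcad ht
    simp only [counted_apply]
    rw [this]
    congr 1
    refine Finset.sum_congr rfl fun l _ => finsum_mem_congr rfl fun s hs => ?_
    congr 1
    have hM := isJumpPath_sum hω.jump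
    have h1 := tendsto_linear_left (continuousOn_conjLin (hwr l) (hL l)) hω.isCadlagFrom_weightedProj
      hM (fun n => g (n + 1)) i j hs.1
    have h2 := tendsto_linear_left (Ψ := fun _ => LinearMap.id) (fun _ => continuousOn_const)
      hω.isCadlagFrom_weightedProj hM g i j hs.1
    refine (leftLim_eq_of_tendsto ((h1.sub h2).congr fun u => ?_)).symm
    simp only [c, counted_apply, LinearMap.id_apply, neg_one_mul, ← sub_eq_add_neg]
    rw [counted, map_smul, Matrix.smul_apply, smul_eq_mul,
      mul_comm (g (∑ l, ϖ l u ω + 1))]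
    rfl
  have hstart := congrFun (congrFun (expect_counted_start hs h hr g) i) j
  change ∫ ω, counted ϖ φ lam g t ω i j ∂P = _
  refine (integral_congr_ae hpath).trans ((integral_add_add (hc.integrable h le_rfl) hI1
    (integrable_finsetSum _ fun l _ => (hJ l).1)).trans ?_)
  rw [hE1, integral_finsetSum _ fun l _ => (hJ l).1, ← hstart]
  congr 1
  · congr 1
    refine intervalIntegral.integral_congr fun s hst => ?_
    rw [uIcc_of_le ht] at hst
    exact integral_linear hs h hr hA hL hwr hg _ i j hst.1
  · refine Finset.sum_congr rfl fun l _ => ?_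
    rw [(hJ l).2]
    refine intervalIntegral.integral_congr fun s hst => ?_
    rw [uIcc_of_le ht] at hst
    simp only [c]
    rw [integral_add ((hconj l).integrable h hst.1) ((hc.integrable h hst.1).const_mul _),
      integral_const_mul, neg_one_mul, ← sub_eq_add_neg,
      integral_linear hs h hr hA hL hwr hg' _ i j hst.1]
    rfl

end

/-- The rates disappear: the terms `r σ` of the drift cancel against those of the compensators, and
`r (w/r) = w`. The gain terms contain the shifted weight because every jump raises the count by one.
-/
theorem hasOpDeriv_expect_counted [IsProbabilityMeasure P]
    (hs : IsOstensibleSolution P ℱ t₀ (drift H L w r) L w r ϖ z φ lam)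
    (h : IsPoissonSystem P ℱ t₀ r ϖ) (hr : ∀ l, ContinuousOn (r l) (Ici t₀))
    (hpos : ∀ l t, t₀ ≤ t → 0 < r l t) (hH : ContinuousOn H (Ici t₀))
    (hL : ∀ l, ContinuousOn (L l) (Ici t₀)) (hw : ∀ l, ContinuousOn (w l) (Ici t₀))
    {g : ℕ → ℂ} {C : ℝ} (hg : ∀ n, ‖g n‖ ≤ C) {t : ℝ} (ht : t₀ ≤ t) :
    HasOpDeriv (fun u => expect P (counted ϖ φ lam g u))
      (sandwichGenerator (effectiveGenerator H L w) t (expect P (counted ϖ φ lam g t))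
        + jumpPart L w t (expect P (counted ϖ φ lam (fun n => g (n + 1)) t))) t₀ t := by
  have hg' : ∀ n, ‖g (n + 1)‖ ≤ C := fun n => hg (n + 1)
  have hA := continuousOn_drift hH hL hw hr
  have hwr : ∀ l, ContinuousOn (fun t => w l t / r l t) (Ici t₀) := fun l =>
    (hw l).div (hr l) fun u hu => (hpos l u hu).ne'
  have hE := continuousOn_expect_counted hs h hr hA hL hwr hg
  have hE' := continuousOn_expect_counted hs h hr hA hL hwr hg'
  intro i j
  have h1 := hasDerivWithinAt_Ici_integral (continuousOn_entry ((hA.mul hE).add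
    (hE.mul (continuousOn_conjTranspose hA))) i j) ht
  have h2 := fun l => hasDerivWithinAt_Ici_integral
    ((Complex.continuous_ofReal.comp_continuousOn (hr l)).mul ((continuousOn_entry
      (continuousOn_ofReal_smul (hwr l) (((hL l).mul hE').mul
        (continuousOn_conjTranspose (hL l)))) i j).sub (continuousOn_entry hE i j))) ht
  have h3 := ((h1.const_add ((g 0 • Matrix.vecMulVec z (star z)) i j)).add
    (HasDerivWithinAt.fun_sum (u := Finset.univ) fun l _ => h2 l)).congr
      (f₁ := fun u => expect P (counted ϖ φ lam g u) i j)
      (fun u hu => expect_counted_eq hs h hr hA hL hwr hg hpos i j hu)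
      (expect_counted_eq hs h hr hA hL hwr hg hpos i j ht)
  refine h3.congr_deriv ?_
  have h4 := congrFun (congrFun (sandwichGenerator_drift (H := H) (L := L) (w := w) (r := r) t
    (expect P (counted ϖ φ lam g t))) i) j
  have h5 : ∀ l, (r l t : ℂ) * ((((w l t / r l t : ℝ) : ℂ) • (L l t *
      expect P (counted ϖ φ lam (fun n => g (n + 1)) t) * (L l t)ᴴ)) i j
        - expect P (counted ϖ φ lam g t) i j) =
      ((w l t : ℂ) • (L l t * expect P (counted ϖ φ lam (fun n => g (n + 1)) t) * (L l t)ᴴ)) i j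
        - ((r l t : ℂ) • expect P (counted ϖ φ lam g t)) i j := fun l => by
    have := (hpos l t ht).ne'
    rw [Matrix.smul_apply, Matrix.smul_apply, Matrix.smul_apply, smul_eq_mul, smul_eq_mul,
      smul_eq_mul, mul_sub, ← mul_assoc, ← Complex.ofReal_mul, mul_div_cancel₀ _ this]
  rw [sandwichGenerator_apply] at h4
  refine (congrArg₂ (· + ·) h4 (Finset.sum_congr rfl fun l _ => h5 l)).trans ?_
  simp only [Finset.sum_sub_distrib, jumpPart, Matrix.add_apply, Matrix.sum_apply]
  ring

end Counted

/-! ### The expectation and the contribution of the trajectories with one jump -/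

section MainResults

variable {Ω : Type*} [mΩ : MeasurableSpace Ω] {P : Measure Ω} {ℱ : Filtration ℝ mΩ} {t₀ : ℝ}
  {d m : ℕ} {H : ℝ → Op d} {L : Fin m → ℝ → Op d} {w r : Fin m → ℝ → ℝ}
  {ϖ : Fin m → ℝ → Ω → ℕ} {z : Fin d → ℂ} {φ : ℝ → Ω → Fin d → ℂ} {lam : ℝ → Ω → ℝ}

omit mΩ in
theorem counted_one : counted ϖ φ lam (fun _ => 1) = sigma φ lam := by
  funext t ω
  exact one_smul _ _

theorem expect_restrict_jumps (h : IsPoissonSystem P ℱ t₀ r ϖ) {t : ℝ} (ht : t₀ ≤ t) (k : ℕ) :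
    expect (P.restrict {ω | ∑ l, ϖ l t ω = k}) (sigma φ lam t) =
      expect P (counted ϖ φ lam (fun n => if n = k then 1 else 0) t) := by
  have hS : MeasurableSet {ω | ∑ l, ϖ l t ω = k} :=
    (Finset.measurable_fun_sum _ fun l _ => h.measurable l ht) (measurableSet_singleton k)
  ext i j
  change ∫ ω in {ω | ∑ l, ϖ l t ω = k}, sigma φ lam t ω i j ∂P = ∫ ω, _ ∂P
  rw [← integral_indicator hS]
  refine integral_congr_ae (.of_forall fun ω => ?_)
  by_cases hω : ∑ l, ϖ l t ω = k
  · exact (indicator_of_mem (s := {ω | ∑ l, ϖ l t ω = k}) hω _).trans (by simp [counted, hω])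
  · exact (indicator_of_notMem (s := {ω | ∑ l, ϖ l t ω = k}) hω _).trans (by simp [counted, hω])

section

variable (hs : IsOstensibleSolution P ℱ t₀ (drift H L w r) L w r ϖ z φ lam)
  [IsProbabilityMeasure P] (h : IsPoissonSystem P ℱ t₀ r ϖ)
  (hr : ∀ l, ContinuousOn (r l) (Ici t₀)) (hpos : ∀ l t, t₀ ≤ t → 0 < r l t)
  (hH : ContinuousOn H (Ici t₀)) (hL : ∀ l, ContinuousOn (L l) (Ici t₀))
  (hw : ∀ l, ContinuousOn (w l) (Ici t₀))

include hs h hr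

theorem expect_sigma_start : expect P (sigma φ lam t₀) = Matrix.vecMulVec z (star z) := by
  rw [← counted_one, expect_counted_start hs h hr, one_smul]

include hpos hH hL hw

theorem integrable_sigma {t : ℝ} (ht : t₀ ≤ t) (i j : Fin d) :
    Integrable (fun ω => sigma φ lam t ω i j) P := by
  have := (isTameProcess_counted hs h hr (continuousOn_drift hH hL hw hr) hL
    (fun l => (hw l).div (hr l) fun u hu => (hpos l u hu).ne') (g := fun _ => 1) (C := 1)
    (by simp) i j).integrable h ht
  rwa [counted_one] at this

theorem hasOpDeriv_expect_sigma {t : ℝ} (ht : t₀ ≤ t) :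
    HasOpDeriv (fun u => expect P (sigma φ lam u))
      (masterLin H L w t (expect P (sigma φ lam t))) t₀ t := by
  have := hasOpDeriv_expect_counted hs h hr hpos hH hL hw (g := fun _ => 1) (C := 1) (by simp) ht
  rwa [counted_one, ← masterLin_apply] at this

theorem trace_expect_sigma (hHsa : ∀ t, t₀ ≤ t → (H t).IsHermitian) {t : ℝ} (ht : t₀ ≤ t) :
    (expect P (sigma φ lam t)).trace = star z ⬝ᵥ z := by
  have hder : ∀ u, t₀ ≤ u → HasDerivWithinAt (fun u => (expect P (sigma φ lam u)).trace) 0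
      (Ici t₀) u := fun u hu => by
    have h1 := HasDerivWithinAt.fun_sum (u := Finset.univ) fun i _ =>
      hasOpDeriv_expect_sigma hs h hr hpos hH hL hw hu i i
    refine h1.congr_deriv ?_
    change (masterLin H L w u _).trace = 0
    rw [masterLin_apply, ← masterGenerator_eq (hHsa u hu), trace_masterGenerator]
  have hconst := constant_of_has_deriv_right_zero (a := t₀) (b := t)
    (f := fun u => (expect P (sigma φ lam u)).trace)
    (fun u hu => ((hder u hu.1).continuousWithinAt).mono Icc_subset_Ici_self)
    (fun u hu => (hder u hu.1).mono (Ici_subset_Ici.2 hu.1)) t ⟨ht, le_rfl⟩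
  rw [hconst, expect_sigma_start hs h hr, Matrix.trace_vecMulVec, dotProduct_comm]

/-- The shift takes the indicator of `1` to the indicator of `0`, and the latter to zero. The
equations for zero jumps and one jump thus form a closed triangular system. -/
theorem expect_one_jump {t : ℝ} (ht : t₀ ≤ t) :
    expect (P.restrict {ω | ∑ l, ϖ l t ω = 1}) (sigma φ lam t) =
      oneJumpMap H L w w t₀ t (Matrix.vecMulVec z (star z)) := by
  rw [expect_restrict_jumps h ht 1]
  have hb : ∀ k n : ℕ, ‖(if n = k then (1 : ℂ) else 0)‖ ≤ 1 := fun k n => by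
    split_ifs <;> simp
  refine eq_oneJumpMap hH hL hw
    (R₀ := fun u => expect P (counted ϖ φ lam (fun n => if n = 0 then 1 else 0) u))
    (R₁ := fun u => expect P (counted ϖ φ lam (fun n => if n = 1 then 1 else 0) u))
    ?_ (fun u hu => ?_) ?_ (fun u hu => ?_) ht
  · simp [expect_counted_start hs h hr]
  · have h1 := hasOpDeriv_expect_counted hs h hr hpos hH hL hw (hb 0) hu
    -- The shift of the indicator of `{0}` is zero, so trajectories without jumps have no source
    -- term.
    have h2 : expect P (counted ϖ φ lam (fun _ => 0) u) = 0 := by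
      ext i j
      simp [expect, counted]
    simpa [h2, jumpPart] using h1
  · simp [expect_counted_start hs h hr]
  · have h1 := hasOpDeriv_expect_counted hs h hr hpos hH hL hw (hb 1) hu
    simpa only [Nat.add_eq_right] using h1

end

end MainResults

end Ostensible

/-! ### The main theorem. -/

open Ostensible in
theorem mainTheorem2 {d m : ℕ} (t₀ : ℝ)
    (H : ℝ → Op d) (L : Fin m → ℝ → Op d) (w : Fin m → ℝ → ℝ)
    (hH : ContinuousOn H (Ici t₀)) (hHsa : ∀ t, t₀ ≤ t → (H t).IsHermitian)
    (hL : ∀ l, ContinuousOn (L l) (Ici t₀)) (hw : ∀ l, ContinuousOn (w l) (Ici t₀)) :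
    -- the one-jump operator sum is a difference of two completely positive maps
    (∀ t, t₀ ≤ t →
      IsCompletelyPositive (oneJumpMap H L w (fun l u => max 0 (w l u)) t₀ t) ∧
      IsCompletelyPositive (oneJumpMap H L w (fun l u => max 0 (-w l u)) t₀ t) ∧
      ∀ ρ, oneJumpMap H L w w t₀ t ρ =
        oneJumpMap H L w (fun l u => max 0 (w l u)) t₀ t ρ
          - oneJumpMap H L w (fun l u => max 0 (-w l u)) t₀ t ρ) ∧
    -- completely positive maps which depend on neither the rates, nor the initial datum,
    -- nor the realization of the process
    ∃ Φp Φm : ℝ → Op d → Op d,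
      (∀ t, t₀ ≤ t → IsCompletelyPositive (Φp t) ∧ IsCompletelyPositive (Φm t) ∧
        ∃ (f : Fin (d ^ 2) → ℝ) (V : Fin (d ^ 2) → Op d), ∀ ρ,
          Φp t ρ - Φm t ρ = ∑ n, (Real.sign (f n) : ℂ) • (V n * ρ * (V n)ᴴ)) ∧
      ∀ (r : Fin m → ℝ → ℝ), (∀ l, ContinuousOn (r l) (Ici t₀)) →
        (∀ l t, t₀ ≤ t → 0 < r l t) →
      ∀ {Ω : Type*} [mΩ : MeasurableSpace Ω] (P : Measure Ω) [IsProbabilityMeasure P]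
        (ℱ : Filtration ℝ mΩ) (ϖ : Fin m → ℝ → Ω → ℕ), IsPoissonSystem P ℱ t₀ r ϖ →
      ∀ (z : Fin d → ℂ) (φ : ℝ → Ω → Fin d → ℂ) (lam : ℝ → Ω → ℝ),
        IsOstensibleSolution P ℱ t₀ (drift H L w r) L w r ϖ z φ lam →
      -- the stochastic evolution equation of `σ`
      (∀ᵐ ω ∂P, ∀ t, t₀ ≤ t →
        sigma φ lam t ω = Matrix.vecMulVec z (star z)
          + timeIntegral (fun s => masterGenerator H L w s (sigma φ lam s ω)) t₀ t
          + ∑ l, (jumpIntegral (fun s => ϖ l s ω)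
                (fun s => jumpCoeff (L l s) (w l s) (r l s)
                  (Function.leftLim (fun u => sigma φ lam u ω) s)) t₀ t
              - timeIntegral (fun s => (r l s : ℂ) •
                  jumpCoeff (L l s) (w l s) (r l s) (sigma φ lam s ω)) t₀ t)) ∧
      -- the expectation exists and solves the master equation
      (∀ t, t₀ ≤ t → ∀ i j, Integrable (fun ω => sigma φ lam t ω i j) P) ∧
      expect P (sigma φ lam t₀) = Matrix.vecMulVec z (star z) ∧
      (∀ t, t₀ ≤ t → ∀ i j, HasDerivWithinAt (fun s => expect P (sigma φ lam s) i j)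
        (masterGenerator H L w t (expect P (sigma φ lam t)) i j) (Ici t₀) t) ∧
      (∀ t, t₀ ≤ t → (expect P (sigma φ lam t)).trace = star z ⬝ᵥ z) ∧
      -- the contribution of the trajectories with exactly one jump
      (∀ t, t₀ ≤ t → expect (P.restrict {ω | ∑ l, ϖ l t ω = 1}) (sigma φ lam t) =
        oneJumpMap H L w w t₀ t (Matrix.vecMulVec z (star z))) ∧
      -- the unconditional expectation as a difference of two completely positive terms
      (∀ t, t₀ ≤ t → expect P (sigma φ lam t) =
        Φp t (Matrix.vecMulVec z (star z)) - Φm t (Matrix.vecMulVec z (star z))) := by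
  have hwp : ∀ l, ContinuousOn (fun u => max 0 (w l u)) (Ici t₀) := fun l =>
    continuousOn_const.sup (hw l)
  have hwm : ∀ l, ContinuousOn (fun u => max 0 (-w l u)) (Ici t₀) := fun l =>
    continuousOn_const.sup (hw l).neg
  refine ⟨fun t ht => ⟨isCompletelyPositive_oneJumpMap hH hL hw hwp ht fun _ _ _ => le_max_left _ _,
    isCompletelyPositive_oneJumpMap hH hL hw hwm ht fun _ _ _ => le_max_left _ _, fun ρ => ?_⟩, ?_⟩
  · rw [← oneJumpMap_sub hH hL hw hwp hwm ht ρ]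
    congr 1
    funext l u
    rw [max_comm, max_comm 0 (-w l u), max_zero_sub_max_neg_zero_eq_self]
  obtain ⟨Λ, hΛ0, hΛ, hΛstar⟩ := exists_masterFlow hH hL hw
  -- The maps are extracted from the flow of the master equation before rates, probability space and
  -- initial vector are introduced, which is what makes them independent of these.
  choose! Φp Φm hΦp hΦm hΛΦ hΦ using fun t (ht : t₀ ≤ t) =>
    exists_completelyPositive_decomposition (hΛstar t ht)
  refine ⟨Φp, Φm, fun t ht => ⟨hΦp t ht, hΦm t ht, hΦ t ht⟩, ?_⟩
  intro r hr hpos Ω mΩ P _ ℱ ϖ h z φ lam hs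
  refine ⟨?_, fun t ht i j => integrable_sigma hs h hr hpos hH hL hw ht i j,
    expect_sigma_start hs h hr, fun t ht i j => ?_,
    fun t ht => trace_expect_sigma hs h hr hpos hH hL hw hHsa ht,
    fun t ht => expect_one_jump hs h hr hpos hH hL hw ht, fun t ht => ?_⟩
  · filter_upwards [hs.ae_isSolutionPath h hr] with ω hω t ht
    exact hω.sigma_equation hH hHsa hL hw hr hpos ht
  · rw [masterGenerator_eq (hHsa t ht), ← masterLin_apply]
    exact hasOpDeriv_expect_sigma hs h hr hpos hH hL hw ht i j
  -- The expectation and the flow applied to `zz†` solve the same initial value problem.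
  · rw [← hΛΦ t ht]
    refine eq_of_hasOpDeriv (g := fun _ => 0) (continuousOn_masterLin hH hL hw)
      (X := fun u => expect P (sigma φ lam u)) (Y := fun u => Λ u (Matrix.vecMulVec z (star z)))
      (fun u hu => ?_) (fun u hu => ?_) ?_ ht
    · simpa only [add_zero] using hasOpDeriv_expect_sigma hs h hr hpos hH hL hw hu
    · simpa only [add_zero] using hΛ _ u hu
    · rw [hΛ0, expect_sigma_start hs h hr]
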